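/- **Setting.** Let $\mathcal C$ be a set of names, $\mathcal A=\mathcal C\,\dot\cup\,\bar{\mathcal C}$ the visible actions, $Act=\mathcal A\,\dot\cup\,\{\tau\}$, and let $\mathcal V$ be an infinite set of process variables. CCS expressions are built from action prefixing $\alpha.E$, choice $\sum_{i\in I}E_i$ over arbitrary index sets, parallel composition $E|F$, restriction $E\backslash L$ ($L\subseteq\mathcal C$), relabelling $E[f]$ ($f:\mathcal C\to\mathcal C$), variables, and recursion $\langle X|S\rangle$ for an arbitrary recursive specification $S:\mathcal V\rightharpoonup$ expressions with $X\in\mathrm{dom}(S)$, with Milner's structural operational semantics. *Processes* are the closed expressions. A *test* is defined like a process, but may also use a success action $\omega$; a *reward test* is defined like a process, with prefixes $(\alpha,r)\in Act\times\mathbb R$ (synchronising actions add their rewards; processes are reward tests with all rewards $0$). A computation of $T|P$ is a maximal (finite or infinite) sequence of $\tau$-steps from $T|P$; for tests it is *successful* if it contains a state with an outgoing $\omega$-transition. The *reward* of a computation of $T|P$, with $T$ a reward test, is the sum $\sum_i r_i$ of the rewards of its steps if it is finite, and $\liminf_{n}\sum_{i=1}^n r_i\in[-\infty,\infty]$ if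 it is infinite. Let $P\sqsubseteq_{\rm may}Q$ iff for every test $T$, if $T|P$ has a successful computation, then so has $T|Q$; $P\sqsubseteq_{\rm must}Q$ iff for every $T$, if all computations of $T|P$ are successful, then so are all those of $T|Q$; $P\sqsubseteq_{\rm must}^{\rm dual}Q$ iff for every $T$, if no computation of $T|P$ is successful, then none of $T|Q$ is. Let $P\sqsubseteq_{\rm reward}Q$ iff for every reward test $T$ and every reward $o$ of a computation of $T|Q$ there is a computation of $T|P$ with reward $\le o$. The preorders $\sqsubseteq_{\rm fp\text-reward}$, $\sqsubseteq_{+\rm reward}$, $\sqsubseteq_{-\rm reward}$, $\sqsubseteq_{\rm fp\text--reward}$ are obtained by allowing only those $T$ in which, respectively, each infinite path has only finitely many negative rewards; all rewards are $\ge0$; all rewards are $\le0$; each infinite path has only finitely many negative rewards and all rewards are $\le 0$. For a state $P$ of a labelled transition system (LTS) over $\mathcal A\cup\{\tau\}$, with $\Rightarrow^\sigma$ the weak transition relation: $ptr(P)=\{\sigma\in\mathcal A^*\mid \exists Q.\,P\Rightarrow^\sigma Q\}$; $inf(P)\subseteq\mathcal A^\infty$ is the set of infinite traces; $div(P)$ consists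 of those $\sigma\in\mathcal A^*$ such that $P\Rightarrow^\sigma Q$ for some $Q$ with an infinite sequence of $\tau$-steps; $deadl(P)$ of those with $P\Rightarrow^\sigma Q$ for some $Q$ without outgoing transitions; $ct(P)=inf(P)\cup div(P)\cup deadl(P)$; $fail(P)$ of the pairs $(\sigma,X)$, $X\subseteq\mathcal A$, such that $P\Rightarrow^\sigma Q$ for some $Q$ that can do neither $\tau$ nor any action of $X$. Further $fail_d(P)=fail(P)\cup\{(\sigma,X)\mid\sigma\in div(P)\}$; $inf_d(P)=inf(P)\cup\{\nu\mid$ each finite prefix of $\nu$ can be prolonged to a finite prefix of $\nu$ in $div(P)\}$; and $div_\bot(P)$, $inf_\bot(P)$, $fail_\bot(P)$ are obtained from $div(P)$, $inf(P)$, $fail(P)$ by adding all finite sequences $\sigma$, infinite sequences $\nu$, and pairs $(\sigma,X)$, respectively, for which $\sigma$ (resp. $\nu$) has a prefix in $div(P)$. Let - $P\sqsubseteq_{NDFD}Q$ iff $div(P)\supseteq div(Q)$, $inf(P)\supseteq inf(Q)$, $fail_d(P)\supseteq fail_d(Q)$; - $P\sqsubseteq_{FDI}^dQ$ iff $div(P)\supseteq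 div(Q)$, $inf_d(P)\supseteq inf_d(Q)$, $fail_d(P)\supseteq fail_d(Q)$; - $P\sqsubseteq_{FDI}^\bot Q$ iff $div_\bot(P)\supseteq div_\bot(Q)$, $inf_\bot(P)\supseteq inf_\bot(Q)$, $fail_\bot(P)\supseteq fail_\bot(Q)$; - $P\sqsubseteq_T^\infty Q$ iff $ptr(P)\supseteq ptr(Q)$ and $inf(P)\supseteq inf(Q)$; and $P\sqsubseteq_TQ$ iff $ptr(P)\supseteq ptr(Q)$. A linear-time property $\Phi\subseteq\mathcal A^*\cup\mathcal A^\infty$ holds for $P$ iff $ct(P)\subseteq\Phi$. The liveness property given by $G\subseteq\mathcal A^*$ holds iff each complete trace of $P$ has a prefix in $G$; the conditional liveness property given by $C,G\subseteq\mathcal A^*$ iff each complete trace of $P$ with a prefix in $C$ has a prefix in $G$; the safety property given by $B\subseteq\mathcal A^*$ iff $ptr(P)\cap B=\emptyset$. A preorder preserves such properties if $P\sqsubseteq Q$ implies that $Q$ has every such property that $P$ has. Let $\sqsubseteq_{lt}$, $\sqsubseteq_{cond.\,liveness}$, $\sqsubseteq_{liveness}$, $\sqsubseteq_{safety}$ be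 the coarsest preorders on processes in LTSs over $\mathcal A\cup\{\tau\}$ that preserve linear-time, conditional liveness, liveness and safety properties, respectively, and are precongruences for the operators of CSP (action prefixing, internal and external choice, partially synchronous interleaving $\|_S$ for $S\subseteq\mathcal A$, concealment, renaming), restricted to CCS processes. **Theorem.** (1) On CCS processes, - ${\sqsubseteq_{\rm reward}}={\sqsubseteq_{NDFD}}$; - ${\sqsubseteq_{-\rm reward}}={\sqsubseteq_T^\infty}$; - ${\sqsubseteq_{\rm fp\text-reward}}={\sqsubseteq_{FDI}^d}$; - ${\sqsubseteq_{\rm must}}={\sqsubseteq_{+\rm reward}}={\sqsubseteq_{FDI}^\bot}$; - ${\sqsubseteq_{\rm may}^{-1}}={\sqsubseteq_{\rm must}^{\rm dual}}={\sqsubseteq_{\rm fp\text--reward}}={\sqsubseteq_T}$. (2) The preorder $\sqsubseteq_{safety}$ exists and equals $\sqsubseteq_{\rm fp\text--reward}$. If $\mathcal C$ is infinite, then $\sqsubseteq_{lt}$, $\sqsubseteq_{cond.\,liveness}$ and $\sqsubseteq_{liveness}$ exist and equal $\sqsubseteq_{\rm reward}$, $\sqsubseteq_{\rm fp\text-reward}$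 and $\sqsubseteq_{\rm must}$, respectively. In all four cases, the same preorder on processes in LTSs is also the coarsest one when one merely asks for a precongruence for injective renaming and partially synchronous interleaving. (3) ${\sqsubseteq_{\rm reward}}\subseteq{\sqsubseteq_{-\rm reward}}\subseteq{\sqsubseteq_{\rm fp\text--reward}}$, ${\sqsubseteq_{\rm reward}}\subseteq{\sqsubseteq_{\rm fp\text-reward}}\subseteq{\sqsubseteq_{\rm fp\text--reward}}$ and ${\sqsubseteq_{\rm fp\text-reward}}\subseteq{\sqsubseteq_{+\rm reward}}$. (4) If $\mathcal C\ne\emptyset$, these five inclusions are strict, and the following pairs are incomparable: $\sqsubseteq_{-\rm reward}$ and $\sqsubseteq_{\rm fp\text-reward}$; $\sqsubseteq_{-\rm reward}$ and $\sqsubseteq_{+\rm reward}$; $\sqsubseteq_{+\rm reward}$ and $\sqsubseteq_{\rm fp\text--reward}$. Moreover, writing $\equiv$ for the equivalence associated to a preorder, there are processes $P,Q$ with $P\equiv_{\rm fp\text-reward}Q$ and $P\not\sqsubseteq_{-\rm reward}Q$; there are $P,Q$ with $P\equiv_{\rm must}Q$, $P\equiv_{-\rm reward}Q$ and $P\not\sqsubseteq_{\rm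 fp\text-reward}Q$; there are $P,Q$ with $P\equiv_{\rm fp\text--reward}Q$ and $P\not\sqsubseteq_{+\rm reward}Q$; and there are $P,Q$ with $P\equiv_{+\rm reward}Q$ and $P\not\sqsubseteq_{\rm fp\text--reward}Q$. -/

import Mathlib

universe u v w

namespace RewardTesting

/-! ### Labelled transition systems over `A ∪ {τ}` and their traces -/

/-- Actions over a set `A` of visible actions: the elements of `A` and the internal action `τ`. -/
inductive Act (A : Type u) : Type u
  | tau : Act A
  | vis (a : A) : Act A

/-- A process in a labelled transition system: a labelled transition system over `A ∪ {τ}` together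
with one of its states. -/
structure LTS (A : Type u) where
  State : Type v
  tr : State → Act A → State → Prop
  init : State

/-- `Weak tr p σ q`: from `p` one can reach `q` by performing the visible actions `σ`, in this order,
interspersed with any number of internal actions. -/
inductive Weak {A : Type u} {S : Type v} (tr : S → Act A → S → Prop) : S → List A → S → Prop
  | refl (p : S) : Weak tr p [] p
  | tau {p q r : S} {σ : List A} : tr p Act.tau q → Weak tr q σ r → Weak tr p σ r
  | vis {p q r : S} {a : A} {σ : List A} :
      tr p (Act.vis a) q → Weak tr q σ r → Weak tr p (a :: σ) r

/-- The finite sequence `σ` is a prefix of the infinite sequence `ν`. -/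
def PrefixInf {A : Type u} (σ : List A) (ν : ℕ → A) : Prop :=
  σ = (List.range σ.length).map ν

namespace LTS

variable {A : Type u} (P : LTS.{u, v} A)

def infTraces : Set (ℕ → A) :=
  {ν | ∃ s : ℕ → P.State, s 0 = P.init ∧ ∀ n, Weak P.tr (s n) [ν n] (s (n + 1))}

/-- A state diverges if it starts an infinite sequence of internal actions. -/
def Diverges (p : P.State) : Prop :=
  ∃ s : ℕ → P.State, s 0 = p ∧ ∀ n, P.tr (s n) Act.tau (s (n + 1))

def divergences : Set (List A) :=
  {σ | ∃ q, Weak P.tr P.init σ q ∧ P.Diverges q}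

/-- The actions, including `τ`, that a state can perform. -/
def initials (p : P.State) : Set (Act A) :=
  {α | ∃ q, P.tr p α q}

def deadlocks : Set (List A) :=
  {σ | ∃ q, Weak P.tr P.init σ q ∧ P.initials q = ∅}

def ptraces : Set (List A) :=
  {σ | ∃ q, Weak P.tr P.init σ q}

/-- Complete traces; finite ones are tagged `Sum.inl` and infinite ones `Sum.inr`. -/
def ctraces : Set (List A ⊕ (ℕ → A)) :=
  Sum.inr '' P.infTraces ∪ Sum.inl '' P.divergences ∪ Sum.inl '' P.deadlocks

def failures : Set (List A × Set A) :=
  {f | ∃ q, Weak P.tr P.init f.1 q ∧ P.initials q ∩ (Act.vis '' f.2 ∪ {Act.tau}) = ∅}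

def failuresD : Set (List A × Set A) :=
  P.failures ∪ {f | f.1 ∈ P.divergences}

def infD : Set (ℕ → A) :=
  P.infTraces ∪
    {ν | ∀ σ, PrefixInf σ ν → ∃ ρ ∈ P.divergences, σ <+: ρ ∧ PrefixInf ρ ν}

def divergencesBot : Set (List A) :=
  {σ | ∃ ρ ∈ P.divergences, ρ <+: σ}

def infBot : Set (ℕ → A) :=
  P.infTraces ∪ {ν | ∃ ρ ∈ P.divergences, PrefixInf ρ ν}

def failuresBot : Set (List A × Set A) :=
  P.failures ∪ {f | ∃ ρ ∈ P.divergences, ρ <+: f.1}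

end LTS

/-! ### The explicitly characterised preorders -/

section Explicit

variable {A : Type u} (P Q : LTS.{u, v} A)

def NDFD : Prop :=
  Q.divergences ⊆ P.divergences ∧ Q.infTraces ⊆ P.infTraces ∧ Q.failuresD ⊆ P.failuresD

def FDId : Prop :=
  Q.divergences ⊆ P.divergences ∧ Q.infD ⊆ P.infD ∧ Q.failuresD ⊆ P.failuresD

def FDIbot : Prop :=
  Q.divergencesBot ⊆ P.divergencesBot ∧ Q.infBot ⊆ P.infBot ∧ Q.failuresBot ⊆ P.failuresBot

def TraceInf : Prop :=
  Q.ptraces ⊆ P.ptraces ∧ Q.infTraces ⊆ P.infTraces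

def Trace : Prop :=
  Q.ptraces ⊆ P.ptraces

end Explicit

/-! ### Linear-time, liveness, safety and conditional liveness properties -/

section Properties

variable {A : Type u}

/-- The finite or infinite sequence `t` has a prefix in `G`. -/
def HasPrefixIn (t : List A ⊕ (ℕ → A)) (G : Set (List A)) : Prop :=
  ∃ ρ ∈ G, Sum.elim (fun σ => ρ <+: σ) (fun ν => PrefixInf ρ ν) t

def SatLinearTime (P : LTS.{u, v} A) (Φ : Set (List A ⊕ (ℕ → A))) : Prop :=
  P.ctraces ⊆ Φ

def SatLiveness (P : LTS.{u, v} A) (G : Set (List A)) : Prop :=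
  ∀ t ∈ P.ctraces, HasPrefixIn t G

def SatCondLiveness (P : LTS.{u, v} A) (C G : Set (List A)) : Prop :=
  ∀ t ∈ P.ctraces, HasPrefixIn t C → HasPrefixIn t G

def SatSafety (P : LTS.{u, v} A) (B : Set (List A)) : Prop :=
  P.ptraces ∩ B = ∅

variable (R : LTS.{u, v} A → LTS.{u, v} A → Prop)

def PreservesLinearTime : Prop :=
  ∀ P Q, R P Q → ∀ Φ, SatLinearTime P Φ → SatLinearTime Q Φ

def PreservesLiveness : Prop :=
  ∀ P Q, R P Q → ∀ G, SatLiveness P G → SatLiveness Q G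

def PreservesCondLiveness : Prop :=
  ∀ P Q, R P Q → ∀ C G, SatCondLiveness P C G → SatCondLiveness Q C G

def PreservesSafety : Prop :=
  ∀ P Q, R P Q → ∀ B, SatSafety P B → SatSafety Q B

end Properties

/-! ### The operators of CSP on labelled transition systems -/

namespace LTS

variable {A : Type u}

inductive PreTr (a : A) (P : LTS.{u, v} A) : Option P.State → Act A → Option P.State → Prop
  | start : PreTr a P none (Act.vis a) (some P.init)
  | run {p q : P.State} {α : Act A} : P.tr p α q → PreTr a P (some p) α (some q)

/-- Action prefixing `a → P`. -/
def pre (a : A) (P : LTS.{u, v} A) : LTS.{u, v} A :=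
  ⟨Option P.State, PreTr a P, none⟩

inductive IntTr (P Q : LTS.{u, v} A) :
    Option (P.State ⊕ Q.State) → Act A → Option (P.State ⊕ Q.State) → Prop
  | chooseL : IntTr P Q none Act.tau (some (Sum.inl P.init))
  | chooseR : IntTr P Q none Act.tau (some (Sum.inr Q.init))
  | left {p p' : P.State} {α : Act A} :
      P.tr p α p' → IntTr P Q (some (Sum.inl p)) α (some (Sum.inl p'))
  | right {q q' : Q.State} {α : Act A} :
      Q.tr q α q' → IntTr P Q (some (Sum.inr q)) α (some (Sum.inr q'))

/-- Internal choice `P ⊓ Q`. -/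
def intChoice (P Q : LTS.{u, v} A) : LTS.{u, v} A :=
  ⟨Option (P.State ⊕ Q.State), IntTr P Q, none⟩

inductive ExtTr (P Q : LTS.{u, v} A) :
    (P.State × Q.State) ⊕ (P.State ⊕ Q.State) → Act A →
      (P.State × Q.State) ⊕ (P.State ⊕ Q.State) → Prop
  | tauL {p p' : P.State} {q : Q.State} :
      P.tr p Act.tau p' → ExtTr P Q (Sum.inl (p, q)) Act.tau (Sum.inl (p', q))
  | tauR {p : P.State} {q q' : Q.State} :
      Q.tr q Act.tau q' → ExtTr P Q (Sum.inl (p, q)) Act.tau (Sum.inl (p, q'))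
  | visL {p p' : P.State} {q : Q.State} {a : A} :
      P.tr p (Act.vis a) p' → ExtTr P Q (Sum.inl (p, q)) (Act.vis a) (Sum.inr (Sum.inl p'))
  | visR {p : P.State} {q q' : Q.State} {a : A} :
      Q.tr q (Act.vis a) q' → ExtTr P Q (Sum.inl (p, q)) (Act.vis a) (Sum.inr (Sum.inr q'))
  | left {p p' : P.State} {α : Act A} :
      P.tr p α p' → ExtTr P Q (Sum.inr (Sum.inl p)) α (Sum.inr (Sum.inl p'))
  | right {q q' : Q.State} {α : Act A} :
      Q.tr q α q' → ExtTr P Q (Sum.inr (Sum.inr q)) α (Sum.inr (Sum.inr q'))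

/-- External choice `P □ Q`; internal actions do not resolve the choice. -/
def extChoice (P Q : LTS.{u, v} A) : LTS.{u, v} A :=
  ⟨(P.State × Q.State) ⊕ (P.State ⊕ Q.State), ExtTr P Q, Sum.inl (P.init, Q.init)⟩

inductive InterleaveTr (S : Set A) (P Q : LTS.{u, v} A) :
    P.State × Q.State → Act A → P.State × Q.State → Prop
  | left {p p' : P.State} {q : Q.State} {α : Act A} :
      α ∉ Act.vis '' S → P.tr p α p' → InterleaveTr S P Q (p, q) α (p', q)
  | right {p : P.State} {q q' : Q.State} {α : Act A} :
      α ∉ Act.vis '' S → Q.tr q α q' → InterleaveTr S P Q (p, q) α (p, q')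
  | both {p p' : P.State} {q q' : Q.State} {a : A} :
      a ∈ S → P.tr p (Act.vis a) p' → Q.tr q (Act.vis a) q' →
        InterleaveTr S P Q (p, q) (Act.vis a) (p', q')

/-- Partially synchronous interleaving: `P` and `Q` synchronise on the actions in `S` and
interleave all other actions. -/
def interleave (S : Set A) (P Q : LTS.{u, v} A) : LTS.{u, v} A :=
  ⟨P.State × Q.State, InterleaveTr S P Q, (P.init, Q.init)⟩

inductive HideTr (H : Set A) (P : LTS.{u, v} A) : P.State → Act A → P.State → Prop
  | keep {p q : P.State} {α : Act A} : α ∉ Act.vis '' H → P.tr p α q → HideTr H P p α q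
  | hidden {p q : P.State} {a : A} : a ∈ H → P.tr p (Act.vis a) q → HideTr H P p Act.tau q

/-- Concealment: the actions in `H` become internal. -/
def hide (H : Set A) (P : LTS.{u, v} A) : LTS.{u, v} A :=
  ⟨P.State, HideTr H P, P.init⟩

inductive RenameTr (f : A → A) (P : LTS.{u, v} A) : P.State → Act A → P.State → Prop
  | tau {p q : P.State} : P.tr p Act.tau q → RenameTr f P p Act.tau q
  | vis {p q : P.State} {a : A} : P.tr p (Act.vis a) q → RenameTr f P p (Act.vis (f a)) q

/-- Renaming of visible actions. -/
def rename (f : A → A) (P : LTS.{u, v} A) : LTS.{u, v} A :=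
  ⟨P.State, RenameTr f P, P.init⟩

end LTS

section Precongruence

variable {A : Type u} (R : LTS.{u, v} A → LTS.{u, v} A → Prop)

/-- `R` is a preorder. -/
structure IsPreord {X : Type w} (R : X → X → Prop) : Prop where
  refl : ∀ P, R P P
  trans : ∀ P Q T, R P Q → R Q T → R P T

/-- `R` is a precongruence for injective renaming and partially synchronous interleaving. -/
structure InterleavingPrecongruence : Prop where
  rename : ∀ f : A → A, Function.Injective f → ∀ P P', R P P' → R (P.rename f) (P'.rename f)
  interleave : ∀ (S : Set A) (P P' Q Q'), R P P' → R Q Q' →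
    R (LTS.interleave S P Q) (LTS.interleave S P' Q')

/-- `R` is a precongruence for the operators of CSP (for the constants of CSP, such as inaction and
divergence, the requirement is that `R` be reflexive). -/
structure CSPPrecongruence : Prop where
  pre : ∀ a P P', R P P' → R (LTS.pre a P) (LTS.pre a P')
  intChoice : ∀ P P' Q Q', R P P' → R Q Q' → R (LTS.intChoice P Q) (LTS.intChoice P' Q')
  extChoice : ∀ P P' Q Q', R P P' → R Q Q' → R (LTS.extChoice P Q) (LTS.extChoice P' Q')
  interleave : ∀ (S : Set A) (P P' Q Q'), R P P' → R Q Q' →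
    R (LTS.interleave S P Q) (LTS.interleave S P' Q')
  hide : ∀ (H : Set A) (P P'), R P P' → R (LTS.hide H P) (LTS.hide H P')
  rename : ∀ (f : A → A) (P P'), R P P' → R (LTS.rename f P) (LTS.rename f P')

/-- `R` is the coarsest preorder on processes in labelled transition systems that is a precongruence
for the operators of CSP and has the property `Pres`; moreover, it is also the coarsest such preorder
when one merely asks for a precongruence for injective renaming and partially synchronous
interleaving. -/
def IsCoarsestPrecongruence (Pres : (LTS.{u, v} A → LTS.{u, v} A → Prop) → Prop) : Prop :=
  IsGreatest {R' | IsPreord R' ∧ CSPPrecongruence R' ∧ Pres R'} R ∧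
    IsGreatest {R' | IsPreord R' ∧ InterleavingPrecongruence R' ∧ Pres R'} R

end Precongruence

/-! ### CCS: expressions and operational semantics -/

/-- The visible actions of CCS: names and co-names. -/
inductive Vis (Ch : Type u) : Type u
  | name (c : Ch) : Vis Ch
  | coname (c : Ch) : Vis Ch

namespace Vis

variable {Ch : Type u}

/-- Complementation. -/
def compl : Vis Ch → Vis Ch
  | name c => coname c
  | coname c => name c

/-- The name underlying a visible action. -/
def channel : Vis Ch → Ch
  | name c => c
  | coname c => c

def map (f : Ch → Ch) : Vis Ch → Vis Ch
  | name c => name (f c)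
  | coname c => coname (f c)

end Vis

/-- What the operational semantics has to know about a set `L` of transition labels. -/
class Labels (Ch : Type u) (L : Type u) where
  /-- The label may be performed under restriction by a set of names. -/
  Unrestricted : Set Ch → L → Prop
  /-- The effect of a relabelling. -/
  ren : (Ch → Ch) → L → L
  /-- `Comm ℓ ℓ' ℓ''`: the labels `ℓ` and `ℓ'` synchronise, resulting in `ℓ''`. -/
  Comm : L → L → L → Prop

/-- Actions of CCS processes. -/
instance Act.labels (Ch : Type u) : Labels Ch (Act (Vis Ch)) where
  Unrestricted H
    | .tau => True
    | .vis a => a.channel ∉ H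
  ren f
    | .tau => .tau
    | .vis a => .vis (a.map f)
  Comm α β γ := ∃ a : Vis Ch, α = .vis a ∧ β = .vis a.compl ∧ γ = .tau

/-- Actions of CCS tests: those of CCS processes and the success action `ω`. -/
inductive TestAct (Ch : Type u) : Type u
  | act (α : Act (Vis Ch)) : TestAct Ch
  | omega : TestAct Ch

instance TestAct.labels (Ch : Type u) : Labels Ch (TestAct Ch) where
  Unrestricted H
    | .act α => Labels.Unrestricted H α
    | .omega => True
  ren f
    | .act α => .act (Labels.ren f α)
    | .omega => .omega
  Comm ℓ ℓ' ℓ'' := ∃ α β γ : Act (Vis Ch),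
    Labels.Comm Ch α β γ ∧ ℓ = .act α ∧ ℓ' = .act β ∧ ℓ'' = .act γ

/-- Valued actions: actions of CCS processes tagged with a real reward. -/
structure RewAct (Ch : Type u) : Type u where
  act : Act (Vis Ch)
  rew : ℝ

instance RewAct.labels (Ch : Type u) : Labels Ch (RewAct Ch) where
  Unrestricted H ℓ := Labels.Unrestricted H ℓ.act
  ren f ℓ := ⟨Labels.ren f ℓ.act, ℓ.rew⟩
  Comm ℓ ℓ' ℓ'' := Labels.Comm Ch ℓ.act ℓ'.act ℓ''.act ∧ ℓ''.rew = ℓ.rew + ℓ'.rew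

/-- CCS expressions with names in `Ch`, process variables in `V` and action prefixes in `L`. -/
inductive Expr (Ch V L : Type u) : Type (u + 1)
  | pre (ℓ : L) (E : Expr Ch V L) : Expr Ch V L
  | sum (I : Type u) (E : I → Expr Ch V L) : Expr Ch V L
  | par (E F : Expr Ch V L) : Expr Ch V L
  | res (E : Expr Ch V L) (H : Set Ch) : Expr Ch V L
  | ren (E : Expr Ch V L) (f : Ch → Ch) : Expr Ch V L
  | var (X : V) : Expr Ch V L
  /-- The `X`-component of a solution of the recursive specification `S` with domain `D`. -/
  | fix (D : Set V) (S : D → Expr Ch V L) (X : D) : Expr Ch V L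

namespace Expr

variable {Ch V L L' : Type u}

/-- Each occurrence of a variable outside `Γ` lies in the scope of a recursion binding it. -/
def ClosedIn : Set V → Expr Ch V L → Prop
  | Γ, pre _ E => ClosedIn Γ E
  | Γ, sum _ E => ∀ i, ClosedIn Γ (E i)
  | Γ, par E F => ClosedIn Γ E ∧ ClosedIn Γ F
  | Γ, res E _ => ClosedIn Γ E
  | Γ, ren E _ => ClosedIn Γ E
  | Γ, var X => X ∈ Γ
  | Γ, fix D S _ => ∀ Y, ClosedIn (Γ ∪ D) (S Y)

def Closed (E : Expr Ch V L) : Prop := ClosedIn ∅ E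

open Classical in
/-- Substitution for the free variables. It is only applied to closed expressions `σ X` (and to the
trivial ones `σ X = X`) below, so that no renaming of bound variables is needed. -/
noncomputable def subst : (V → Expr Ch V L) → Expr Ch V L → Expr Ch V L
  | σ, pre ℓ E => pre ℓ (subst σ E)
  | σ, sum I E => sum I (fun i => subst σ (E i))
  | σ, par E F => par (subst σ E) (subst σ F)
  | σ, res E H => res (subst σ E) H
  | σ, ren E f => ren (subst σ E) f
  | σ, var X => σ X
  | σ, fix D S X => fix D (fun Y => subst (fun Z => if Z ∈ D then var Z else σ Z) (S Y)) X

open Classical in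
/-- The body `S X`, with the recursive calls `fix D S Y` substituted for the variables `Y ∈ D`. -/
noncomputable def unfold (D : Set V) (S : D → Expr Ch V L) (X : D) : Expr Ch V L :=
  subst (fun Y => if h : Y ∈ D then fix D S ⟨Y, h⟩ else var Y) (S X)

/-- The structural operational semantics. -/
inductive Tr [Labels Ch L] : Expr Ch V L → L → Expr Ch V L → Prop
  | pre (ℓ : L) (E : Expr Ch V L) : Tr (pre ℓ E) ℓ E
  | sum {I : Type u} {E : I → Expr Ch V L} {ℓ : L} {E' : Expr Ch V L} (j : I) :
      Tr (E j) ℓ E' → Tr (sum I E) ℓ E'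
  | parL {E E' F : Expr Ch V L} {ℓ : L} : Tr E ℓ E' → Tr (par E F) ℓ (par E' F)
  | parR {E F F' : Expr Ch V L} {ℓ : L} : Tr F ℓ F' → Tr (par E F) ℓ (par E F')
  | comm {E E' F F' : Expr Ch V L} {ℓ ℓ' ℓ'' : L} : Labels.Comm Ch ℓ ℓ' ℓ'' →
      Tr E ℓ E' → Tr F ℓ' F' → Tr (par E F) ℓ'' (par E' F')
  | res {E E' : Expr Ch V L} {H : Set Ch} {ℓ : L} : Labels.Unrestricted H ℓ →
      Tr E ℓ E' → Tr (res E H) ℓ (res E' H)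
  | ren {E E' : Expr Ch V L} {f : Ch → Ch} {ℓ : L} :
      Tr E ℓ E' → Tr (ren E f) (Labels.ren f ℓ) (ren E' f)
  | fix {D : Set V} {S : D → Expr Ch V L} {X : D} {ℓ : L} {E' : Expr Ch V L} :
      Tr (unfold D S X) ℓ E' → Tr (fix D S X) ℓ E'

/-- Changing the prefixes occurring in an expression. -/
def mapLabel (g : L → L') : Expr Ch V L → Expr Ch V L'
  | pre ℓ E => pre (g ℓ) (mapLabel g E)
  | sum I E => sum I (fun i => mapLabel g (E i))
  | par E F => par (mapLabel g E) (mapLabel g F)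
  | res E H => res (mapLabel g E) H
  | ren E f => ren (mapLabel g E) f
  | var X => var X
  | fix D S X => fix D (fun Y => mapLabel g (S Y)) X

/-- All prefixes occurring in the expression satisfy `p`. -/
def AllLabels (p : L → Prop) : Expr Ch V L → Prop
  | pre ℓ E => p ℓ ∧ AllLabels p E
  | sum _ E => ∀ i, AllLabels p (E i)
  | par E F => AllLabels p E ∧ AllLabels p F
  | res E _ => AllLabels p E
  | ren E _ => AllLabels p E
  | var _ => True
  | fix _ S _ => ∀ Y, AllLabels p (S Y)

theorem ClosedIn.mapLabel (g : L → L') {E : Expr Ch V L} :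
    ∀ {Γ : Set V}, ClosedIn Γ E → ClosedIn Γ (E.mapLabel g) := by
  induction E with
  | pre ℓ E ih => intro Γ h; exact ih h
  | sum I E ih => intro Γ h i; exact ih i (h i)
  | par E F ihE ihF => intro Γ h; exact ⟨ihE h.1, ihF h.2⟩
  | res E H ih => intro Γ h; exact ih h
  | ren E f ih => intro Γ h; exact ih h
  | var X => intro Γ h; exact h
  | fix D S X ih => intro Γ h Y; exact ih Y (h Y)

end Expr

/-- Closed expressions. -/
def Closed (Ch V L : Type u) : Type (u + 1) := {E : Expr Ch V L // E.Closed}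

namespace Closed

variable {Ch V L L' : Type u}

/-- The transition relation between closed expressions. -/
def Step [Labels Ch L] (E : Closed Ch V L) (ℓ : L) (F : Closed Ch V L) : Prop :=
  Expr.Tr E.1 ℓ F.1

def par (E F : Closed Ch V L) : Closed Ch V L := ⟨Expr.par E.1 F.1, E.2, F.2⟩

def mapLabel (g : L → L') (E : Closed Ch V L) : Closed Ch V L' :=
  ⟨E.1.mapLabel g, E.2.mapLabel g⟩

end Closed

/-- CCS processes. -/
abbrev Proc (Ch V : Type u) := Closed Ch V (Act (Vis Ch))

/-- CCS tests. -/
abbrev Test (Ch V : Type u) := Closed Ch V (TestAct Ch)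

/-- CCS reward tests. -/
abbrev RewTest (Ch V : Type u) := Closed Ch V (RewAct Ch)

/-- A CCS process as a state in the labelled transition system of all CCS processes. -/
def Proc.toLTS {Ch V : Type u} (P : Proc Ch V) : LTS.{u, u + 1} (Vis Ch) :=
  ⟨Proc Ch V, Closed.Step, P⟩

/-! ### Testing -/

section Testing

variable {T P O : Type*} [LE O]

def HoareLE (O₁ O₂ : Set O) : Prop := ∀ o₁ ∈ O₁, ∃ o₂ ∈ O₂, o₁ ≤ o₂

def SmythLE (O₁ O₂ : Set O) : Prop := ∀ o₂ ∈ O₂, ∃ o₁ ∈ O₁, o₁ ≤ o₂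

/-- May testing with the tests in `𝒯`. -/
def MayPre (apply : T → P → Set O) (𝒯 : Set T) (p q : P) : Prop :=
  ∀ t ∈ 𝒯, HoareLE (apply t p) (apply t q)

/-- Must testing with the tests in `𝒯`. -/
def MustPre (apply : T → P → Set O) (𝒯 : Set T) (p q : P) : Prop :=
  ∀ t ∈ 𝒯, SmythLE (apply t p) (apply t q)

end Testing

variable {Ch V : Type u}

/-- The combined system `T | P`. -/
def Test.run (T : Test Ch V) (P : Proc Ch V) : Test Ch V :=
  Closed.par T (P.mapLabel TestAct.act)

/-- A computation starting in `T`: states `st 0, st 1, …, st len`, where `len` may be infinite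
(the values `st n` for `n > len` are irrelevant). -/
structure Computation (T : Test Ch V) where
  len : ℕ∞
  st : ℕ → Test Ch V
  st_zero : st 0 = T
  step : ∀ n : ℕ, (n : ℕ∞) < len → (st n).Step (.act .tau) (st (n + 1))
  final : ∀ n : ℕ, (n : ℕ∞) = len → ∀ T', ¬ (st n).Step (.act .tau) T'

def Computation.Successful {T : Test Ch V} (π : Computation T) : Prop :=
  ∃ n : ℕ, (n : ℕ∞) ≤ π.len ∧ ∃ T', (π.st n).Step .omega T'

/-- The possible outcomes of a classical test; `⊤` is success and `⊥` failure. -/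
def applyTest (T : Test Ch V) (P : Proc Ch V) : Set Bool :=
  {o | o = ⊤ ∧ ∃ π : Computation (T.run P), π.Successful} ∪
    {o | o = ⊥ ∧ ∃ π : Computation (T.run P), ¬ π.Successful}

/-- The possible outcomes of a test where `ω` reports a catastrophe. -/
def applyTestDual (T : Test Ch V) (P : Proc Ch V) : Set Bool :=
  {o | o = ⊥ ∧ ∃ π : Computation (T.run P), π.Successful} ∪
    {o | o = ⊤ ∧ ∃ π : Computation (T.run P), ¬ π.Successful}

def MayTesting (P Q : Proc Ch V) : Prop := MayPre applyTest Set.univ P Q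

def MustTesting (P Q : Proc Ch V) : Prop := MustPre applyTest Set.univ P Q

def DualMustTesting (P Q : Proc Ch V) : Prop := MustPre applyTestDual Set.univ P Q

/-- The combined system `T | P`, where `P` carries reward `0` everywhere. -/
def RewTest.run (T : RewTest Ch V) (P : Proc Ch V) : RewTest Ch V :=
  Closed.par T (P.mapLabel fun α => ⟨α, 0⟩)

/-- A reward computation `st 0, r 0, st 1, r 1, …, st len`, where `len` may be infinite. -/
structure RewComputation (T : RewTest Ch V) where
  len : ℕ∞
  st : ℕ → RewTest Ch V
  r : ℕ → ℝ
  st_zero : st 0 = T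
  step : ∀ n : ℕ, (n : ℕ∞) < len → (st n).Step ⟨.tau, r n⟩ (st (n + 1))
  final : ∀ n : ℕ, (n : ℕ∞) = len → ∀ x T', ¬ (st n).Step ⟨.tau, x⟩ T'

open Classical in
/-- The reward of a computation: the sum of the rewards of its steps, where for infinite
computations the lower limit of the partial sums is taken. -/
noncomputable def RewComputation.reward {T : RewTest Ch V} (π : RewComputation T) : EReal :=
  if π.len = ⊤ then
    Filter.liminf (fun n : ℕ => ((∑ i ∈ Finset.range n, π.r i : ℝ) : EReal)) Filter.atTop
  else ((∑ i ∈ Finset.range π.len.toNat, π.r i : ℝ) : EReal)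

def applyRew (T : RewTest Ch V) (P : Proc Ch V) : Set EReal :=
  {o | ∃ π : RewComputation (T.run P), o = π.reward}

/-- Each infinite path of `T` has only finitely many transitions with a negative reward. -/
def RewTest.FinitePenalty (T : RewTest Ch V) : Prop :=
  ∀ (st : ℕ → RewTest Ch V) (ℓ : ℕ → RewAct Ch), st 0 = T →
    (∀ n, (st n).Step (ℓ n) (st (n + 1))) → {n | (ℓ n).rew < 0}.Finite

def RewTest.Nonneg (T : RewTest Ch V) : Prop := T.1.AllLabels fun ℓ => 0 ≤ ℓ.rew

def RewTest.Nonpos (T : RewTest Ch V) : Prop := T.1.AllLabels fun ℓ => ℓ.rew ≤ 0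

/-- Reward testing. -/
def Reward (P Q : Proc Ch V) : Prop := MustPre applyRew Set.univ P Q

/-- Finite-penalty reward testing. -/
def FpReward (P Q : Proc Ch V) : Prop := MustPre applyRew {T | T.FinitePenalty} P Q

/-- Nonnegative reward testing. -/
def PosReward (P Q : Proc Ch V) : Prop := MustPre applyRew {T | T.Nonneg} P Q

/-- Nonpositive reward testing. -/
def NegReward (P Q : Proc Ch V) : Prop := MustPre applyRew {T | T.Nonpos} P Q

/-- Finite-penalty nonpositive reward testing. -/
def FpNegReward (P Q : Proc Ch V) : Prop :=
  MustPre applyRew {T | T.FinitePenalty ∧ T.Nonpos} P Q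

/-- A preorder on processes in labelled transition systems, specialised to CCS processes. -/
def onCCS (R : LTS.{u, u + 1} (Vis Ch) → LTS.{u, u + 1} (Vis Ch) → Prop) (P Q : Proc Ch V) : Prop :=
  R P.toLTS Q.toLTS

/-- The associated equivalence of a preorder. -/
def Equivalent {X : Type w} (R : X → X → Prop) (P Q : X) : Prop := R P Q ∧ R Q P

end RewardTesting

open RewardTesting

/-! The proof passes through an abstract notion of test, the context `Ctx`: a machine that moves on
its own, synchronises with visible actions of the process placed in it, and lets the process take
internal steps in its `live` states. Smyth comparison of rewards in a context depends only on the
traces of the process. By `Ctx.Adm.exists_outcome` and `Ctx.exists_adm`, every outcome lies above a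
reward in `Ctx.Adm` and conversely, and `Ctx.Adm` is obtained by pairing a path of the context with
a partial trace, failure, divergence or infinite trace of the process.

Soundness of the explicit preorders: a path used with Q is reused with P, as far as the traces of P
permit. Under `NDFD` the whole path is reused, unless P diverges where Q is stuck, which earns the
same. If all rewards are nonpositive, P may continue a finite path in any way, so partial traces
suffice for finite paths. If negative rewards occur only finitely often, P may diverge along an
infinite path once they have all been paid. If all rewards are nonnegative, P may diverge anywhere
along the path. This yields `Ctx.smythLE_of_ndfd`, `Ctx.smythLE_of_traceInf`,
`Ctx.smythLE_of_trace`, `Ctx.smythLE_of_fdid` and `Ctx.smythLE_of_fdibot`.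

Completeness needs only the tests `Ctx.chain`, which follow one fixed sequence of actions and offer
escapes worth 1. Rewards and escapes are chosen such that P can match the outcome of Q only by
following the sequence far enough and then stopping, diverging or continuing forever
(`Ctx.ndfd_of_chain` and its variants).

Both directions transfer to CCS. Reward tests are contexts (`applyRew_eq_outcomes`), and chains are
CCS tests, since with infinitely many variables each transition relation on the natural numbers is
realised by closed expressions (`graph_tr`). A classical test becomes a context with nonnegative
rewards by paying 1 for entering a successful state, which reduces must testing to `FDIbot`; may
testing and its dual only see partial traces.

A CSP operator with all but one argument fixed is, up to bisimilarity, a context with actions as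
output. Composing a chain with it gives another context with the same restriction on rewards
(`Ctx.outcomes_comp`), so completeness followed by soundness shows that `NDFD`, `FDId`, `FDIbot` and
`Trace` are precongruences. They are coarsest because an injective renaming that misses some action
d, followed by synchronisation with a chain process, encodes the chain tests in the complete traces
of the result (`chainTest_ctraces_cases`); d takes the place of the internal escape. Here infinitely
many names are needed. For safety the complement of the partial traces of P is already the decisive
property.

The separations use small processes with internal loops: looping everywhere makes divergence
information coincide with partial traces, and initial divergence erases everything that `FDIbot` can
see. -/

namespace RewardTesting

/-! ### Runs and outcomes of reward-labelled step relations -/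

section Outcomes

open Filter

variable {X Y : Type*}

/-- The limit inferior of the partial sums of a sequence of rewards. -/
noncomputable def limReward (r : ℕ → ℝ) : EReal :=
  liminf (fun n : ℕ => ((∑ i ∈ Finset.range n, r i : ℝ) : EReal)) atTop

theorem limReward_le_sum {r : ℕ → ℝ} {N : ℕ} (h : ∀ i, N ≤ i → r i ≤ 0) :
    limReward r ≤ ((∑ i ∈ Finset.range N, r i : ℝ) : EReal) := by
  refine (liminf_le_liminf (v := fun _ => ((∑ i ∈ Finset.range N, r i : ℝ) : EReal)) ?_).trans_eq
    (liminf_const _)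
  filter_upwards [eventually_ge_atTop N] with n hn
  rw [EReal.coe_le_coe_iff, ← Finset.sum_range_add_sum_Ico _ hn]
  have : ∑ i ∈ Finset.Ico N n, r i ≤ 0 :=
    Finset.sum_nonpos fun i hi => h i (Finset.mem_Ico.1 hi).1
  linarith

theorem sum_le_limReward {r : ℕ → ℝ} {N : ℕ} (h : ∀ i, N ≤ i → 0 ≤ r i) :
    ((∑ i ∈ Finset.range N, r i : ℝ) : EReal) ≤ limReward r := by
  refine (liminf_const _).symm.trans_le (liminf_le_liminf
    (u := fun _ => ((∑ i ∈ Finset.range N, r i : ℝ) : EReal)) ?_)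
  filter_upwards [eventually_ge_atTop N] with n hn
  rw [EReal.coe_le_coe_iff, ← Finset.sum_range_add_sum_Ico _ hn]
  have : 0 ≤ ∑ i ∈ Finset.Ico N n, r i :=
    Finset.sum_nonneg fun i hi => h i (Finset.mem_Ico.1 hi).1
  linarith

theorem limReward_eq_sum {r : ℕ → ℝ} {N : ℕ} (h : ∀ i, N ≤ i → r i = 0) :
    limReward r = ((∑ i ∈ Finset.range N, r i : ℝ) : EReal) :=
  (limReward_le_sum fun i hi => (h i hi).le).antisymm (sum_le_limReward fun i hi => (h i hi).ge)

/-- The partial sums of ρ are those of r sampled along g, and sampling can only raise the limit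
inferior. Repetitions in g are harmless. For this reason infinite runs are compared by inequalities
throughout. -/
theorem limReward_le_of_subseq {r ρ : ℕ → ℝ} {g : ℕ → ℕ} (hg : Tendsto g atTop atTop)
    (h : ∀ j, ∑ i ∈ Finset.range (g j), r i = ∑ i ∈ Finset.range j, ρ i) :
    limReward r ≤ limReward ρ := by
  have : limReward ρ = liminf (fun n : ℕ => ((∑ i ∈ Finset.range n, r i : ℝ) : EReal))
      (map g atTop) := by
    simp only [limReward, liminf, map_map, Function.comp_def, h]
  rw [this]
  exact liminf_le_liminf_of_le hg

/-- Prepending an element to a sequence. -/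
def seqCons (c : X) (r : ℕ → X) : ℕ → X
  | 0 => c
  | n + 1 => r n

/-- Adding a real constant is monotone and continuous on all of `EReal`, so it commutes with the
limit inferior even when the latter is infinite. -/
theorem limReward_cons (c : ℝ) (r : ℕ → ℝ) :
    limReward (seqCons c r) = (c : EReal) + limReward r := by
  have h1 : limReward (seqCons c r) =
      liminf (fun n => (c : EReal) + ((∑ i ∈ Finset.range n, r i : ℝ) : EReal)) atTop := by
    unfold limReward
    rw [← liminf_nat_add _ 1]
    congr 1
    funext n
    rw [Finset.sum_range_succ', add_comm, EReal.coe_add]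
    rfl
  rw [h1]
  have hc : Continuous fun x : EReal => (c : EReal) + x :=
    continuous_iff_continuousAt.2 fun x => by
      have := (EReal.continuousAt_add (p := ((c : EReal), x)) (by simp) (by simp))
      exact this.comp (f := fun y : EReal => ((c : EReal), y)) (by fun_prop)
  have hm : Monotone fun x : EReal => (c : EReal) + x := fun x y h => add_le_add le_rfl h
  exact (hm.map_liminf_of_continuousAt _ hc.continuousAt).symm

/-- `Run st n x t y`: a run of `n` steps from `x` to `y` with total reward `t`. -/
inductive Run (st : X → ℝ → X → Prop) : ℕ → X → ℝ → X → Prop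
  | refl (x : X) : Run st 0 x 0 x
  | head {n : ℕ} {x y z : X} {r t : ℝ} : st x r y → Run st n y t z → Run st (n + 1) x (r + t) z

/-- The rewards of the maximal runs starting in `x`. -/
def Outcomes (st : X → ℝ → X → Prop) (x : X) : Set EReal :=
  {o | (∃ n t y, Run st n x t y ∧ (∀ r z, ¬ st y r z) ∧ o = (t : ℝ)) ∨
    ∃ (s : ℕ → X) (r : ℕ → ℝ), s 0 = x ∧ (∀ n, st (s n) (r n) (s (n + 1))) ∧ o = limReward r}

variable {st : X → ℝ → X → Prop} {st' : Y → ℝ → Y → Prop}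

theorem Run.single {x y : X} {r : ℝ} (h : st x r y) : Run st 1 x r y := by
  simpa using Run.head h (Run.refl y)

theorem Run.trans {n m : ℕ} {x y z : X} {t t' : ℝ} (h : Run st n x t y) (h' : Run st m y t' z) :
    Run st (n + m) x (t + t') z := by
  induction h with
  | refl x => simpa using h'
  | @head n x y z r t h _ ih =>
    have := Run.head h (ih h')
    rw [Nat.add_right_comm n 1 m, add_assoc r t t']
    exact this

theorem Run.of_seq {n : ℕ} {s : ℕ → X} {r : ℕ → ℝ} (h : ∀ i < n, st (s i) (r i) (s (i + 1))) :
    Run st n (s 0) (∑ i ∈ Finset.range n, r i) (s n) := by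
  induction n with
  | zero => simpa using Run.refl (s 0)
  | succ n ih =>
    rw [Finset.sum_range_succ]
    exact (ih fun i hi => h i (hi.trans n.lt_succ_self)).trans (Run.single (h n n.lt_succ_self))

theorem Run.exists_seq {n : ℕ} {x y : X} {t : ℝ} (h : Run st n x t y) :
    ∃ (s : ℕ → X) (r : ℕ → ℝ), s 0 = x ∧ s n = y ∧ (∀ i < n, st (s i) (r i) (s (i + 1))) ∧
      t = ∑ i ∈ Finset.range n, r i := by
  induction h with
  | refl x => exact ⟨fun _ => x, fun _ => 0, rfl, rfl, by simp, by simp⟩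
  | @head n x y z r t h _ ih =>
    obtain ⟨s, q, h0, hn, hs, rfl⟩ := ih
    refine ⟨seqCons x s, seqCons r q, rfl, hn, ?_, ?_⟩
    · rintro (_ | i) hi
      · simpa [seqCons, h0] using h
      · exact hs i (by omega)
    · rw [Finset.sum_range_succ', add_comm]
      rfl

theorem mem_outcomes_cons {x y : X} {r : ℝ} {o : EReal} (h : st x r y) (ho : o ∈ Outcomes st y) :
    (r : EReal) + o ∈ Outcomes st x := by
  rcases ho with ⟨n, t, z, hr, hz, rfl⟩ | ⟨s, q, h0, hs, rfl⟩
  · exact Or.inl ⟨n + 1, r + t, z, Run.head h hr, hz, by simp⟩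
  · refine Or.inr ⟨seqCons x s, seqCons r q, rfl, ?_,
      (limReward_cons r q).symm⟩
    rintro (_ | i)
    · simpa [seqCons, h0] using h
    · exact hs i

theorem Run.mem_outcomes {n : ℕ} {x y : X} {t : ℝ} {o : EReal} (h : Run st n x t y)
    (ho : o ∈ Outcomes st y) : (t : EReal) + o ∈ Outcomes st x := by
  induction h with
  | refl x => simpa using ho
  | head h _ ih =>
    rw [EReal.coe_add, add_assoc]
    exact mem_outcomes_cons h (ih ho)

/-- Dependent choice for a relation indexed by the position. -/
theorem exists_seq_of_step {Z : Type*} {Q : Z → Prop} {R : ℕ → Z → Z → Prop} {z : Z} (hz : Q z)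
    (h : ∀ n x, Q x → ∃ y, Q y ∧ R n x y) :
    ∃ s : ℕ → Z, s 0 = z ∧ ∀ n, Q (s n) ∧ R n (s n) (s (n + 1)) := by
  choose f hf hR using h
  let F : ℕ → {x // Q x} := fun n =>
    Nat.rec ⟨z, hz⟩ (fun n p => ⟨f n p.1 p.2, hf n p.1 p.2⟩) n
  exact ⟨fun n => (F n).1, rfl, fun n => ⟨(F n).2, hR n _ (F n).2⟩⟩

/-- If no finite run ends in a terminal state, every run can be prolonged, and dependent choice
gives an infinite one. -/
theorem outcomes_nonempty (st : X → ℝ → X → Prop) (x : X) : (Outcomes st x).Nonempty := by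
  by_cases h : ∃ n t y, Run st n x t y ∧ ∀ r z, ¬ st y r z
  · obtain ⟨n, t, y, hr, hy⟩ := h
    exact ⟨t, Or.inl ⟨n, t, y, hr, hy, rfl⟩⟩
  · push Not at h
    obtain ⟨s, h0, hs⟩ := exists_seq_of_step (Q := fun y => ∃ n t, Run st n x t y)
      (R := fun _ y z => ∃ r, st y r z) ⟨0, 0, Run.refl x⟩ (by
        rintro - y ⟨n, t, hr⟩
        obtain ⟨r, z, hz⟩ := h n t y hr
        exact ⟨z, ⟨_, _, hr.trans (Run.single hz)⟩, r, hz⟩)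
    choose r hr using fun n => (hs n).2
    exact ⟨_, Or.inr ⟨s, r, h0, hr, rfl⟩⟩

theorem Run.map {f : X → Y} (hf : ∀ x r x', st x r x' → st' (f x) r (f x')) {n : ℕ} {x y : X}
    {t : ℝ} (h : Run st n x t y) : Run st' n (f x) t (f y) := by
  induction h with
  | refl x => exact Run.refl _
  | head h _ ih => exact Run.head (hf _ _ _ h) ih

theorem Run.of_map {f : X → Y} (hb : ∀ x r y, st' (f x) r y → ∃ x', f x' = y ∧ st x r x') {n : ℕ}
    {z y : Y} {t : ℝ} (h : Run st' n z t y) :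
    ∀ {x}, z = f x → ∃ y', f y' = y ∧ Run st n x t y' := by
  induction h with
  | refl z => rintro x rfl; exact ⟨x, rfl, Run.refl x⟩
  | head h _ ih =>
    rintro x rfl
    obtain ⟨x', rfl, hx'⟩ := hb _ _ _ h
    obtain ⟨y', rfl, hy'⟩ := ih (x := x') rfl
    exact ⟨y', rfl, Run.head hx' hy'⟩

/-- Step relations related by a functional bisimulation have the same outcomes. -/
theorem outcomes_map (f : X → Y) (hf : ∀ x r x', st x r x' → st' (f x) r (f x'))
    (hb : ∀ x r y, st' (f x) r y → ∃ x', f x' = y ∧ st x r x') (x : X) :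
    Outcomes st' (f x) = Outcomes st x := by
  apply Set.Subset.antisymm
  · rintro o (⟨n, t, y, hr, hy, rfl⟩ | ⟨s, r, h0, hs, rfl⟩)
    · obtain ⟨y', rfl, hy'⟩ := hr.of_map hb rfl
      exact Or.inl ⟨n, t, y', hy', fun r z hz => hy _ _ (hf _ _ _ hz), rfl⟩
    -- The position is carried along with the state because the invariant refers to the run at that
    -- position; `hn` then identifies it with the index.
    · obtain ⟨q, hq0, hq⟩ := exists_seq_of_step (Z := ℕ × X) (Q := fun p => f p.2 = s p.1)
        (R := fun _ p p' => p'.1 = p.1 + 1 ∧ st p.2 (r p.1) p'.2) (z := (0, x)) h0.symm (by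
          rintro - ⟨n, y⟩ hy
          have := hs n
          simp only at hy
          rw [← hy] at this
          obtain ⟨y', hy', hst⟩ := hb _ _ _ this
          exact ⟨(n + 1, y'), hy', rfl, hst⟩)
      have hn : ∀ n, (q n).1 = n := by
        intro n
        induction n with
        | zero => rw [hq0]
        | succ n ih => rw [(hq n).2.1, ih]
      refine Or.inr ⟨fun n => (q n).2, r, by simp [hq0], fun n => ?_, rfl⟩
      simpa [hn n] using (hq n).2.2
  · rintro o (⟨n, t, y, hr, hy, rfl⟩ | ⟨s, r, h0, hs, rfl⟩)
    · refine Or.inl ⟨n, t, f y, hr.map hf, fun r z hz => ?_, rfl⟩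
      obtain ⟨x', -, hx'⟩ := hb _ _ _ hz
      exact hy _ _ hx'
    · exact Or.inr ⟨fun n => f (s n), r, by simp [h0], fun n => hf _ _ _ (hs n), rfl⟩

/-- An infinite sequence of nonempty runs can be concatenated. -/
theorem exists_outcome_le_of_blocks {x : ℕ → X} {ρ : ℕ → ℝ}
    (h : ∀ j, ∃ m, Run st (m + 1) (x j) (ρ j) (x (j + 1))) :
    ∃ o ∈ Outcomes st (x 0), o ≤ limReward ρ := by
  choose m hm using h
  -- positions: current state, block, number of steps left after the next one, reward left
  obtain ⟨s, h0, hs⟩ := exists_seq_of_step (Z := X × ℕ × ℕ × ℝ)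
    (Q := fun z => Run st (z.2.2.1 + 1) z.1 z.2.2.2 (x (z.2.1 + 1)))
    (R := fun _ z z' => ∃ r, st z.1 r z'.1 ∧
      ((∃ k, z.2.2.1 = k + 1 ∧ z'.2.1 = z.2.1 ∧ z'.2.2.1 = k ∧ r + z'.2.2.2 = z.2.2.2) ∨
        (z.2.2.1 = 0 ∧ r = z.2.2.2 ∧
          z' = (x (z.2.1 + 1), z.2.1 + 1, m (z.2.1 + 1), ρ (z.2.1 + 1)))))
    (z := (x 0, 0, m 0, ρ 0)) (hm 0) (by
      rintro - ⟨y, j, k, t⟩ hz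
      simp only at hz
      generalize hw : x (j + 1) = w at hz
      cases hz with
      | @head _ _ y' _ r t' hst hrun =>
        rcases k with _ | k
        · cases hrun
          exact ⟨(x (j + 1), j + 1, m (j + 1), ρ (j + 1)), hm (j + 1), r, by simpa [hw] using hst,
            Or.inr ⟨rfl, by simp, by simp [hw]⟩⟩
        · exact ⟨(y', j, k, t'), by simpa [hw] using hrun, r, hst, Or.inl ⟨k, rfl, rfl, rfl, rfl⟩⟩)
  choose hQ r hr hcase using hs
  -- By induction on the number of steps left in the current block, the start of the next block is
  -- reached, having collected precisely the reward left in this one.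
  have key : ∀ k n, (s n).2.2.1 = k → ∃ n', n < n' ∧
      s n' = (x ((s n).2.1 + 1), (s n).2.1 + 1, m ((s n).2.1 + 1), ρ ((s n).2.1 + 1)) ∧
      ∑ i ∈ Finset.range n', r i = ∑ i ∈ Finset.range n, r i + (s n).2.2.2 := by
    intro k
    induction k with
    | zero =>
      intro n hn
      rcases hcase n with ⟨k, hk, -⟩ | ⟨-, h1, h2⟩
      · omega
      · exact ⟨n + 1, n.lt_succ_self, h2, by rw [Finset.sum_range_succ, h1]⟩
    | succ k ih =>
      intro n hn
      rcases hcase n with ⟨k', hk, h1, h2, h3⟩ | ⟨h1, -⟩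
      · obtain ⟨n', hn', hs', hsum⟩ := ih (n + 1) (by omega)
        refine ⟨n', by omega, by rw [hs', h1], ?_⟩
        rw [hsum, Finset.sum_range_succ, ← h3, add_assoc]
      · omega
  have hg : ∀ j, ∃ n, j ≤ n ∧ s n = (x j, j, m j, ρ j) ∧
      ∑ i ∈ Finset.range n, r i = ∑ i ∈ Finset.range j, ρ i := by
    intro j
    induction j with
    | zero => exact ⟨0, le_rfl, h0, rfl⟩
    | succ j ih =>
      obtain ⟨n, hn, hsn, hsum⟩ := ih
      obtain ⟨n', hn', hs', hsum'⟩ := key _ n rfl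
      refine ⟨n', by omega, by simpa [hsn] using hs', ?_⟩
      rw [hsum', hsum, hsn, Finset.sum_range_succ]
  choose g hjg _ hgs using hg
  exact ⟨_, Or.inr ⟨fun n => (s n).1, r, by simp [h0], hr, rfl⟩,
    limReward_le_of_subseq (tendsto_atTop_mono hjg tendsto_id) hgs⟩

end Outcomes

end RewardTesting

namespace RewardTesting

/-! ### Weak transitions and the trace sets -/

section Weak

variable {A : Type u} {S : Type v} {tr : S → Act A → S → Prop}

theorem Weak.trans {p q r : S} {σ ρ : List A} (h : Weak tr p σ q) (h' : Weak tr q ρ r) :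
    Weak tr p (σ ++ ρ) r := by
  induction h with
  | refl p => exact h'
  | tau h _ ih => exact Weak.tau h (ih h')
  | vis h _ ih => exact Weak.vis h (ih h')

theorem Weak.snoc_vis {p q r : S} {a : A} {σ : List A} (h : Weak tr p σ q)
    (h' : tr q (Act.vis a) r) : Weak tr p (σ ++ [a]) r :=
  h.trans (Weak.vis h' (Weak.refl r))

theorem Weak.snoc_tau {p q r : S} {σ : List A} (h : Weak tr p σ q)
    (h' : tr q Act.tau r) : Weak tr p σ r := by
  simpa using h.trans (Weak.tau h' (Weak.refl r))

theorem Weak.of_cons {p r : S} {a : A} {σ : List A} (h : Weak tr p (a :: σ) r) :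
    ∃ y z, Weak tr p [] y ∧ tr y (Act.vis a) z ∧ Weak tr z σ r := by
  generalize hρ : a :: σ = ρ at h
  induction h with
  | refl p => cases hρ
  | tau h _ ih =>
    obtain ⟨y, z, hy, hyz, hz⟩ := ih hρ
    exact ⟨y, z, Weak.tau h hy, hyz, hz⟩
  | vis h h' _ =>
    cases hρ
    exact ⟨_, _, Weak.refl _, h, h'⟩

theorem Weak.of_append {p r : S} {σ ρ : List A} (h : Weak tr p (σ ++ ρ) r) :
    ∃ q, Weak tr p σ q ∧ Weak tr q ρ r := by
  induction σ generalizing p with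
  | nil => exact ⟨p, Weak.refl p, h⟩
  | cons a σ ih =>
    obtain ⟨y, z, hy, hyz, hz⟩ := h.of_cons
    obtain ⟨q, hq, hq'⟩ := ih hz
    exact ⟨q, hy.trans (Weak.vis hyz hq), hq'⟩

/-- Induction principle for sequences of internal steps. -/
theorem Weak.nil_induction {motive : S → Prop} {p q : S} (h : Weak tr p [] q) (hp : motive p)
    (step : ∀ x y, motive x → tr x Act.tau y → motive y) : motive q := by
  generalize hρ : ([] : List A) = ρ at h
  induction h with
  | refl p => exact hp
  | tau h _ ih => exact ih (step _ _ hp h) hρ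
  | vis => cases hρ

end Weak

/-! ### Divergences, failures and partial traces of a process -/

namespace LTS

variable {A : Type u} {P : LTS.{u, v} A}

theorem Diverges.of_tau {p q : P.State} (h : P.tr p Act.tau q) (hq : P.Diverges q) :
    P.Diverges p := by
  obtain ⟨s, h0, hs⟩ := hq
  refine ⟨seqCons p s, rfl, ?_⟩
  rintro (_ | n)
  · simpa [seqCons, h0] using h
  · exact hs n

theorem Diverges.of_weak {p q : P.State} (h : Weak P.tr p [] q) (hq : P.Diverges q) :
    P.Diverges p := by
  generalize hρ : ([] : List A) = ρ at h
  induction h with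
  | refl p => exact hq
  | tau h _ ih => exact (ih hq hρ).of_tau h
  | vis => cases hρ

/-- If every state reachable by internal steps has a further internal step, these steps can be
chained forever. -/
theorem diverges_or_stable (p : P.State) :
    P.Diverges p ∨ ∃ q, Weak P.tr p [] q ∧ ∀ q', ¬ P.tr q Act.tau q' := by
  by_contra! h
  obtain ⟨s, h0, hs⟩ := exists_seq_of_step (Q := fun q => Weak P.tr p [] q)
    (R := fun _ q q' => P.tr q Act.tau q') (Weak.refl p) fun _ q hq => by
      obtain ⟨q', hq'⟩ := h.2 q hq
      exact ⟨q', hq.snoc_tau hq', hq'⟩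
  exact h.1 ⟨s, h0, fun n => (hs n).2⟩

theorem mem_failures {σ : List A} {X : Set A} : (σ, X) ∈ P.failures ↔
    ∃ q, Weak P.tr P.init σ q ∧ (∀ q', ¬ P.tr q Act.tau q') ∧
      ∀ a ∈ X, ∀ q', ¬ P.tr q (Act.vis a) q' := by
  constructor
  · rintro ⟨q, hq, h⟩
    refine ⟨q, hq, fun q' hq' => ?_, fun a ha q' hq' => ?_⟩
    · have : Act.tau ∈ P.initials q ∩ (Act.vis '' X ∪ {Act.tau}) := ⟨⟨q', hq'⟩, by simp⟩
      rw [h] at this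
      exact this
    · have : Act.vis a ∈ P.initials q ∩ (Act.vis '' X ∪ {Act.tau}) := ⟨⟨q', hq'⟩, by simp [ha]⟩
      rw [h] at this
      exact this
  · rintro ⟨q, hq, h, h'⟩
    refine ⟨q, hq, Set.eq_empty_iff_forall_notMem.2 ?_⟩
    rintro α ⟨⟨q', hq'⟩, ⟨a, ha, rfl⟩ | rfl⟩
    · exact h' a ha q' hq'
    · exact h q' hq'

theorem mem_deadlocks {σ : List A} : σ ∈ P.deadlocks ↔ (σ, Set.univ) ∈ P.failures := by
  rw [mem_failures]
  constructor
  · rintro ⟨q, hq, h⟩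
    have h' : ∀ α q', ¬ P.tr q α q' := fun α q' hq' => by
      have : α ∈ P.initials q := ⟨q', hq'⟩
      rw [h] at this
      exact this
    exact ⟨q, hq, h' _, fun a _ => h' _⟩
  · rintro ⟨q, hq, h, h'⟩
    refine ⟨q, hq, Set.eq_empty_iff_forall_notMem.2 ?_⟩
    rintro (_ | a) ⟨q', hq'⟩
    · exact h q' hq'
    · exact h' a trivial q' hq'

theorem ptraces_of_divergences {σ : List A} (h : σ ∈ P.divergences) : σ ∈ P.ptraces :=
  let ⟨q, hq, _⟩ := h; ⟨q, hq⟩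

theorem ptraces_of_failures {σ : List A} {X : Set A} (h : (σ, X) ∈ P.failures) : σ ∈ P.ptraces :=
  let ⟨q, hq, _⟩ := h; ⟨q, hq⟩

/-- After a partial trace the process diverges or settles in a stable state, which refuses the empty
set. Thus partial traces need no separate clause in the failure-based preorders. -/
theorem mem_ptraces_iff {σ : List A} : σ ∈ P.ptraces ↔ (σ, ∅) ∈ P.failuresD := by
  constructor
  · rintro ⟨q, hq⟩
    rcases diverges_or_stable q with h | ⟨q', hq', h⟩
    · exact Or.inr ⟨q, hq, h⟩
    · exact Or.inl (mem_failures.2 ⟨q', by simpa using hq.trans hq', h, by simp⟩)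
  · rintro (h | h)
    · exact ptraces_of_failures h
    · exact ptraces_of_divergences h

/-- `P` can perform the visible actions listed by the stream `a`. -/
def Follows (P : LTS.{u, v} A) (a : ℕ → Option A) : Prop :=
  ∃ p : ℕ → P.State, p 0 = P.init ∧ ∀ n, (a n = none → p (n + 1) = p n) ∧
    ∀ b, a n = some b → ∃ y, Weak P.tr (p n) [] y ∧ P.tr y (Act.vis b) (p (n + 1))

/-- The process is made to lag behind q: internal steps are postponed until just before the next
visible action. They then occur only where a context is about to synchronise and hence is live,
never while it suspends the process. -/
theorem Follows.of_weak {a : ℕ → Option A} {q : ℕ → P.State} (h0 : q 0 = P.init)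
    (h : ∀ n, Weak P.tr (q n) (a n).toList (q (n + 1))) : P.Follows a := by
  obtain ⟨s, hs0, hs⟩ := exists_seq_of_step (Z := ℕ × P.State)
    (Q := fun z => Weak P.tr z.2 [] (q z.1))
    (R := fun _ z z' => z'.1 = z.1 + 1 ∧ (a z.1 = none → z'.2 = z.2) ∧
      ∀ b, a z.1 = some b → ∃ y, Weak P.tr z.2 [] y ∧ P.tr y (Act.vis b) z'.2)
    (z := (0, P.init)) (h0 ▸ Weak.refl _) (by
      rintro - ⟨n, p⟩ hp
      have := h n
      cases ha : a n with
      | none =>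
        rw [ha] at this
        exact ⟨(n + 1, p), by simpa using hp.trans this, rfl, fun _ => rfl, by simp⟩
      | some b =>
        rw [ha] at this
        obtain ⟨y, z, hy, hyz, hz⟩ := Weak.of_cons this
        refine ⟨(n + 1, z), hz, rfl, by simp, fun b' hb' => ?_⟩
        cases hb'
        exact ⟨y, by simpa using hp.trans hy, hyz⟩)
  have hn : ∀ n, (s n).1 = n := by
    intro n
    induction n with
    | zero => rw [hs0]
    | succ n ih => rw [(hs n).2.1, ih]
  refine ⟨fun n => (s n).2, by simp [hs0], fun n => ?_⟩
  simpa [hn n] using (hs n).2.2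

end LTS

/-- The visible actions among the first `n` entries of a stream. -/
def traceUpTo {A : Type u} (a : ℕ → Option A) (n : ℕ) : List A :=
  (List.range n).filterMap a

/-! ### Streams of visible and silent moves -/

section Streams

variable {A : Type u} {P : LTS.{u, v} A} {a : ℕ → Option A}

theorem traceUpTo_succ (a : ℕ → Option A) (n : ℕ) :
    traceUpTo a (n + 1) = traceUpTo a n ++ (a n).toList := by
  cases h : a n <;> simp [traceUpTo, List.range_succ, h]

theorem prefixInf_map_range (ν : ℕ → A) (k : ℕ) : PrefixInf ((List.range k).map ν) ν := by
  simp [PrefixInf]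

theorem LTS.Follows.weak {p : ℕ → P.State}
    (hp : ∀ n, (a n = none → p (n + 1) = p n) ∧
      ∀ b, a n = some b → ∃ y, Weak P.tr (p n) [] y ∧ P.tr y (Act.vis b) (p (n + 1))) (n : ℕ) :
    Weak P.tr (p n) (a n).toList (p (n + 1)) := by
  cases h : a n with
  | none => rw [(hp n).1 h]; exact Weak.refl _
  | some b =>
    obtain ⟨y, hy, hy'⟩ := (hp n).2 b h
    exact hy.snoc_vis hy'

theorem LTS.Follows.traceUpTo_mem (h : P.Follows a) (n : ℕ) : traceUpTo a n ∈ P.ptraces := by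
  obtain ⟨p, h0, hp⟩ := h
  refine ⟨p n, ?_⟩
  induction n with
  | zero => rw [h0]; exact Weak.refl _
  | succ n ih => rw [traceUpTo_succ]; exact ih.trans (LTS.Follows.weak hp n)

theorem exists_seq_of_weak_traceUpTo {p q : P.State} {N : ℕ} (h : Weak P.tr p (traceUpTo a N) q) :
    ∃ s : ℕ → P.State, s 0 = p ∧ Weak P.tr (s N) [] q ∧
      ∀ n < N, Weak P.tr (s n) (a n).toList (s (n + 1)) := by
  induction N generalizing q with
  | zero => exact ⟨fun _ => p, rfl, h, by simp⟩
  | succ N ih =>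
    rw [traceUpTo_succ] at h
    obtain ⟨m, hm, hq⟩ := h.of_append
    obtain ⟨s, h0, hN, hs⟩ := ih hm
    refine ⟨fun n => if n ≤ N then s n else q, by simp [h0], ?_, fun n hn => ?_⟩
    · simpa using Weak.refl q
    · rcases Nat.lt_succ_iff_lt_or_eq.1 hn with hn | rfl
      · simpa [hn.le, Nat.succ_le_of_lt hn] using hs n hn
      · simpa using hN.trans hq

theorem follows_iff_of_eventually_none {N : ℕ} (hN : ∀ n, N ≤ n → a n = none) :
    P.Follows a ↔ traceUpTo a N ∈ P.ptraces := by
  refine ⟨fun h => h.traceUpTo_mem N, fun ⟨q, hq⟩ => ?_⟩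
  obtain ⟨s, h0, -, hs⟩ := exists_seq_of_weak_traceUpTo hq
  refine LTS.Follows.of_weak (q := fun n => s (min n N)) (by simpa using h0) fun n => ?_
  rcases lt_or_ge n N with hn | hn
  · simpa [hn.le, Nat.succ_le_of_lt hn] using hs n hn
  · rw [hN n hn, min_eq_right hn, min_eq_right (by omega)]
    exact Weak.refl _

open Classical in
/-- A function that changes only at positions satisfying `B` is determined by the number of such
positions passed. -/
theorem rel_of_count_eq {X : Type*} {R : X → X → Prop} (hr : ∀ x, R x x)
    (ht : ∀ x y z, R x y → R y z → R x z) {B : ℕ → Prop} {F : ℕ → X}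
    (hF : ∀ n, ¬ B n → R (F n) (F (n + 1))) {n m : ℕ} (hnm : n ≤ m)
    (hc : Nat.count B n = Nat.count B m) : R (F n) (F m) := by
  induction m, hnm using Nat.le_induction with
  | base => exact hr _
  | succ m hm ih =>
    have h1 := Nat.count_monotone B hm
    have h2 := Nat.count_monotone B (Nat.le_add_right m 1)
    have hB : ¬ B m := fun hB => by
      have := Nat.count_succ B m
      rw [if_pos hB] at this
      omega
    exact ht _ _ _ (ih (by omega)) (hF m hB)

-- With B the set of positions of visible entries, ν k is the entry at `Nat.nth B k`, and `Nat.count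
-- B n` visible actions occur before position n. The sequence ν does not depend on the process, so
-- it serves for P and Q alike. The first property picks, for each prefix length, a position where a
-- visible action comes next; a context performing that action is live there.
open Classical in
theorem exists_infinite_trace (h : ∀ N, ∃ n, N ≤ n ∧ a n ≠ none) :
    ∃ ν : ℕ → A, (∀ k, ∃ n, a n ≠ none ∧ traceUpTo a n = (List.range k).map ν) ∧
      (∀ n, ∃ k, traceUpTo a n = (List.range k).map ν) ∧
      ∀ P : LTS.{u, v} A, P.Follows a ↔ ν ∈ P.infTraces := by
  obtain ⟨B, hBa⟩ : ∃ B : ℕ → Prop, ∀ n, B n ↔ a n ≠ none := ⟨_, fun _ => Iff.rfl⟩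
  have hBn : ∀ n, ¬ B n → a n = none := fun n hn => not_not.1 fun h => hn ((hBa n).2 h)
  have hB : {n | B n}.Infinite := Set.infinite_of_not_bddAbove fun ⟨N, hN⟩ => by
    obtain ⟨n, hn, hn'⟩ := h (N + 1)
    have := hN ((hBa n).2 hn')
    omega
  have hnth : ∀ k, ∃ b, a (Nat.nth B k) = some b := fun k =>
    Option.ne_none_iff_exists'.1 ((hBa _).1 (Nat.nth_mem_of_infinite hB k))
  choose ν hν using hnth
  have htr : ∀ n, traceUpTo a n = (List.range (Nat.count B n)).map ν := by
    intro n
    induction n with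
    | zero => simp [traceUpTo]
    | succ n ih =>
      rw [traceUpTo_succ, ih, Nat.count_succ]
      by_cases hn : B n
      · have := hν (Nat.count B n)
        rw [Nat.nth_count hn] at this
        simp [if_pos hn, this, List.range_succ]
      · have : a n = none := hBn n hn
        simp [if_neg hn, this]
  refine ⟨ν, fun k => ⟨Nat.nth B k, (hBa _).1 (Nat.nth_mem_of_infinite hB k), ?_⟩,
      fun n => ⟨_, htr n⟩,
    fun P => ⟨?_, ?_⟩⟩
  · rw [htr, Nat.count_nth_of_infinite hB]
  · rintro ⟨p, h0, hp⟩
    have hconst : ∀ {n m}, n ≤ m → Nat.count B n = Nat.count B m → p n = p m :=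
      rel_of_count_eq (fun _ => rfl) (fun _ _ _ => Eq.trans)
        fun n hn => ((hp n).1 (hBn n hn)).symm
    refine ⟨fun k => p (Nat.nth B k), ?_, fun k => ?_⟩
    · rw [← h0]
      exact (hconst (Nat.zero_le _) (by rw [Nat.count_nth_of_infinite hB, Nat.count_zero])).symm
    · have h1 := LTS.Follows.weak hp (Nat.nth B k)
      rw [hν] at h1
      have h2 : p (Nat.nth B k + 1) = p (Nat.nth B (k + 1)) := by
        refine hconst (Nat.nth_strictMono hB k.lt_succ_self) ?_
        rw [Nat.count_nth_of_infinite hB, Nat.count_succ, Nat.count_nth_of_infinite hB,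
          if_pos (Nat.nth_mem_of_infinite hB k)]
      rw [h2] at h1
      exact h1
  · rintro ⟨s, h0, hs⟩
    refine LTS.Follows.of_weak (q := fun n => s (Nat.count B n)) (by simpa using h0) fun n => ?_
    by_cases hn : B n
    · have := hν (Nat.count B n)
      rw [Nat.nth_count hn] at this
      simpa [Nat.count_succ, if_pos hn, this] using hs (Nat.count B n)
    · have : a n = none := hBn n hn
      simpa [Nat.count_succ, if_neg hn, this] using Weak.refl _

theorem follows_some_iff {ν : ℕ → A} : P.Follows (fun n => some (ν n)) ↔ ν ∈ P.infTraces :=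
  ⟨fun ⟨p, h0, hp⟩ => ⟨p, h0, fun n => LTS.Follows.weak hp n⟩,
    fun ⟨_, h0, hs⟩ => LTS.Follows.of_weak h0 hs⟩

end Streams

end RewardTesting

namespace RewardTesting

/-! ### Contexts -/

/-- A unary context for processes over `A`, with output labels in `O`. In a state that is not `live`
the process in the context is suspended. -/
structure Ctx (A : Type u) (S : Type w) (O : Type*) where
  live : S → Prop
  own : S → O → S → Prop
  sync : S → A → O → S → Prop

namespace Ctx

variable {A : Type u} {S : Type w} {O : Type*}

/-- The steps of a process in a context; internal actions of the process have the output `z`. -/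
inductive Step (C : Ctx A S O) (z : O) (P : LTS.{u, v} A) :
    S × P.State → O → S × P.State → Prop
  | own {s s' : S} {o : O} {p : P.State} : C.own s o s' → Step C z P (s, p) o (s', p)
  | tau {s : S} {p p' : P.State} : C.live s → P.tr p Act.tau p' → Step C z P (s, p) z (s, p')
  | sync {s s' : S} {a : A} {o : O} {p p' : P.State} : C.live s → C.sync s a o s' →
      P.tr p (Act.vis a) p' → Step C z P (s, p) o (s', p')

/-- The moves of a context; `none` stands for an own move. -/
def Mv (C : Ctx A S O) (s : S) (a : Option A) (o : O) (s' : S) : Prop :=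
  (a = none ∧ C.own s o s') ∨ ∃ b, a = some b ∧ C.live s ∧ C.sync s b o s'

variable {C : Ctx A S ℝ} {P : LTS.{u, v} A}

/-- `Path C s σ t s'`: a finite path of the context, synchronising on `σ`, with total
reward `t`. -/
inductive Path (C : Ctx A S ℝ) : S → List A → ℝ → S → Prop
  | refl (s : S) : Path C s [] 0 s
  | own {s s' s'' : S} {r t : ℝ} {σ : List A} :
      C.own s r s' → Path C s' σ t s'' → Path C s σ (r + t) s''
  | sync {s s' s'' : S} {a : A} {r t : ℝ} {σ : List A} :
      C.live s → C.sync s a r s' → Path C s' σ t s'' → Path C s (a :: σ) (r + t) s''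

theorem Path.trans {s s' s'' : S} {σ ρ : List A} {t t' : ℝ} (h : Path C s σ t s')
    (h' : Path C s' ρ t' s'') : Path C s (σ ++ ρ) (t + t') s'' := by
  induction h with
  | refl s => simpa using h'
  | own h _ ih => rw [add_assoc]; exact Path.own h (ih h')
  | sync h1 h2 _ ih => rw [add_assoc]; exact Path.sync h1 h2 (ih h')

theorem Path.of_mv {s s' : S} {a : Option A} {r : ℝ} (h : C.Mv s a r s') :
    Path C s a.toList r s' := by
  rcases h with ⟨rfl, h⟩ | ⟨b, rfl, h1, h2⟩
  · simpa using Path.own h (Path.refl s')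
  · simpa using Path.sync h1 h2 (Path.refl s')

theorem Path.of_seq {s : ℕ → S} {a : ℕ → Option A} {r : ℕ → ℝ}
    (h : ∀ n, C.Mv (s n) (a n) (r n) (s (n + 1))) (n : ℕ) :
    Path C (s 0) (traceUpTo a n) (∑ i ∈ Finset.range n, r i) (s n) := by
  induction n with
  | zero => simpa [traceUpTo] using Path.refl (s 0)
  | succ n ih =>
    rw [traceUpTo_succ, Finset.sum_range_succ]
    exact ih.trans (Path.of_mv (h n))

/-- Cutting a path just before it synchronises on a given action. -/
theorem Path.cut {s s' : S} {σ ρ : List A} {a : A} {t : ℝ} (h : Path C s (σ ++ a :: ρ) t s') :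
    ∃ s₁ t₁ t₂, Path C s σ t₁ s₁ ∧ C.live s₁ ∧ Path C s₁ (a :: ρ) t₂ s' ∧ t = t₁ + t₂ := by
  generalize hτ : σ ++ a :: ρ = τ at h
  induction h generalizing σ with
  | refl s => simp at hτ
  | own h _ ih =>
    obtain ⟨s₁, t₁, t₂, h1, h2, h3, rfl⟩ := ih hτ
    exact ⟨s₁, _, t₂, Path.own h h1, h2, h3, by ring⟩
  | @sync s s' s'' b r t τ h1 h2 h3 ih =>
    rcases σ with _ | ⟨c, σ⟩
    · simp only [List.nil_append, List.cons.injEq] at hτ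
      obtain ⟨rfl, rfl⟩ := hτ
      exact ⟨s, 0, r + t, Path.refl s, h1, Path.sync h1 h2 h3, by ring⟩
    · simp only [List.cons_append, List.cons.injEq] at hτ
      obtain ⟨rfl, hτ⟩ := hτ
      obtain ⟨s₁, t₁, t₂, h4, h5, h6, rfl⟩ := ih hτ
      exact ⟨s₁, _, t₂, Path.sync h1 h2 h4, h5, h6, by ring⟩

theorem run_tau {s : S} {p p' : P.State} (hs : C.live s) (h : Weak P.tr p [] p') :
    ∃ n, Run (C.Step 0 P) n (s, p) 0 (s, p') :=
  Weak.nil_induction (motive := fun q => ∃ n, Run (C.Step 0 P) n (s, p) 0 (s, q)) h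
    ⟨0, Run.refl _⟩ fun _ _ ⟨n, hn⟩ hxy =>
      ⟨n + 1, by simpa using hn.trans (Run.single (Step.tau hs hxy))⟩

/-- The process may end some internal steps short of q, since the context need not be live after its
last synchronisation. -/
theorem Path.exists_run {s s' : S} {σ : List A} {t : ℝ} (h : Path C s σ t s') {p q : P.State}
    (hq : Weak P.tr p σ q) : ∃ n p', Run (C.Step 0 P) n (s, p) t (s', p') ∧
      Weak P.tr p' [] q := by
  induction h generalizing p with
  | refl s => exact ⟨0, p, Run.refl _, hq⟩
  | own h _ ih =>
    obtain ⟨n, p', hr, hp'⟩ := ih hq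
    exact ⟨n + 1, p', Run.head (Step.own h) hr, hp'⟩
  | sync h1 h2 _ ih =>
    obtain ⟨y, z, hy, hyz, hz⟩ := hq.of_cons
    obtain ⟨n, p', hr, hp'⟩ := ih hz
    obtain ⟨m, hm⟩ := run_tau h1 hy
    exact ⟨_, p', by simpa using hm.trans (Run.head (Step.sync h1 h2 hyz) hr), hp'⟩

theorem exists_path_of_run {n : ℕ} {x y : S × P.State} {t : ℝ} (h : Run (C.Step 0 P) n x t y) :
    ∃ σ, Path C x.1 σ t y.1 ∧ Weak P.tr x.2 σ y.2 := by
  induction h with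
  | refl x => exact ⟨[], Path.refl _, Weak.refl _⟩
  | head h _ ih =>
    obtain ⟨σ, h1, h2⟩ := ih
    cases h with
    | own h => exact ⟨σ, Path.own h h1, h2⟩
    | tau h h' => exact ⟨σ, by simpa using h1, Weak.tau h' h2⟩
    | sync h h' h'' => exact ⟨_, Path.sync h h' h1, Weak.vis h'' h2⟩

/-- The possible rewards of `P` in the context `C`, expressed by paths of `C` and traces of `P`. -/
inductive Adm (C : Ctx A S ℝ) (P : LTS.{u, v} A) (s : S) : EReal → Prop
  | stuck {σ : List A} {t : ℝ} {s' : S} : Path C s σ t s' → (∀ r s'', ¬ C.own s' r s'') →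
      (C.live s' → (σ, {a | ∃ r s'', C.sync s' a r s''}) ∈ P.failures) →
      σ ∈ P.ptraces → Adm C P s t
  | div {σ : List A} {t : ℝ} {s' : S} : Path C s σ t s' → C.live s' → σ ∈ P.divergences →
      Adm C P s t
  | inf {st : ℕ → S} {a : ℕ → Option A} {r : ℕ → ℝ} : st 0 = s →
      (∀ n, C.Mv (st n) (a n) (r n) (st (n + 1))) → P.Follows a → Adm C P s (limReward r)

/-- A path and a matching trace are merged into a run, inserting internal steps of reward 0 where
the context is live. For an infinite path each move becomes a nonempty block of steps; the partial
sums agree only at the block ends, hence the inequality. -/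
theorem Adm.exists_outcome {s : S} {o : EReal} (h : C.Adm P s o) :
    ∃ o' ∈ Outcomes (C.Step 0 P) (s, P.init), o' ≤ o := by
  cases h with
  | @stuck σ t s' hp ho hl hσ =>
    by_cases hs : C.live s'
    · obtain ⟨q, hq, h1, h2⟩ := LTS.mem_failures.1 (hl hs)
      obtain ⟨n, p', hr, hp'⟩ := hp.exists_run hq
      obtain ⟨m, hm⟩ := run_tau hs hp'
      refine ⟨(t : ℝ), Or.inl ⟨_, t, _, by simpa using hr.trans hm, ?_, rfl⟩, le_rfl⟩
      rintro r z (h | h | h)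
      · exact ho _ _ h
      · exact h1 _ (by assumption)
      · exact h2 _ ⟨_, _, by assumption⟩ _ (by assumption)
    · obtain ⟨q, hq⟩ := hσ
      obtain ⟨n, p', hr, -⟩ := hp.exists_run hq
      refine ⟨(t : ℝ), Or.inl ⟨_, t, _, hr, ?_, rfl⟩, le_rfl⟩
      rintro r z (h | h | h)
      · exact ho _ _ h
      · exact hs h
      · exact hs h
  | @div σ t s' hp hs hσ =>
    obtain ⟨q, hq, hd⟩ := hσ
    obtain ⟨n, p', hr, hp'⟩ := hp.exists_run hq
    obtain ⟨x, h0, hx⟩ := LTS.Diverges.of_weak hp' hd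
    refine ⟨_, hr.mem_outcomes (Or.inr ⟨fun n => (s', x n), fun _ => 0, by simp [h0],
      fun n => Step.tau hs (hx n), rfl⟩), ?_⟩
    rw [limReward_eq_sum (N := 0) fun _ _ => rfl]
    simp
  | @inf st a r h0 hm hf =>
    obtain ⟨p, hp0, hp⟩ := hf
    have := exists_outcome_le_of_blocks (st := C.Step 0 P) (x := fun n => (st n, p n)) (ρ := r) (by
      intro n
      rcases hm n with ⟨ha, h⟩ | ⟨b, hb, h1, h2⟩
      · simp only [(hp n).1 ha]
        exact ⟨0, Run.single (Step.own h)⟩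
      · obtain ⟨y, hy, hy'⟩ := (hp n).2 b hb
        obtain ⟨m, hm⟩ := run_tau h1 hy
        exact ⟨m, by simpa using hm.trans (Run.single (Step.sync h1 h2 hy'))⟩)
    simpa [h0, hp0] using this

-- Conversely, the internal steps of the process are deleted from an infinite run. If only finitely
-- many moves of the context remain, the process diverges while the context is live. Otherwise B is
-- the infinite set of positions of these moves; between them the context stands still and earns
-- nothing, so the deletion preserves the values of the partial sums.
open Classical in
theorem exists_adm_of_infinite {x : ℕ → S × P.State} {r : ℕ → ℝ}
    (hx : ∀ n, C.Step 0 P (x n) (r n) (x (n + 1))) (h0 : (x 0).2 = P.init) :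
    ∃ o', C.Adm P (x 0).1 o' ∧ o' ≤ limReward r := by
  have hcase : ∀ n, (∃ a, C.Mv (x n).1 a (r n) (x (n + 1)).1 ∧
      Weak P.tr (x n).2 a.toList (x (n + 1)).2) ∨
      ((x (n + 1)).1 = (x n).1 ∧ C.live (x n).1 ∧ r n = 0 ∧
        P.tr (x n).2 Act.tau (x (n + 1)).2) := by
    intro n
    generalize hy : x n = y
    generalize hz : x (n + 1) = z
    generalize hr : r n = ρ
    have := hx n
    rw [hy, hz, hr] at this
    cases this with
    | own h => exact Or.inl ⟨none, Or.inl ⟨rfl, h⟩, Weak.refl _⟩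
    | tau h h' => exact Or.inr ⟨rfl, h, rfl, h'⟩
    | sync h h' h'' =>
      exact Or.inl ⟨some _, Or.inr ⟨_, rfl, h, h'⟩, Weak.vis h'' (Weak.refl _)⟩
  obtain ⟨B, hB⟩ : ∃ B : ℕ → Prop, ∀ n, B n ↔ ∃ a, C.Mv (x n).1 a (r n) (x (n + 1)).1 ∧
      Weak P.tr (x n).2 a.toList (x (n + 1)).2 := ⟨_, fun _ => Iff.rfl⟩
  have hnB : ∀ n, ¬ B n → (x (n + 1)).1 = (x n).1 ∧ C.live (x n).1 ∧ r n = 0 ∧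
        P.tr (x n).2 Act.tau (x (n + 1)).2 := fun n hn =>
    (hcase n).resolve_left fun h => hn ((hB n).2 h)
  by_cases hfin : ∃ N, ∀ n, N ≤ n → ¬ B n
  · obtain ⟨N, hN⟩ := hfin
    obtain ⟨σ, hσ, hw⟩ := exists_path_of_run (Run.of_seq (n := N) fun i _ => hx i)
    rw [h0] at hw
    refine ⟨_, Adm.div hσ (hnB N (hN N le_rfl)).2.1 ⟨_, hw, fun n => (x (N + n)).2, rfl,
      fun n => (hnB _ (hN (N + n) (by omega))).2.2.2⟩, ?_⟩
    rw [limReward_eq_sum fun i hi => (hnB i (hN i hi)).2.2.1]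
  · push Not at hfin
    have hinf : {n | B n}.Infinite := Set.infinite_of_not_bddAbove fun ⟨N, hN⟩ => by
      obtain ⟨n, hn, hn'⟩ := hfin (N + 1)
      have := hN hn'
      omega
    choose a hmv hweak using fun k => (hB _).1 (Nat.nth_mem_of_infinite hinf k)
    have hc1 : ∀ {n m}, n ≤ m → Nat.count B n = Nat.count B m → (x n).1 = (x m).1 :=
      rel_of_count_eq (F := fun n => (x n).1) (fun _ => rfl) (fun _ _ _ => Eq.trans)
        fun n hn => (hnB n hn).1.symm
    have hc2 : ∀ {n m}, n ≤ m → Nat.count B n = Nat.count B m →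
        Weak P.tr (x n).2 [] (x m).2 :=
      rel_of_count_eq (F := fun n => (x n).2) (R := fun p q => Weak P.tr p [] q) Weak.refl
        (fun _ _ _ h h' => by simpa using Weak.trans h h')
        fun n hn => Weak.tau (hnB n hn).2.2.2 (Weak.refl _)
    have hnext : ∀ k, Nat.count B (Nat.nth B k + 1) = Nat.count B (Nat.nth B (k + 1)) := by
      intro k
      rw [Nat.count_nth_of_infinite hinf, Nat.count_succ, Nat.count_nth_of_infinite hinf,
          if_pos (Nat.nth_mem_of_infinite hinf k)]
    have hle : ∀ k, Nat.nth B k + 1 ≤ Nat.nth B (k + 1) := fun k =>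
      Nat.nth_strictMono hinf k.lt_succ_self
    have hzero : Nat.count B 0 = Nat.count B (Nat.nth B 0) := by
      rw [Nat.count_nth_of_infinite hinf, Nat.count_zero]
    refine ⟨_, Adm.inf (st := fun k => (x (Nat.nth B k)).1) (a := a)
      (r := fun k => r (Nat.nth B k)) (hc1 (Nat.zero_le _) hzero).symm (fun k => ?_) ?_, ?_⟩
    · have := hmv k
      rwa [hc1 (hle k) (hnext k)] at this
    -- Entry k + 1 is the process state right after the k-th move of the context; the internal steps
    -- leading up to a move are counted with that move.
    · refine LTS.Follows.of_weak (q := fun k => Nat.casesOn k P.init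
        fun k => (x (Nat.nth B k + 1)).2) rfl ?_
      rintro (_ | k)
      · have := (hc2 (Nat.zero_le _) hzero).trans (hweak 0)
        rwa [h0] at this
      · exact (hc2 (hle k) (hnext k)).trans (hweak (k + 1))
    · refine limReward_le_of_subseq (g := Nat.count B) ?_ fun n => ?_
      · refine Filter.tendsto_atTop_atTop_of_monotone (Nat.count_monotone B) fun k => ?_
        exact ⟨Nat.nth B k, (Nat.count_nth_of_infinite hinf k).ge⟩
      · induction n with
        | zero => simp
        | succ n ih =>
          rw [Nat.count_succ, Finset.sum_range_succ (n := n), ← ih]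
          by_cases hn : B n
          · rw [if_pos hn, Finset.sum_range_succ, Nat.nth_count hn]
          · rw [if_neg hn, (hnB n hn).2.2.1]
            simp

theorem exists_adm {s : S} {o : EReal} (h : o ∈ Outcomes (C.Step 0 P) (s, P.init)) :
    ∃ o', C.Adm P s o' ∧ o' ≤ o := by
  rcases h with ⟨n, t, ⟨s', q⟩, hr, hs, rfl⟩ | ⟨x, r, h0, hx, rfl⟩
  · obtain ⟨σ, h1, h2⟩ := exists_path_of_run hr
    refine ⟨(t : ℝ), Adm.stuck h1 (fun r s'' h => hs _ _ (Step.own h))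
      (fun hl => LTS.mem_failures.2 ⟨q, h2, fun q' hq' => hs _ _ (Step.tau hl hq'), ?_⟩)
      ⟨q, h2⟩, le_rfl⟩
    rintro a ⟨r, s'', h⟩ q' hq'
    exact hs _ _ (Step.sync hl h hq')
  · have := exists_adm_of_infinite hx (by simp [h0])
    simpa [h0] using this

end Ctx

end RewardTesting

namespace RewardTesting

/-! ### Implications between the explicitly characterised preorders -/

section Implications

variable {A : Type u} {P Q : LTS.{u, v} A}

theorem ptraces_subset_of_failuresD (h : Q.failuresD ⊆ P.failuresD) : Q.ptraces ⊆ P.ptraces :=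
  fun _ hσ => LTS.mem_ptraces_iff.2 (h (LTS.mem_ptraces_iff.1 hσ))

theorem NDFD.traceInf (h : NDFD P Q) : TraceInf P Q :=
  ⟨ptraces_subset_of_failuresD h.2.2, h.2.1⟩

theorem NDFD.fdid (h : NDFD P Q) : FDId P Q := by
  refine ⟨h.1, ?_, h.2.2⟩
  rintro ν (hν | hν)
  · exact Or.inl (h.2.1 hν)
  · exact Or.inr fun σ hσ => let ⟨ρ, h1, h2⟩ := hν σ hσ; ⟨ρ, h.1 h1, h2⟩

theorem TraceInf.trace (h : TraceInf P Q) : Trace P Q := h.1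

theorem FDId.trace (h : FDId P Q) : Trace P Q := ptraces_subset_of_failuresD h.2.2

theorem FDId.fdibot (h : FDId P Q) : FDIbot P Q := by
  refine ⟨fun σ ⟨ρ, h1, h2⟩ => ⟨ρ, h.1 h1, h2⟩, ?_, ?_⟩
  · rintro ν (hν | ⟨ρ, h1, h2⟩)
    · rcases h.2.1 (Or.inl hν) with hν | hν
      · exact Or.inl hν
      · obtain ⟨ρ, h1, -, h2⟩ := hν [] rfl
        exact Or.inr ⟨ρ, h1, h2⟩
    · exact Or.inr ⟨ρ, h.1 h1, h2⟩
  · rintro ⟨σ, X⟩ (hσ | ⟨ρ, h1, h2⟩)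
    · rcases h.2.2 (Or.inl hσ) with hσ | hσ
      · exact Or.inl hσ
      · exact Or.inr ⟨σ, hσ, List.prefix_rfl⟩
    · exact Or.inr ⟨ρ, h.1 h1, h2⟩

/-- A divergence at σ itself already makes σ a partial trace of P, so the second alternative can be
taken with a strict prefix. This matters where the context is not live at the end of σ and a
divergence there could not be used. -/
theorem FDIbot.ptraces (h : FDIbot P Q) {σ : List A} (hσ : σ ∈ Q.ptraces) :
    σ ∈ P.ptraces ∨ ∃ ρ ∈ P.divergences, ρ <+: σ ∧ ρ ≠ σ := by
  have : (σ, ∅) ∈ P.failuresBot := by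
    apply h.2.2
    rcases LTS.mem_ptraces_iff.1 hσ with h1 | h1
    · exact Or.inl h1
    · exact Or.inr ⟨σ, h1, List.prefix_rfl⟩
  rcases this with h1 | ⟨ρ, h1, h2⟩
  · exact Or.inl (LTS.ptraces_of_failures h1)
  · by_cases hρ : ρ = σ
    · subst hρ
      exact Or.inl (LTS.ptraces_of_divergences h1)
    · exact Or.inr ⟨ρ, h1, h2, hρ⟩

/-- A stream with finitely many visible entries amounts to a partial trace, any other stream to an
infinite trace. -/
theorem LTS.Follows.mono (h1 : Q.ptraces ⊆ P.ptraces) (h2 : Q.infTraces ⊆ P.infTraces)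
    {a : ℕ → Option A} (h : Q.Follows a) : P.Follows a := by
  by_cases ha : ∃ N, ∀ n, N ≤ n → a n = none
  · obtain ⟨N, hN⟩ := ha
    rw [follows_iff_of_eventually_none hN] at h ⊢
    exact h1 h
  · push Not at ha
    obtain ⟨ν, -, -, hν⟩ := exists_infinite_trace.{u, v} ha
    rw [hν] at h ⊢
    exact h2 h

end Implications

/-! ### The explicit preorders imply reward testing by arbitrary contexts -/

theorem outcome_nonpos {X : Type*} {st : X → ℝ → X → Prop} (I : X → Prop)
    (hI : ∀ x r y, I x → st x r y → I y ∧ r ≤ 0) {x : X} (hx : I x) {o : EReal}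
    (ho : o ∈ Outcomes st x) : o ≤ 0 := by
  rcases ho with ⟨n, t, y, hr, -, rfl⟩ | ⟨s, r, rfl, hs, rfl⟩
  · have : t ≤ 0 := by
      induction hr with
      | refl x => exact le_rfl
      | head h _ ih => exact add_nonpos (hI _ _ _ hx h).2 (ih (hI _ _ _ hx h).1)
    exact_mod_cast this
  · have h : ∀ n, I (s n) := fun n => by
      induction n with
      | zero => exact hx
      | succ n ih => exact (hI _ _ _ ih (hs n)).1
    simpa using limReward_le_sum (N := 0) fun i _ => (hI _ _ _ (h i) (hs i)).2

namespace Ctx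

variable {A : Type u} {S : Type w} (C : Ctx A S ℝ) {P Q : LTS.{u, v} A} {s : S}

/-- The outcomes of testing `P` in the context `C` with initial state `s`. -/
def outcomes (s : S) (P : LTS.{u, v} A) : Set EReal := Outcomes (C.Step 0 P) (s, P.init)

/-- From states satisfying `I`, which is preserved by moves, all rewards satisfy `p`. -/
def RewardInv (I : S → Prop) (p : ℝ → Prop) : Prop :=
  ∀ s a r s', I s → C.Mv s a r s' → I s' ∧ p r

/-- Each infinite path has only finitely many negative rewards. -/
def FinitePenalty (s : S) : Prop :=
  ∀ (st : ℕ → S) (a : ℕ → Option A) (r : ℕ → ℝ), st 0 = s →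
    (∀ n, C.Mv (st n) (a n) (r n) (st (n + 1))) → {n | r n < 0}.Finite

variable {C}

theorem smythLE_of_adm (h : ∀ o, C.Adm Q s o → ∃ o' ∈ C.outcomes s P, o' ≤ o) :
    SmythLE (C.outcomes s P) (C.outcomes s Q) := fun _ ho =>
  let ⟨_, h1, h2⟩ := exists_adm ho
  let ⟨o', h3, h4⟩ := h _ h1
  ⟨o', h3, h4.trans h2⟩

theorem exists_bound_of_finite {r : ℕ → ℝ} (h : {n | r n < 0}.Finite) :
    ∃ N, ∀ n, N ≤ n → 0 ≤ r n := by
  obtain ⟨N, hN⟩ := h.bddAbove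
  refine ⟨N + 1, fun n hn => ?_⟩
  by_contra hr
  have := hN (a := n) (not_le.1 hr)
  omega

/-- When rewards are nonpositive, P can follow the path and then continue arbitrarily: every
completion keeps the total at or below t. -/
theorem Path.exists_outcome {σ : List A} {t : ℝ} {s' : S} (h : Path C s σ t s')
    {I : S → Prop} (hI : C.RewardInv I (· ≤ 0)) (hs : I s) (hσ : σ ∈ P.ptraces) :
    ∃ o ∈ C.outcomes s P, o ≤ t := by
  obtain ⟨q, hq⟩ := hσ
  obtain ⟨n, p', hr, -⟩ := h.exists_run hq
  obtain ⟨o, ho⟩ := outcomes_nonempty (C.Step 0 P) (s', p')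
  have hs' : I s' := by
    clear * - h hI hs
    induction h with
    | refl s => exact hs
    | own h _ ih => exact ih (hI _ none _ _ hs (Or.inl ⟨rfl, h⟩)).1
    | sync h h' _ ih => exact ih (hI _ (some _) _ _ hs (Or.inr ⟨_, rfl, h, h'⟩)).1
  have : o ≤ 0 := by
    refine outcome_nonpos (fun x : S × P.State => I x.1) ?_ hs' ho
    rintro - r - hx (h | ⟨h, h'⟩ | ⟨h, h', h''⟩)
    · exact hI _ none _ _ hx (Or.inl ⟨rfl, h⟩)
    · exact ⟨hx, le_rfl⟩
    · exact hI _ (some _) _ _ hx (Or.inr ⟨_, rfl, h, h'⟩)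
  refine ⟨_, hr.mem_outcomes ho, ?_⟩
  simpa using add_le_add_right this (t : EReal)

theorem smythLE_of_ndfd (h : NDFD P Q) (C : Ctx A S ℝ) (s : S) :
    SmythLE (C.outcomes s P) (C.outcomes s Q) := by
  refine smythLE_of_adm fun o ho => Adm.exists_outcome ?_
  have hptr := h.traceInf.1
  cases ho with
  | @stuck σ t s' hp ho hl hσ =>
    by_cases hs : C.live s'
    · rcases h.2.2 (Or.inl (hl hs)) with h1 | h1
      · exact Adm.stuck hp ho (fun _ => h1) (hptr hσ)
      · exact Adm.div hp hs h1
    · exact Adm.stuck hp ho (fun h => (hs h).elim) (hptr hσ)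
  | div hp hs hσ => exact Adm.div hp hs (h.1 hσ)
  | inf h0 hm hf => exact Adm.inf h0 hm (hf.mono hptr h.2.1)

theorem Adm.exists_outcome_of_trace {I : S → Prop} (hI : C.RewardInv I (· ≤ 0)) (hs : I s)
    (h : Trace P Q) {o : EReal} (ho : C.Adm Q s o)
    (hinf : ∀ (st : ℕ → S) (a : ℕ → Option A) (r : ℕ → ℝ), st 0 = s →
      (∀ n, C.Mv (st n) (a n) (r n) (st (n + 1))) → Q.Follows a →
      ∃ o' ∈ C.outcomes s P, o' ≤ limReward r) :
    ∃ o' ∈ C.outcomes s P, o' ≤ o := by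
  cases ho with
  | stuck hp ho hl hσ => exact hp.exists_outcome hI hs (h hσ)
  | div hp hl hσ => exact hp.exists_outcome hI hs (h (LTS.ptraces_of_divergences hσ))
  | inf h0 hm hf => exact hinf _ _ _ h0 hm hf

theorem smythLE_of_traceInf (h : TraceInf P Q) {I : S → Prop} (hI : C.RewardInv I (· ≤ 0))
    (hs : I s) : SmythLE (C.outcomes s P) (C.outcomes s Q) :=
  smythLE_of_adm fun _ ho => ho.exists_outcome_of_trace hI hs h.trace fun _ _ _ h0 hm hf =>
    Adm.exists_outcome (Adm.inf h0 hm (hf.mono h.1 h.2))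

/-- Beyond the last negative reward all rewards vanish, so the reward of an infinite path is that of
a finite initial part, for which a partial trace suffices. -/
theorem smythLE_of_trace (h : Trace P Q) {I : S → Prop} (hI : C.RewardInv I (· ≤ 0))
    (hs : I s) (hC : C.FinitePenalty s) : SmythLE (C.outcomes s P) (C.outcomes s Q) := by
  refine smythLE_of_adm fun _ ho => ho.exists_outcome_of_trace hI hs h fun st a r h0 hm hf => ?_
  obtain ⟨N, hN⟩ := exists_bound_of_finite (hC st a r h0 hm)
  have hIn : ∀ n, I (st n) := fun n => by
    induction n with
    | zero => rwa [h0]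
    | succ n ih => exact (hI _ _ _ _ ih (hm n)).1
  rw [limReward_eq_sum fun i hi => le_antisymm (hI _ _ _ _ (hIn i) (hm i)).2 (hN i hi)]
  have := Path.of_seq hm N
  rw [h0] at this
  exact this.exists_outcome hI hs (h (hf.traceUpTo_mem N))

theorem live_of_mv {s' : S} {a : Option A} {r : ℝ} (h : C.Mv s a r s') (ha : a ≠ none) :
    C.live s := by
  rcases h with ⟨rfl, -⟩ | ⟨b, -, h, -⟩
  · exact (ha rfl).elim
  · exact h

theorem length_traceUpTo_mono (a : ℕ → Option A) : Monotone fun n => (traceUpTo a n).length :=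
  monotone_nat_of_le_succ fun n => by simp [traceUpTo_succ]

/-- The essential case is an infinite trace ν of Q to which P responds only by divergences along ν.
One is chosen at a prefix so long that all negative rewards have already been paid; diverging there
forgoes only nonnegative rewards. -/
theorem smythLE_of_fdid (h : FDId P Q) (hC : C.FinitePenalty s) :
    SmythLE (C.outcomes s P) (C.outcomes s Q) := by
  have hptr := h.trace
  refine smythLE_of_adm fun o ho => ?_
  cases ho with
  | @stuck σ t s' hp ho hl hσ =>
    apply Adm.exists_outcome
    by_cases hs : C.live s'
    · rcases h.2.2 (Or.inl (hl hs)) with h1 | h1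
      · exact Adm.stuck hp ho (fun _ => h1) (hptr hσ)
      · exact Adm.div hp hs h1
    · exact Adm.stuck hp ho (fun h => (hs h).elim) (hptr hσ)
  | div hp hs hσ => exact Adm.exists_outcome (Adm.div hp hs (h.1 hσ))
  | @inf st a r h0 hm hf =>
    by_cases ha : ∃ N, ∀ n, N ≤ n → a n = none
    · obtain ⟨N, hN⟩ := ha
      refine Adm.exists_outcome (Adm.inf h0 hm ?_)
      rw [follows_iff_of_eventually_none hN] at hf ⊢
      exact hptr hf
    · push Not at ha
      obtain ⟨ν, h1, h2, h3⟩ := exists_infinite_trace.{u, v} ha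
      rw [h3] at hf
      rcases h.2.1 (Or.inl hf) with hν | hν
      · exact Adm.exists_outcome (Adm.inf h0 hm ((h3 P).2 hν))
      · obtain ⟨N, hN⟩ := exists_bound_of_finite (hC st a r h0 hm)
        obtain ⟨k, hk⟩ := h2 N
        obtain ⟨ρ, hρ, hkρ, hρν⟩ := hν _ (prefixInf_map_range ν k)
        obtain ⟨n, hn, hnρ⟩ := h1 ρ.length
        rw [← hρν] at hnρ
        -- Otherwise the first N positions would contain the visible action at n, so their trace, of
        -- length k, would be longer than ρ; but ρ extends that trace.
        have hNn : N ≤ n := by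
          by_contra hlt
          have h4 := length_traceUpTo_mono a (show n + 1 ≤ N by omega)
          obtain ⟨b, hb⟩ := Option.ne_none_iff_exists'.1 hn
          have h5 := hkρ.length_le
          rw [← hk] at h5
          simp [traceUpTo_succ, hnρ, hb] at h4
          omega
        have hpath := Path.of_seq hm n
        rw [hnρ, h0] at hpath
        obtain ⟨o', h4, h5⟩ := (Adm.div hpath (live_of_mv (hm n) hn) hρ).exists_outcome
        exact ⟨o', h4, h5.trans (sum_le_limReward fun i hi => hN i (hNn.trans hi))⟩

theorem Path.nonneg {σ : List A} {t : ℝ} {s' : S} (h : Path C s σ t s')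
    {I : S → Prop} (hI : C.RewardInv I (0 ≤ ·)) (hs : I s) : I s' ∧ 0 ≤ t := by
  induction h with
  | refl s => exact ⟨hs, le_rfl⟩
  | own h _ ih =>
    have := hI _ none _ _ hs (Or.inl ⟨rfl, h⟩)
    exact ⟨(ih this.1).1, add_nonneg this.2 (ih this.1).2⟩
  | sync h h' _ ih =>
    have := hI _ (some _) _ _ hs (Or.inr ⟨_, rfl, h, h'⟩)
    exact ⟨(ih this.1).1, add_nonneg this.2 (ih this.1).2⟩

/-- Diverging early forgoes only nonnegative rewards. For a strict prefix the path is cut just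
before its next synchronisation, where the context must be live; at the end of the path liveness has
to be supplied. -/
theorem Path.exists_outcome_of_divergence {σ ρ : List A} {t : ℝ} {s' : S} (h : Path C s σ t s')
    {I : S → Prop} (hI : C.RewardInv I (0 ≤ ·)) (hs : I s) (hρ : ρ ∈ P.divergences)
    (hρσ : ρ <+: σ) (hl : ρ = σ → C.live s') : ∃ o ∈ C.outcomes s P, o ≤ t := by
  obtain ⟨_ | ⟨a, τ⟩, rfl⟩ := hρσ
  · rw [List.append_nil] at h hl
    exact (Adm.div h (hl rfl) hρ).exists_outcome
  · obtain ⟨s₁, t₁, t₂, h1, h2, h3, rfl⟩ := h.cut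
    obtain ⟨o, h4, h5⟩ := (Adm.div h1 h2 hρ).exists_outcome
    have := (h3.nonneg hI (h1.nonneg hI hs).1).2
    exact ⟨o, h4, h5.trans (by exact_mod_cast le_add_of_nonneg_right this)⟩

theorem smythLE_of_fdibot (h : FDIbot P Q) {I : S → Prop} (hI : C.RewardInv I (0 ≤ ·))
    (hs : I s) : SmythLE (C.outcomes s P) (C.outcomes s Q) := by
  refine smythLE_of_adm fun o ho => ?_
  cases ho with
  | @stuck σ t s' hp ho hl hσ =>
    by_cases hs' : C.live s'
    · rcases h.2.2 (Or.inl (hl hs')) with h1 | ⟨ρ, h1, h2⟩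
      · exact (Adm.stuck hp ho (fun _ => h1) (LTS.ptraces_of_failures h1)).exists_outcome
      · exact hp.exists_outcome_of_divergence hI hs h1 h2 fun _ => hs'
    · rcases h.ptraces hσ with h1 | ⟨ρ, h1, h2, h3⟩
      · exact (Adm.stuck hp ho (fun h => (hs' h).elim) h1).exists_outcome
      · exact hp.exists_outcome_of_divergence hI hs h1 h2 fun h => (h3 h).elim
  | div hp hs' hσ =>
    obtain ⟨ρ, h1, h2⟩ := h.1 ⟨_, hσ, List.prefix_rfl⟩
    exact hp.exists_outcome_of_divergence hI hs h1 h2 fun _ => hs'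
  | @inf st a r h0 hm hf =>
    have hIn : ∀ n, I (st n) := fun n => by
      induction n with
      | zero => rwa [h0]
      | succ n ih => exact (hI _ _ _ _ ih (hm n)).1
    have hle : ∀ N, ((∑ i ∈ Finset.range N, r i : ℝ) : EReal) ≤ limReward r := fun N =>
      sum_le_limReward fun i _ => (hI _ _ _ _ (hIn i) (hm i)).2
    by_cases ha : ∃ N, ∀ n, N ≤ n → a n = none
    · obtain ⟨N, hN⟩ := ha
      rw [follows_iff_of_eventually_none hN] at hf
      rcases h.ptraces hf with h1 | ⟨ρ, h1, h2, h3⟩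
      · exact (Adm.inf h0 hm ((follows_iff_of_eventually_none hN).2 h1)).exists_outcome
      · have := Path.of_seq hm N
        rw [h0] at this
        obtain ⟨o, h4, h5⟩ := this.exists_outcome_of_divergence hI hs h1 h2 fun h => (h3 h).elim
        exact ⟨o, h4, h5.trans (hle N)⟩
    · push Not at ha
      obtain ⟨ν, h1, h2, h3⟩ := exists_infinite_trace.{u, v} ha
      rw [h3] at hf
      rcases h.2.1 (Or.inl hf) with hν | ⟨ρ, hρ, hρν⟩
      · exact Adm.exists_outcome (Adm.inf h0 hm ((h3 P).2 hν))
      · obtain ⟨n, hn, hnρ⟩ := h1 ρ.length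
        rw [← hρν] at hnρ
        have hpath := Path.of_seq hm n
        rw [hnρ, h0] at hpath
        obtain ⟨o', h4, h5⟩ := (Adm.div hpath (live_of_mv (hm n) hn) hρ).exists_outcome
        exact ⟨o', h4, h5.trans (hle n)⟩

end Ctx

end RewardTesting

/-! ### Prefixes of infinite sequences, and chain tests -/

namespace RewardTesting

theorem PrefixInf.of_prefix {A : Type u} {σ ρ : List A} {ν : ℕ → A} (h : PrefixInf σ ν)
    (hρ : ρ <+: σ) : PrefixInf ρ ν := by
  have h1 := List.prefix_iff_eq_take.1 hρ
  have h2 := hρ.length_le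
  unfold PrefixInf at h ⊢
  rw [h, ← List.map_take, List.take_range, min_eq_left h2] at h1
  exact h1

theorem map_range_prefix {A : Type u} (ν : ℕ → A) {m n : ℕ} (h : m ≤ n) :
    (List.range m).map ν <+: (List.range n).map ν := by
  rw [List.prefix_iff_eq_take, ← List.map_take, List.take_range]
  simp [h]

section TraceUpTo

variable {A : Type u}

theorem traceUpTo_getElem? (σ : List A) (n : ℕ) : traceUpTo (fun i => σ[i]?) n = σ.take n := by
  induction n with
  | zero => simp [traceUpTo]
  | succ n ih => rw [traceUpTo_succ, ih, List.take_add_one]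

theorem traceUpTo_some (ν : ℕ → A) (n : ℕ) :
    traceUpTo (fun i => some (ν i)) n = (List.range n).map ν := by
  induction n with
  | zero => simp [traceUpTo]
  | succ n ih => rw [traceUpTo_succ, ih, List.range_succ]; simp

end TraceUpTo

namespace Ctx

variable {A : Type u} {P Q : LTS.{u, v} A}

/-! ### Chain tests -/

/-- The test that performs the actions `c 0, c 1, …` (up to the first `none`) with rewards
`ρ 0, ρ 1, …`, and that after `i` of these can also escape by the actions in `e i`, where `none`
stands for an internal action, with reward `1`. It starts in state `1`; state `0` is reached by
escaping. -/
def chain (c : ℕ → Option A) (ρ : ℕ → ℝ) (e : ℕ → Option A → Prop) : Ctx A ℕ ℝ where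
  live _ := True
  own k r k' := ∃ i, k = i + 1 ∧ e i none ∧ r = 1 ∧ k' = 0
  sync k a r k' := ∃ i, k = i + 1 ∧
    ((c i = some a ∧ r = ρ i ∧ k' = i + 2) ∨ (e i (some a) ∧ r = 1 ∧ k' = 0))

variable {c : ℕ → Option A} {ρ : ℕ → ℝ} {e : ℕ → Option A → Prop}

theorem chain_mv {k k' : ℕ} {a : Option A} {r : ℝ} (h : (chain c ρ e).Mv k a r k') :
    ∃ i, k = i + 1 ∧ ((a ≠ none ∧ c i = a ∧ r = ρ i ∧ k' = i + 2) ∨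
      (e i a ∧ r = 1 ∧ k' = 0)) := by
  rcases h with ⟨rfl, i, h⟩ | ⟨b, rfl, -, i, h1, h2⟩
  · exact ⟨i, h.1, Or.inr h.2⟩
  · refine ⟨i, h1, ?_⟩
    simpa using h2

theorem chain_path {i : ℕ} (h : ∀ j < i, c j ≠ none) :
    Path (chain c ρ e) 1 (traceUpTo c i) (∑ j ∈ Finset.range i, ρ j) (i + 1) := by
  induction i with
  | zero => simpa [traceUpTo] using Path.refl 1
  | succ i ih =>
    rw [traceUpTo_succ, Finset.sum_range_succ]
    obtain ⟨b, hb⟩ := Option.ne_none_iff_exists'.1 (h i i.lt_succ_self)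
    refine (ih fun j hj => h j (hj.trans i.lt_succ_self)).trans (Path.of_mv (Or.inr ⟨b, hb, trivial,
      i, rfl, Or.inl ⟨hb, rfl, rfl⟩⟩))

/-- A path is either still on the chain, with an initial segment of c performed, or it has escaped
exactly once and rests in state 0, which has no moves. The inner claim `step` treats silent and
synchronising moves together. -/
theorem chain_path_cases {k k' : ℕ} {σ : List A} {t : ℝ} (h : Path (chain c ρ e) k σ t k') :
    (k = 0 → k' = 0 ∧ σ = [] ∧ t = 0) ∧ ∀ i, k = i + 1 → (∀ j < i, c j ≠ none) →
      (∃ i', k' = i' + 1 ∧ traceUpTo c i ++ σ = traceUpTo c i' ∧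
        ∑ j ∈ Finset.range i, ρ j + t = ∑ j ∈ Finset.range i', ρ j ∧ ∀ j < i', c j ≠ none) ∨
      (k' = 0 ∧ ∃ i' a, e i' a ∧ traceUpTo c i ++ σ = traceUpTo c i' ++ a.toList ∧
        ∑ j ∈ Finset.range i, ρ j + t = ∑ j ∈ Finset.range i', ρ j + 1) := by
  have step : ∀ {k k' k'' : ℕ} {a : Option A} {r t : ℝ} {σ : List A},
      (chain c ρ e).Mv k a r k' →
      ((k' = 0 → k'' = 0 ∧ σ = [] ∧ t = 0) ∧ ∀ i, k' = i + 1 → (∀ j < i, c j ≠ none) →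
      (∃ i', k'' = i' + 1 ∧ traceUpTo c i ++ σ = traceUpTo c i' ∧
        ∑ j ∈ Finset.range i, ρ j + t = ∑ j ∈ Finset.range i', ρ j ∧ ∀ j < i', c j ≠ none) ∨
      (k'' = 0 ∧ ∃ i' a, e i' a ∧ traceUpTo c i ++ σ = traceUpTo c i' ++ a.toList ∧
        ∑ j ∈ Finset.range i, ρ j + t = ∑ j ∈ Finset.range i', ρ j + 1)) →
      (k = 0 → k'' = 0 ∧ a.toList ++ σ = [] ∧ r + t = 0) ∧
        ∀ i, k = i + 1 → (∀ j < i, c j ≠ none) →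
      (∃ i', k'' = i' + 1 ∧ traceUpTo c i ++ (a.toList ++ σ) = traceUpTo c i' ∧
        ∑ j ∈ Finset.range i, ρ j + (r + t) = ∑ j ∈ Finset.range i', ρ j ∧ ∀ j < i', c j ≠ none) ∨
      (k'' = 0 ∧ ∃ i' b, e i' b ∧
        traceUpTo c i ++ (a.toList ++ σ) = traceUpTo c i' ++ b.toList ∧
        ∑ j ∈ Finset.range i, ρ j + (r + t) = ∑ j ∈ Finset.range i', ρ j + 1) := by
    rintro k k' k'' a r t σ hm ⟨h0, hs⟩
    obtain ⟨i, rfl, ⟨ha, hc, rfl, rfl⟩ | ⟨he, rfl, rfl⟩⟩ := chain_mv hm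
    · refine ⟨by omega, fun i' hi' hall => ?_⟩
      obtain rfl : i = i' := by omega
      have := hs (i + 1) rfl fun j hj => by
        rcases Nat.lt_succ_iff_lt_or_eq.1 hj with hj | rfl
        · exact hall j hj
        · rwa [hc]
      rwa [traceUpTo_succ, hc, Finset.sum_range_succ, List.append_assoc, add_assoc] at this
    · refine ⟨by omega, fun i' hi' hall => Or.inr ?_⟩
      obtain rfl : i = i' := by omega
      obtain ⟨rfl, rfl, rfl⟩ := h0 rfl
      exact ⟨rfl, i, a, he, by simp, by simp⟩
  induction h with
  | refl k =>
    refine ⟨fun h => ⟨h, rfl, rfl⟩, fun i hi hall => Or.inl ⟨i, hi, by simp, by simp, hall⟩⟩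
  | own h _ ih => exact step (a := none) (Or.inl ⟨rfl, h⟩) ih
  | sync h h' _ ih => exact step (a := some _) (Or.inr ⟨_, rfl, h, h'⟩) ih

/-- The three alternatives are: stopping on the chain, escaping, and following the chain forever. In
the last case the value of o is dropped, as no application needs it. -/
theorem chain_adm_cases {o : EReal} (h : (chain c ρ e).Adm P 1 o) :
    (∃ i, o = ((∑ j ∈ Finset.range i, ρ j : ℝ) : EReal) ∧ (∀ j < i, c j ≠ none) ∧
      (traceUpTo c i ∈ P.divergences ∨
        (¬ e i none ∧ (traceUpTo c i, {a | c i = some a ∨ e i (some a)}) ∈ P.failures))) ∨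
    (∃ i a, o = ((∑ j ∈ Finset.range i, ρ j + 1 : ℝ) : EReal) ∧ e i a) ∨
    ((∀ n, c n ≠ none) ∧ P.Follows c) := by
  cases h with
  | @stuck σ t s' hp ho hl hσ =>
    rcases (chain_path_cases hp).2 0 rfl (by simp) with ⟨i, rfl, h1, h2, h3⟩
        | ⟨rfl, i, a, h1, h2, h3⟩
    · simp only [traceUpTo, List.range_zero, List.filterMap_nil, List.nil_append] at h1
      simp only [Finset.range_zero, Finset.sum_empty, zero_add] at h2
      subst h1 h2
      refine Or.inl ⟨i, rfl, h3, Or.inr ⟨fun h => ho 1 0 ⟨i, rfl, h, rfl, rfl⟩, ?_⟩⟩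
      have hX : {a | c i = some a ∨ e i (some a)} =
          {a | ∃ r s'', (chain c ρ e).sync (i + 1) a r s''} := by
        ext a
        constructor
        · rintro (h | h)
          · exact ⟨ρ i, i + 2, i, rfl, Or.inl ⟨h, rfl, rfl⟩⟩
          · exact ⟨1, 0, i, rfl, Or.inr ⟨h, rfl, rfl⟩⟩
        · rintro ⟨r, k, j, hj, h⟩
          obtain rfl : i = j := by omega
          exact h.imp And.left And.left
      rw [hX]
      exact hl trivial
    · simp only [Finset.range_zero, Finset.sum_empty, zero_add] at h3
      exact Or.inr (Or.inl ⟨i, a, by rw [h3], h1⟩)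
  | @div σ t s' hp hl hσ =>
    rcases (chain_path_cases hp).2 0 rfl (by simp) with ⟨i, rfl, h1, h2, h3⟩
        | ⟨rfl, i, a, h1, h2, h3⟩
    · simp only [traceUpTo, List.range_zero, List.filterMap_nil, List.nil_append] at h1
      simp only [Finset.range_zero, Finset.sum_empty, zero_add] at h2
      subst h1 h2
      exact Or.inl ⟨i, rfl, h3, Or.inl hσ⟩
    · simp only [Finset.range_zero, Finset.sum_empty, zero_add] at h3
      exact Or.inr (Or.inl ⟨i, a, by rw [h3], h1⟩)
  | @inf st a r h0 hm hf =>
    refine Or.inr (Or.inr ?_)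
    have hne : ∀ n, st n ≠ 0 := fun n hn => by
      obtain ⟨i, hi, -⟩ := chain_mv (hm n)
      omega
    have hst : ∀ n, st n = n + 1 := by
      intro n
      induction n with
      | zero => exact h0
      | succ n ih =>
        obtain ⟨i, hi, ⟨-, -, -, h⟩ | ⟨-, -, h⟩⟩ := chain_mv (hm n)
        · omega
        · exact (hne _ h).elim
    have hac : ∀ n, a n ≠ none ∧ c n = a n := fun n => by
      obtain ⟨i, hi, ⟨h1, h2, -, h⟩ | ⟨-, -, h⟩⟩ := chain_mv (hm n)
      · have := hst n
        obtain rfl : n = i := by omega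
        exact ⟨h1, h2⟩
      · exact (hne _ h).elim
    obtain rfl : c = a := funext fun n => (hac n).2
    exact ⟨fun n => (hac n).1, hf⟩

theorem chain_adm_div {i : ℕ} (hi : ∀ j < i, c j ≠ none) (h : traceUpTo c i ∈ P.divergences) :
    (chain c ρ e).Adm P 1 ((∑ j ∈ Finset.range i, ρ j : ℝ) : EReal) :=
  Adm.div (chain_path hi) trivial h

theorem chain_adm_fail {i : ℕ} (hi : ∀ j < i, c j ≠ none) (he : ¬ e i none)
    (h : (traceUpTo c i, {a | c i = some a ∨ e i (some a)}) ∈ P.failures) :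
    (chain c ρ e).Adm P 1 ((∑ j ∈ Finset.range i, ρ j : ℝ) : EReal) := by
  refine Adm.stuck (chain_path hi) ?_ (fun _ => ?_) (LTS.ptraces_of_failures h)
  · rintro r k ⟨j, hj, h, -⟩
    obtain rfl : i = j := by omega
    exact he h
  · obtain ⟨q, hq, h1, h2⟩ := LTS.mem_failures.1 h
    refine LTS.mem_failures.2 ⟨q, hq, h1, ?_⟩
    rintro a ⟨r, k, j, hj, h⟩
    obtain rfl : i = j := by omega
    exact h2 a (h.imp And.left And.left)

theorem chain_adm_inf {ν : ℕ → A} (h : ν ∈ P.infTraces) :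
    (chain (fun n => some (ν n)) ρ e).Adm P 1 (limReward ρ) :=
  Adm.inf (st := fun n => n + 1) rfl
    (fun n => Or.inr ⟨ν n, rfl, trivial, n, rfl, Or.inl ⟨rfl, rfl, rfl⟩⟩) (follows_some_iff.2 h)

theorem chain_rewardInv {p : ℝ → Prop} (hρ : ∀ i, p (ρ i)) (he : p 1 ∨ ∀ i a, ¬ e i a) :
    (chain c ρ e).RewardInv (fun _ => True) p := by
  refine fun k a r k' _ h => ⟨trivial, ?_⟩
  obtain ⟨i, -, ⟨-, -, rfl, -⟩ | ⟨h', rfl, -⟩⟩ := chain_mv h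
  · exact hρ i
  · exact he.resolve_right fun he => he i a h'

/-! ### Testing by chains implies the explicit preorders -/

theorem exists_chain_adm_le {s : ℕ} {C : Ctx A ℕ ℝ} {o : EReal}
    (h : SmythLE (C.outcomes s P) (C.outcomes s Q)) (ho : C.Adm Q s o) :
    ∃ o', C.Adm P s o' ∧ o' ≤ o := by
  obtain ⟨o₁, h1, h2⟩ := ho.exists_outcome
  obtain ⟨o₂, h3, h4⟩ := h _ h1
  obtain ⟨o₃, h5, h6⟩ := exists_adm h3
  exact ⟨o₃, h5, h6.trans (h4.trans h2)⟩

/-- Reward `-1` for the first `k` steps. -/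
noncomputable def negReward (k : ℕ) (i : ℕ) : ℝ := if i < k then -1 else 0

theorem negReward_nonpos (k i : ℕ) : negReward k i ≤ 0 := by
  unfold negReward; split_ifs <;> norm_num

theorem sum_negReward (k n : ℕ) : ∑ i ∈ Finset.range n, negReward k i = -(min n k : ℕ) := by
  induction n with
  | zero => simp
  | succ n ih =>
    rw [Finset.sum_range_succ, ih, negReward]
    split_ifs with h
    · rw [min_eq_left h.le, min_eq_left (Nat.succ_le_of_lt h)]
      push_cast
      ring
    · rw [min_eq_right (by omega), min_eq_right (by omega)]
      ring

theorem limReward_negReward (k : ℕ) : limReward (negReward k) = ((-(k : ℕ) : ℝ) : EReal) := by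
  rw [limReward_eq_sum (N := k) fun i hi => by simp [negReward, hi], sum_negReward, min_self]

theorem limReward_neg_one : limReward (fun _ => -1) = ⊥ := by
  rw [EReal.eq_bot_iff_forall_lt]
  intro y
  obtain ⟨N, hN⟩ := exists_nat_gt (-y)
  refine (limReward_le_sum (N := N) fun _ _ => by norm_num).trans_lt ?_
  rw [EReal.coe_lt_coe_iff]
  simp only [Finset.sum_const, Finset.card_range, nsmul_eq_mul]
  linarith

theorem getElem?_ne_none_of_lt {σ : List A} {j : ℕ} (h : j < σ.length) : σ[j]? ≠ none := by
  simpa using h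

/-- Each of the first `σ.length` steps earns -1 and an escape, possible only at the end, earns 1.
The minimal total is thus reached only by performing all of σ and not escaping. -/
theorem list_chain_adm {σ : List A} {E : Option A → Prop} {o : EReal}
    (h : (chain (fun i => σ[i]?) (negReward σ.length) (fun i a => i = σ.length ∧ E a)).Adm P 1 o)
    (ho : o ≤ ((-(σ.length : ℕ) : ℝ) : EReal)) :
    σ ∈ P.divergences ∨ (¬ E none ∧ (σ, {a | E (some a)}) ∈ P.failures) := by
  rcases chain_adm_cases h with ⟨i, rfl, h1, h2⟩ | ⟨i, a, rfl, rfl, h1⟩ | ⟨h1, -⟩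
  · have hi : i ≤ σ.length := by
      by_contra hi
      exact h1 σ.length (by omega) (by simp)
    rw [sum_negReward, EReal.coe_le_coe_iff, neg_le_neg_iff, Nat.cast_le] at ho
    obtain rfl : i = σ.length := le_antisymm hi (ho.trans (min_le_left _ _))
    rw [traceUpTo_getElem?, List.take_length] at h2
    simpa using h2
  · rw [sum_negReward, min_self, EReal.coe_le_coe_iff] at ho
    linarith
  · exact (h1 σ.length (by simp)).elim

/-- Divergences are detected by an internal escape at the end of σ, which only a diverging process
can avoid. For a failure the escapes are the actions of X; avoiding them requires refusing X or
diverging. -/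
theorem divergences_failuresD_of_chain
    (h : ∀ (c : ℕ → Option A) (k : ℕ) (e : ℕ → Option A → Prop),
      SmythLE ((chain c (negReward k) e).outcomes 1 P) ((chain c (negReward k) e).outcomes 1 Q)) :
    Q.divergences ⊆ P.divergences ∧ Q.failuresD ⊆ P.failuresD := by
  have hsum : ∀ σ : List A, ((∑ j ∈ Finset.range σ.length, negReward σ.length j : ℝ) : EReal) =
      ((-(σ.length : ℕ) : ℝ) : EReal) := fun σ => by rw [sum_negReward, min_self]
  have hdiv : Q.divergences ⊆ P.divergences := fun σ hσ => by
    obtain ⟨o, h1, h2⟩ := exists_chain_adm_le (h (fun i => σ[i]?) σ.length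
      (fun i a => i = σ.length ∧ a = none)) (chain_adm_div (i := σ.length)
        (fun j hj => getElem?_ne_none_of_lt hj) (by rwa [traceUpTo_getElem?, List.take_length]))
    rw [hsum] at h2
    exact (list_chain_adm h1 h2).resolve_right (by simp)
  refine ⟨hdiv, ?_⟩
  rintro ⟨σ, X⟩ (hσ | hσ)
  · obtain ⟨o, h1, h2⟩ := exists_chain_adm_le (h (fun i => σ[i]?) σ.length
      (fun i a => i = σ.length ∧ ∃ x ∈ X, a = some x)) (chain_adm_fail (i := σ.length)
        (fun j hj => getElem?_ne_none_of_lt hj) (by simp)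
        (by rw [traceUpTo_getElem?, List.take_length]; simpa using hσ))
    rw [hsum] at h2
    rcases list_chain_adm h1 h2 with h3 | ⟨-, h3⟩
    · exact Or.inr h3
    · exact Or.inl (by simpa using h3)
  · exact Or.inr (hdiv hσ)

/-- With reward -1 at every step, performing ν earns `⊥`, while every finite run and every escape
has a real reward. -/
theorem infTraces_of_chain
    (h : ∀ (c : ℕ → Option A), SmythLE ((chain c (fun _ => -1) fun _ _ => False).outcomes 1 P)
      ((chain c (fun _ => -1) fun _ _ => False).outcomes 1 Q)) :
    Q.infTraces ⊆ P.infTraces := fun ν hν => by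
  obtain ⟨o, h1, h2⟩ := exists_chain_adm_le (h fun i => some (ν i)) (chain_adm_inf hν)
  rw [limReward_neg_one, le_bot_iff] at h2
  subst h2
  rcases chain_adm_cases h1 with ⟨i, h1, -⟩ | ⟨i, a, h1, -⟩ | ⟨-, h1⟩
  · exact (EReal.coe_ne_bot _ h1.symm).elim
  · exact (EReal.coe_ne_bot _ h1.symm).elim
  · exact follows_some_iff.1 h1

theorem ndfd_of_chain (h : ∀ c ρ e, SmythLE ((chain c ρ e).outcomes 1 P)
    ((chain c ρ e).outcomes 1 Q)) : NDFD P Q :=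
  have h1 := divergences_failuresD_of_chain fun c k e => h c (negReward k) e
  ⟨h1.1, infTraces_of_chain fun _ => h _ _ _, h1.2⟩

/-- No escapes are needed: Q follows σ and collects all the penalties, and P can collect as many
only by performing σ as well. -/
theorem trace_of_chain (h : ∀ c k, SmythLE ((chain c (negReward k) fun _ _ => False).outcomes 1 P)
    ((chain c (negReward k) fun _ _ => False).outcomes 1 Q)) : Trace P Q := fun σ hσ => by
  obtain ⟨o₁, h1, h2⟩ := (chain_path (c := fun i => σ[i]?) (ρ := negReward σ.length)
    (e := fun _ _ => False) (i := σ.length)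
    (fun j hj => getElem?_ne_none_of_lt hj)).exists_outcome (P := Q)
    (chain_rewardInv (negReward_nonpos _) (by simp)) trivial
    (by rwa [traceUpTo_getElem?, List.take_length])
  obtain ⟨o₂, h3, h4⟩ := h _ _ _ h1
  obtain ⟨o₃, h5, h6⟩ := exists_adm h3
  rw [sum_negReward, min_self] at h2
  have h7 : (chain (fun i => σ[i]?) (negReward σ.length)
      fun i a => i = σ.length ∧ False).Adm P 1 o₃ := by simpa using h5
  rcases list_chain_adm (E := fun _ => False) h7 (h6.trans (h4.trans h2)) with h8 | ⟨-, h8⟩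
  · exact LTS.ptraces_of_divergences h8
  · exact LTS.ptraces_of_failures h8

theorem traceInf_of_chain (h : ∀ c ρ, (∀ i, ρ i ≤ 0) →
    SmythLE ((chain c ρ fun _ _ => False).outcomes 1 P)
      ((chain c ρ fun _ _ => False).outcomes 1 Q)) : TraceInf P Q :=
  ⟨trace_of_chain fun c k => h c _ (negReward_nonpos k),
    infTraces_of_chain fun c => h c _ fun _ => by norm_num⟩

/-- If ν is not in `P.infD`, some prefix σ of ν has no extension along ν at which P diverges. The
test penalises the first `σ.length` steps and offers an internal escape from there on. To keep all
penalties without the bonus, P would have to diverge at an excluded place or perform ν. -/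
theorem fdid_of_chain (h : ∀ c k e, SmythLE ((chain c (negReward k) e).outcomes 1 P)
    ((chain c (negReward k) e).outcomes 1 Q)) : FDId P Q := by
  have h0 := divergences_failuresD_of_chain h
  refine ⟨h0.1, ?_, h0.2⟩
  rintro ν (hν | hν)
  · by_contra hcon
    have hcon' : ∃ σ, PrefixInf σ ν ∧ ∀ ρ ∈ P.divergences, σ <+: ρ → ¬ PrefixInf ρ ν := by
      by_contra! h
      exact hcon (Or.inr h)
    obtain ⟨σ, hσ, hdiv⟩ := hcon'
    obtain ⟨o, h1, h2⟩ := exists_chain_adm_le (h (fun i => some (ν i)) σ.length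
      fun i a => σ.length ≤ i ∧ a = none) (chain_adm_inf hν)
    rw [limReward_negReward] at h2
    rcases chain_adm_cases h1 with ⟨i, rfl, -, h3⟩ | ⟨i, a, rfl, h3, -⟩ | ⟨-, h3⟩
    · rw [sum_negReward, EReal.coe_le_coe_iff, neg_le_neg_iff, Nat.cast_le] at h2
      have hi : σ.length ≤ i := h2.trans (min_le_left _ _)
      rcases h3 with h3 | ⟨h3, -⟩
      · rw [traceUpTo_some] at h3
        refine hdiv _ h3 ?_ (prefixInf_map_range ν i)
        rw [hσ]
        exact map_range_prefix ν hi
      · exact h3 ⟨hi, rfl⟩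
    · rw [sum_negReward, min_eq_right h3, EReal.coe_le_coe_iff] at h2
      linarith
    · exact hcon (Or.inl (follows_some_iff.1 h3))
  · exact Or.inr fun σ hσ => let ⟨ρ, h1, h2⟩ := hν σ hσ; ⟨ρ, h0.1 h1, h2⟩

/-- Only the existence of an outcome at most 0 is compared, so the lemma serves nonnegative reward
testing as well as must testing, where escaping means success. With zero rewards on the chain, an
outcome at most 0 means that no escape is taken. -/
theorem fdibot_of_chain (h : ∀ c e, (∃ o ∈ (chain c (fun _ => 0) e).outcomes 1 Q, o ≤ 0) →
    ∃ o ∈ (chain c (fun _ => 0) e).outcomes 1 P, o ≤ 0) : FDIbot P Q := by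
  have key : ∀ {c e o}, (chain c (fun _ => 0) e).Adm Q 1 o → o ≤ 0 →
      (∃ i, (∀ j < i, c j ≠ none) ∧ (traceUpTo c i ∈ P.divergences ∨
        (¬ e i none ∧ (traceUpTo c i, {a | c i = some a ∨ e i (some a)}) ∈ P.failures))) ∨
      ((∀ n, c n ≠ none) ∧ P.Follows c) := by
    intro c e o ho ho'
    obtain ⟨o₁, h1, h2⟩ := ho.exists_outcome
    obtain ⟨o₂, h3, h4⟩ := h c e ⟨o₁, h1, h2.trans ho'⟩
    obtain ⟨o₃, h5, h6⟩ := exists_adm h3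
    rcases chain_adm_cases h5 with ⟨i, -, h7⟩ | ⟨i, a, rfl, -⟩ | h7
    · exact Or.inl ⟨i, h7⟩
    · have := h6.trans h4
      rw [Finset.sum_const_zero, zero_add] at this
      have : (1 : ℝ) ≤ 0 := by exact_mod_cast this
      norm_num at this
    · exact Or.inr h7
  have hdiv : ∀ σ ∈ Q.divergences, ∃ ρ ∈ P.divergences, ρ <+: σ := by
    intro σ hσ
    rcases key (c := fun i => σ[i]?) (e := fun _ a => a = none) (chain_adm_div (i := σ.length)
      (fun j hj => getElem?_ne_none_of_lt hj) (by rwa [traceUpTo_getElem?, List.take_length]))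
      (by simp) with ⟨i, -, h1 | ⟨h1, -⟩⟩ | ⟨h1, -⟩
    · rw [traceUpTo_getElem?] at h1
      exact ⟨_, h1, List.take_prefix _ _⟩
    · exact (h1 rfl).elim
    · exact (h1 σ.length (by simp)).elim
  refine ⟨?_, ?_, ?_⟩
  · rintro σ ⟨ρ, h1, h2⟩
    obtain ⟨ρ', h3, h4⟩ := hdiv ρ h1
    exact ⟨ρ', h3, h4.trans h2⟩
  · rintro ν (hν | ⟨ρ, h1, h2⟩)
    · rcases key (e := fun _ a => a = none) (chain_adm_inf hν)
        (by rw [limReward_eq_sum (N := 0) fun _ _ => rfl]; simp) with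
        ⟨i, -, h1 | ⟨h1, -⟩⟩ | ⟨-, h1⟩
      · rw [traceUpTo_some] at h1
        exact Or.inr ⟨_, h1, prefixInf_map_range ν i⟩
      · exact (h1 rfl).elim
      · exact Or.inl (follows_some_iff.1 h1)
    · obtain ⟨ρ', h3, h4⟩ := hdiv ρ h1
      exact Or.inr ⟨ρ', h3, h2.of_prefix h4⟩
  · rintro ⟨σ, X⟩ (hσ | ⟨ρ, h1, h2⟩)
    -- Before the end of σ an internal escape is enabled, so stopping early requires a divergence;
    -- at the end only the actions of X are escapes.
    · rcases key (c := fun i => σ[i]?) (e := fun i a => (i < σ.length ∧ a = none) ∨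
        (i = σ.length ∧ ∃ x ∈ X, a = some x)) (chain_adm_fail (i := σ.length)
        (fun j hj => getElem?_ne_none_of_lt hj) (by simp)
        (by rw [traceUpTo_getElem?, List.take_length]; simpa using hσ)) (by simp) with
        ⟨i, h0, h1 | ⟨h1, h2⟩⟩ | ⟨h1, -⟩
      · rw [traceUpTo_getElem?] at h1
        exact Or.inr ⟨_, h1, List.take_prefix _ _⟩
      · have hi : i ≤ σ.length := by
          by_contra hi
          exact h0 σ.length (by omega) (by simp)
        have hi' : ¬ i < σ.length := fun hi' => h1 (Or.inl ⟨hi', rfl⟩)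
        obtain rfl : i = σ.length := by omega
        rw [traceUpTo_getElem?, List.take_length] at h2
        exact Or.inl (by simpa using h2)
      · exact (h1 σ.length (by simp)).elim
    · obtain ⟨ρ', h3, h4⟩ := hdiv ρ h1
      exact Or.inr ⟨ρ', h3, h4.trans h2⟩

end Ctx

end RewardTesting

namespace RewardTesting

/-! ### Bisimilarity -/

section Bisimilarity

variable {A : Type u}

/-- Strong bisimilarity of processes. -/
def Bisimilar (P Q : LTS.{u, v} A) : Prop :=
  ∃ B : P.State → Q.State → Prop, B P.init Q.init ∧
    (∀ p q α p', B p q → P.tr p α p' → ∃ q', Q.tr q α q' ∧ B p' q') ∧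
    ∀ p q α q', B p q → Q.tr q α q' → ∃ p', P.tr p α p' ∧ B p' q'

variable {P Q : LTS.{u, v} A}

theorem Bisimilar.symm (h : Bisimilar P Q) : Bisimilar Q P :=
  let ⟨B, h0, h1, h2⟩ := h
  ⟨fun q p => B p q, h0, fun q p α q' hB hq => h2 p q α q' hB hq,
    fun q p α p' hB hp => h1 p q α p' hB hp⟩

theorem Bisimilar.of_map (f : P.State → Q.State) (h0 : f P.init = Q.init)
    (hf : ∀ p α p', P.tr p α p' → Q.tr (f p) α (f p'))
    (hb : ∀ p α q, Q.tr (f p) α q → ∃ p', P.tr p α p' ∧ f p' = q) : Bisimilar P Q := by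
  refine ⟨fun p q => f p = q, h0, ?_, ?_⟩
  · rintro p - α p' rfl h
    exact ⟨_, hf p α p' h, rfl⟩
  · rintro p - α q' rfl h
    exact hb p α q' h

/-- Since `NDFD` implies all the other explicit preorders, bisimilar processes are interchangeable
for each of them. -/
theorem Bisimilar.ndfd (h : Bisimilar P Q) : NDFD P Q := by
  obtain ⟨B, h0, hP, hQ⟩ := h
  have hweak : ∀ {q σ q'}, Weak Q.tr q σ q' → ∀ p, B p q → ∃ p', Weak P.tr p σ p' ∧ B p' q' := by
    intro q σ q' h
    induction h with
    | refl q => exact fun p hp => ⟨p, Weak.refl p, hp⟩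
    | tau h _ ih =>
      intro p hp
      obtain ⟨p', h1, h2⟩ := hQ _ _ _ _ hp h
      obtain ⟨p'', h3, h4⟩ := ih p' h2
      exact ⟨p'', Weak.tau h1 h3, h4⟩
    | vis h _ ih =>
      intro p hp
      obtain ⟨p', h1, h2⟩ := hQ _ _ _ _ hp h
      obtain ⟨p'', h3, h4⟩ := ih p' h2
      exact ⟨p'', Weak.vis h1 h3, h4⟩
  have lift : ∀ {R : ℕ → P.State → P.State → Prop} {R' : ℕ → Q.State → Q.State → Prop},
      (∀ n p q q', B p q → R' n q q' → ∃ p', R n p p' ∧ B p' q') →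
      ∀ p (s : ℕ → Q.State), B p (s 0) → (∀ n, R' n (s n) (s (n + 1))) →
      ∃ s' : ℕ → P.State, s' 0 = p ∧ ∀ n, R n (s' n) (s' (n + 1)) := by
    intro R R' hR p s hp hs
    obtain ⟨x, hx0, hx⟩ := exists_seq_of_step (Z := ℕ × P.State) (Q := fun z => B z.2 (s z.1))
      (R := fun _ z z' => z'.1 = z.1 + 1 ∧ R z.1 z.2 z'.2) (z := (0, p)) hp (by
        rintro - ⟨n, y⟩ hy
        obtain ⟨y', h1, h2⟩ := hR n y _ _ hy (hs n)
        exact ⟨(n + 1, y'), h2, rfl, h1⟩)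
    have hn : ∀ n, (x n).1 = n := fun n => by
      induction n with
      | zero => rw [hx0]
      | succ n ih => rw [(hx n).2.1, ih]
    refine ⟨fun n => (x n).2, by simp [hx0], fun n => ?_⟩
    simpa [hn n] using (hx n).2.2
  have hdiv : Q.divergences ⊆ P.divergences := by
    rintro σ ⟨q, hq, s, hs0, hs⟩
    obtain ⟨p, hp, hB⟩ := hweak hq _ h0
    obtain ⟨s', h1, h2⟩ := lift (R := fun _ p p' => P.tr p Act.tau p')
      (R' := fun _ q q' => Q.tr q Act.tau q') (fun _ p q q' h h' => hQ p q _ q' h h') p s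
      (hs0 ▸ hB) hs
    exact ⟨p, hp, s', h1, h2⟩
  refine ⟨hdiv, ?_, ?_⟩
  · rintro ν ⟨s, hs0, hs⟩
    obtain ⟨s', h1, h2⟩ := lift (R := fun n p p' => Weak P.tr p [ν n] p')
      (R' := fun n q q' => Weak Q.tr q [ν n] q') (fun _ p q q' h h' => hweak h' p h) P.init s
      (hs0 ▸ h0) hs
    exact ⟨s', h1, h2⟩
  · rintro ⟨σ, X⟩ (hσ | hσ)
    · obtain ⟨q, hq, h1, h2⟩ := LTS.mem_failures.1 hσ
      obtain ⟨p, hp, hB⟩ := hweak hq _ h0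
      refine Or.inl (LTS.mem_failures.2 ⟨p, hp, fun p' hp' => ?_, fun a ha p' hp' => ?_⟩)
      · obtain ⟨q', hq', -⟩ := hP _ _ _ _ hB hp'
        exact h1 q' hq'
      · obtain ⟨q', hq', -⟩ := hP _ _ _ _ hB hp'
        exact h2 a ha q' hq'
    · exact Or.inr (hdiv hσ)

end Bisimilarity

/-! ### Composition of contexts -/

namespace Ctx

variable {A : Type u} {S : Type w} {S' : Type*}

/-- The process obtained by placing `P` in the context `C`, in the state `c`. -/
def apply (C : Ctx A S (Act A)) (c : S) (P : LTS.{u, v} A) : LTS.{u, max w v} A :=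
  ⟨S × P.State, C.Step Act.tau P, (c, P.init)⟩

/-- The test that places a process in the context `C` and then tests it by `T`. -/
def comp (T : Ctx A S' ℝ) (C : Ctx A S (Act A)) : Ctx A (S' × S) ℝ where
  live x := T.live x.1 ∧ C.live x.2
  own x r y := (T.own x.1 r y.1 ∧ y.2 = x.2) ∨
    (T.live x.1 ∧ C.own x.2 Act.tau y.2 ∧ y.1 = x.1 ∧ r = 0) ∨
    ∃ a, T.live x.1 ∧ C.own x.2 (Act.vis a) y.2 ∧ T.sync x.1 a r y.1
  sync x b r y := (C.sync x.2 b Act.tau y.2 ∧ y.1 = x.1 ∧ r = 0) ∨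
    ∃ a, C.sync x.2 b (Act.vis a) y.2 ∧ T.sync x.1 a r y.1

/-- The two systems differ only in the bracketing of their states, which is a functional
bisimulation. -/
theorem outcomes_comp (T : Ctx A S' ℝ) (C : Ctx A S (Act A)) (t : S') (c : S)
    (P : LTS.{u, v} A) : (T.comp C).outcomes (t, c) P = T.outcomes t (C.apply c P) := by
  refine (outcomes_map (fun x : (S' × S) × P.State => (x.1.1, (x.1.2, x.2))) ?_ ?_
    ((t, c), P.init)).symm
  · rintro ⟨⟨s, s₁⟩, p⟩ r ⟨⟨s', s₁'⟩, p'⟩ h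
    rcases h with h | ⟨h, h'⟩ | ⟨h, h1, h3⟩
    · rcases h with ⟨h, h'⟩ | ⟨h, h1, h2, h3⟩ | ⟨a, h, h1, h2⟩
      · simp only at h'
        subst h'
        exact Step.own h
      · simp only at h2
        subst h2 h3
        exact Step.tau (P := C.apply c P) h (Step.own h1)
      · exact Step.sync (P := C.apply c P) h h2 (Step.own h1)
    · exact Step.tau (P := C.apply c P) h.1 (Step.tau h.2 h')
    · rcases h1 with ⟨h1, h2, h4⟩ | ⟨b, h1, h2⟩
      · simp only at h2
        subst h2 h4
        exact Step.tau (P := C.apply c P) h.1 (Step.sync h.2 h1 h3)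
      · exact Step.sync (P := C.apply c P) h.1 h2 (Step.sync h.2 h1 h3)
  · have key : ∀ (s : S') (y : S × P.State) (r : ℝ) (s' : S') (y' : S × P.State),
        T.Step 0 (C.apply c P) (s, y) r (s', y') →
        (T.comp C).Step 0 P ((s, y.1), y.2) r ((s', y'.1), y'.2) := by
      rintro s y r s' y' (h | ⟨h, h'⟩ | ⟨h, h1, h2⟩)
      · exact Step.own (Or.inl ⟨h, rfl⟩)
      · rcases h' with h1 | ⟨h1, h2⟩ | ⟨h1, h2, h3⟩
        · exact Step.own (Or.inr (Or.inl ⟨h, h1, rfl, rfl⟩))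
        · exact Step.tau ⟨h, h1⟩ h2
        · exact Step.sync ⟨h, h1⟩ (Or.inl ⟨h2, rfl, rfl⟩) h3
      · rcases h2 with h2 | ⟨h2, h3⟩ | ⟨h2, h3, h4⟩
        · exact Step.own (Or.inr (Or.inr ⟨_, h, h2, h1⟩))
        · exact Step.sync ⟨h, h2⟩ (Or.inr ⟨_, h3, h1⟩) h4
    rintro ⟨⟨s, s₁⟩, p⟩ r ⟨s', ⟨s₁', p'⟩⟩ h
    exact ⟨((s', s₁'), p'), rfl, key _ _ _ _ _ h⟩

theorem comp_mv {T : Ctx A S' ℝ} {C : Ctx A S (Act A)} {x y : S' × S} {a : Option A} {r : ℝ}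
    (h : (T.comp C).Mv x a r y) : (y.1 = x.1 ∧ r = 0) ∨ ∃ b, T.Mv x.1 b r y.1 := by
  rcases h with ⟨rfl, ⟨h, -⟩ | ⟨-, -, h⟩ | ⟨b, hl, -, h⟩⟩ | ⟨a, rfl, hl, ⟨-, h⟩ | ⟨b, -, h⟩⟩
  · exact Or.inr ⟨none, Or.inl ⟨rfl, h⟩⟩
  · exact Or.inl h
  · exact Or.inr ⟨some b, Or.inr ⟨b, rfl, hl, h⟩⟩
  · exact Or.inl h
  · exact Or.inr ⟨some b, Or.inr ⟨b, rfl, hl.1, h⟩⟩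

theorem RewardInv.comp {T : Ctx A S' ℝ} {p : ℝ → Prop} (h : T.RewardInv (fun _ => True) p)
    (h0 : p 0) (C : Ctx A S (Act A)) : (T.comp C).RewardInv (fun _ => True) p := by
  refine fun x a r y _ hm => ⟨trivial, ?_⟩
  rcases comp_mv hm with ⟨-, rfl⟩ | ⟨b, hb⟩
  · exact h0
  · exact (h _ _ _ _ trivial hb).2

/-- The potential `μ` decreases with each negative reward. -/
def Potential (T : Ctx A S' ℝ) (μ : S' → ℕ) : Prop :=
  ∀ s a r s', T.Mv s a r s' → μ s' ≤ μ s ∧ (r < 0 → μ s' < μ s)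

theorem Potential.comp {T : Ctx A S' ℝ} {μ : S' → ℕ} (h : T.Potential μ) (C : Ctx A S (Act A)) :
    (T.comp C).Potential fun x => μ x.1 := by
  intro x a r y hm
  rcases comp_mv hm with ⟨h1, rfl⟩ | ⟨b, hb⟩
  · simp [h1]
  · exact h _ _ _ _ hb

end Ctx

/-- The potential takes finitely many values, and since it drops right after each position in B and
never rises, it is injective on B. -/
theorem finite_of_potential {B : ℕ → Prop} {μ : ℕ → ℕ}
    (h : ∀ n, μ (n + 1) ≤ μ n ∧ (B n → μ (n + 1) < μ n)) : {n | B n}.Finite := by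
  have hanti : Antitone μ := antitone_nat_of_succ_le fun n => (h n).1
  refine Set.Finite.of_finite_image (f := μ) ?_ ?_
  · refine (Set.finite_Iic (μ 0)).subset ?_
    rintro - ⟨n, -, rfl⟩
    exact hanti (Nat.zero_le n)
  · have key : ∀ {m n}, B m → m < n → μ n < μ m := fun {m n} hm hmn =>
      (hanti (Nat.succ_le_of_lt hmn)).trans_lt ((h m).2 hm)
    intro m hm n hn hmn
    rcases lt_trichotomy m n with h1 | h1 | h1
    · exact absurd hmn (key hm h1).ne'
    · exact h1
    · exact absurd hmn (key hn h1).ne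

namespace Ctx

variable {A : Type u} {S : Type w}

theorem Potential.finitePenalty {S' : Type*} {T : Ctx A S' ℝ} {μ : S' → ℕ} (h : T.Potential μ)
    (s : S') : T.FinitePenalty s := fun st _ _ _ hm =>
  finite_of_potential (μ := fun n => μ (st n)) fun n => h _ _ _ _ (hm n)

/-- In state n = i + 1 the value k + 1 - n = k - i counts the penalties still ahead; none are ahead
in the escaped state 0. -/
theorem chain_potential (c : ℕ → Option A) (k : ℕ) (e : ℕ → Option A → Prop) :
    (chain c (negReward k) e).Potential fun n => if n = 0 then 0 else k + 1 - n := by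
  intro n a r n' h
  obtain ⟨i, rfl, ⟨-, -, rfl, rfl⟩ | ⟨-, rfl, rfl⟩⟩ := chain_mv h
  · refine ⟨by simp; omega, fun h => ?_⟩
    have : i < k := by
      by_contra hik
      simp [negReward, hik] at h
    simp
    omega
  · exact ⟨by simp, fun h => absurd h (by norm_num)⟩

end Ctx

/-! ### Preservation of the explicit preorders by contexts -/

section Apply

variable {A : Type u} {S : Type w} {P Q : LTS.{u, v} A} (C : Ctx A S (Act A)) (c : S)

open Ctx

/-- By completeness of chains it suffices to test the composed processes by chains. A chain around C
is itself a context for P and Q, so soundness finishes the proof. The three results below repeat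
this, the composite inheriting the sign of the rewards or the potential of the chain. -/
theorem NDFD.apply (h : NDFD P Q) : NDFD (C.apply c P) (C.apply c Q) :=
  ndfd_of_chain fun c' ρ e => by
    rw [← outcomes_comp, ← outcomes_comp]
    exact smythLE_of_ndfd h _ _

theorem FDId.apply (h : FDId P Q) : FDId (C.apply c P) (C.apply c Q) :=
  fdid_of_chain fun c' k e => by
    rw [← outcomes_comp, ← outcomes_comp]
    exact smythLE_of_fdid h (((chain_potential c' k e).comp C).finitePenalty _)

theorem FDIbot.apply (h : FDIbot P Q) : FDIbot (C.apply c P) (C.apply c Q) :=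
  fdibot_of_chain fun c' e => by
    rw [← outcomes_comp, ← outcomes_comp]
    rintro ⟨o, h1, h2⟩
    obtain ⟨o', h3, h4⟩ := smythLE_of_fdibot h ((chain_rewardInv (c := c') (ρ :=
        fun _ => 0) (e := e)
      (p := (0 ≤ ·)) (fun _ => le_rfl) (Or.inl zero_le_one)).comp le_rfl C) trivial o h1
    exact ⟨o', h3, h4.trans h2⟩

theorem Trace.apply (h : Trace P Q) : Trace (C.apply c P) (C.apply c Q) :=
  trace_of_chain fun c' k => by
    rw [← outcomes_comp, ← outcomes_comp]
    exact smythLE_of_trace h ((chain_rewardInv (c := c') (e := fun _ _ => False) (p := (· ≤ 0))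
      (negReward_nonpos k) (by simp)).comp le_rfl C) trivial
      (((chain_potential c' k _).comp C).finitePenalty _)

end Apply

end RewardTesting

namespace RewardTesting

/-! ### The operators of CSP as contexts -/

namespace Ctx

variable {A : Type u}

/-- The context `a → _`; in state `none` the prefix has not been performed yet. -/
def preCtx (a : A) : Ctx A (Option PUnit.{v + 1}) (Act A) where
  live c := c = some ⟨⟩
  own c α c' := c = none ∧ α = Act.vis a ∧ c' = some ⟨⟩
  sync c b α c' := c' = c ∧ α = Act.vis b

/-- The context `_ ⊓ Q`. -/
def intCtx (Q : LTS.{u, v} A) : Ctx A (Option (PUnit.{v + 1} ⊕ Q.State)) (Act A) where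
  live c := c = some (Sum.inl ⟨⟩)
  own c α c' := (c = none ∧ α = Act.tau ∧ (c' = some (Sum.inl ⟨⟩) ∨ c' = some (Sum.inr Q.init))) ∨
    ∃ q q', c = some (Sum.inr q) ∧ Q.tr q α q' ∧ c' = some (Sum.inr q')
  sync c b α c' := c' = c ∧ α = Act.vis b

/-- The context `_ □ Q`. -/
def extCtx (Q : LTS.{u, v} A) : Ctx A (Q.State ⊕ (PUnit.{v + 1} ⊕ Q.State)) (Act A) where
  live c := ∀ q, c ≠ Sum.inr (Sum.inr q)
  own c α c' := (∃ q q', c = Sum.inl q ∧ Q.tr q α q' ∧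
      ((α = Act.tau ∧ c' = Sum.inl q') ∨ (α ≠ Act.tau ∧ c' = Sum.inr (Sum.inr q')))) ∨
    ∃ q q', c = Sum.inr (Sum.inr q) ∧ Q.tr q α q' ∧ c' = Sum.inr (Sum.inr q')
  sync _ b α c' := c' = Sum.inr (Sum.inl ⟨⟩) ∧ α = Act.vis b

/-- The context given by partially synchronous interleaving with `Q`. -/
def interleaveCtx (S : Set A) (Q : LTS.{u, v} A) : Ctx A Q.State (Act A) where
  live _ := True
  own q α q' := α ∉ Act.vis '' S ∧ Q.tr q α q'
  sync q b α q' := α = Act.vis b ∧ ((b ∉ S ∧ q' = q) ∨ (b ∈ S ∧ Q.tr q (Act.vis b) q'))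

/-- The context given by concealment. -/
def hideCtx (H : Set A) : Ctx A PUnit.{v + 1} (Act A) where
  live _ := True
  own _ _ _ := False
  sync _ b α _ := (b ∈ H ∧ α = Act.tau) ∨ (b ∉ H ∧ α = Act.vis b)

/-- The context given by renaming. -/
def renameCtx (f : A → A) : Ctx A PUnit.{v + 1} (Act A) where
  live _ := True
  own _ _ _ := False
  sync _ b α _ := α = Act.vis (f b)

end Ctx

open Ctx

variable {A : Type u} (P Q : LTS.{u, v} A)

theorem bisimilar_pre (a : A) : Bisimilar (LTS.pre a P) ((preCtx.{u, v} a).apply none P) := by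
  refine Bisimilar.of_map (fun x : Option P.State => ((x.map fun _ => PUnit.unit), x.getD P.init))
    rfl ?_ ?_
  · rintro x α y (_ | h)
    · exact Step.own ⟨rfl, rfl, rfl⟩
    · cases α with
      | tau => exact Step.tau rfl h
      | vis b => exact Step.sync rfl ⟨rfl, rfl⟩ h
  · have key : ∀ (c : Option PUnit) (p : P.State) α (y : Option PUnit × P.State),
        (preCtx.{u, v} a).Step Act.tau P (c, p) α y →
        (c = none ∧ α = Act.vis a ∧ y = (some ⟨⟩, p)) ∨ (c = some ⟨⟩ ∧ y.1 = c ∧ P.tr p α y.2) := by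
      rintro c p α y (⟨h1, h2, rfl⟩ | ⟨h, h1⟩ | ⟨h, ⟨h1, rfl⟩, h3⟩)
      · exact Or.inl ⟨h1, h2, rfl⟩
      · exact Or.inr ⟨h, rfl, h1⟩
      · exact Or.inr ⟨h, h1, h3⟩
    rintro (_ | p) α y h
    · rcases key _ _ _ _ h with ⟨-, rfl, rfl⟩ | ⟨h1, -⟩
      · exact ⟨_, LTS.PreTr.start, rfl⟩
      · cases h1
    · rcases key _ _ _ _ h with ⟨h1, -⟩ | ⟨-, h2, h3⟩
      · cases h1
      · exact ⟨_, LTS.PreTr.run h3, Prod.ext h2.symm rfl⟩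

theorem bisimilar_hide (H : Set A) : Bisimilar (LTS.hide H P) ((hideCtx.{u, v} H).apply ⟨⟩ P) := by
  refine Bisimilar.of_map (fun x : P.State => (PUnit.unit, x)) rfl ?_ ?_
  · rintro x α y (⟨h, h'⟩ | ⟨h, h'⟩)
    · cases α with
      | tau => exact Step.tau trivial h'
      | vis b => exact Step.sync trivial (Or.inr ⟨fun hb => h ⟨b, hb, rfl⟩, rfl⟩) h'
    · exact Step.sync trivial (Or.inl ⟨h, rfl⟩) h'
  · rintro x α ⟨⟨⟩, y⟩ (h | ⟨-, h⟩ | ⟨-, ⟨hb, rfl⟩ | ⟨hb, rfl⟩, h⟩)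
    · exact h.elim
    · exact ⟨y, LTS.HideTr.keep (by simp) h, rfl⟩
    · exact ⟨y, LTS.HideTr.hidden hb h, rfl⟩
    · exact ⟨y, LTS.HideTr.keep (by rintro ⟨c, hc, hcb⟩; cases hcb; exact hb hc) h, rfl⟩

theorem bisimilar_rename (f : A → A) :
    Bisimilar (LTS.rename f P) ((renameCtx.{u, v} f).apply ⟨⟩ P) := by
  refine Bisimilar.of_map (fun x : P.State => (PUnit.unit, x)) rfl ?_ ?_
  · rintro x α y (h | h)
    · exact Step.tau trivial h
    · exact Step.sync trivial rfl h
  · rintro x α ⟨⟨⟩, y⟩ (h | ⟨-, h⟩ | ⟨-, rfl, h⟩)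
    · exact h.elim
    · exact ⟨y, LTS.RenameTr.tau h, rfl⟩
    · exact ⟨y, LTS.RenameTr.vis h, rfl⟩

theorem bisimilar_interleave (S : Set A) :
    Bisimilar (LTS.interleave S P Q) ((interleaveCtx S Q).apply Q.init P) := by
  refine Bisimilar.of_map (fun x : P.State × Q.State => (x.2, x.1)) rfl ?_ ?_
  · rintro x α y (⟨h, h'⟩ | ⟨h, h'⟩ | ⟨h, h1, h2⟩)
    · cases α with
      | tau => exact Step.tau trivial h'
      | vis b => exact Step.sync trivial ⟨rfl, Or.inl ⟨fun hb => h ⟨b, hb, rfl⟩, rfl⟩⟩ h'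
    · exact Step.own ⟨h, h'⟩
    · exact Step.sync trivial ⟨rfl, Or.inr ⟨h, h2⟩⟩ h1
  · rintro ⟨p, q⟩ α ⟨q', p'⟩ (⟨h, h'⟩ | ⟨-, h⟩ | ⟨-, ⟨rfl, ⟨hb, rfl⟩ | ⟨hb, h⟩⟩, h'⟩)
    · exact ⟨(p, q'), LTS.InterleaveTr.right h h', rfl⟩
    · exact ⟨(p', q), LTS.InterleaveTr.left (by simp) h, rfl⟩
    · exact ⟨_, LTS.InterleaveTr.left (by rintro ⟨c, hc, hcb⟩; cases hcb; exact hb hc) h', rfl⟩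
    · exact ⟨(p', q'), LTS.InterleaveTr.both hb h' h, rfl⟩

theorem bisimilar_intChoice :
    Bisimilar (LTS.intChoice P Q) ((intCtx Q).apply none P) := by
  let f : Option (P.State ⊕ Q.State) → Option (PUnit.{v + 1} ⊕ Q.State) × P.State
    | none => (none, P.init)
    | some (Sum.inl p) => (some (Sum.inl ⟨⟩), p)
    -- The argument that was not chosen stays suspended in its initial state.
    | some (Sum.inr q) => (some (Sum.inr q), P.init)
  refine Bisimilar.of_map f rfl ?_ ?_
  · rintro x α y (_ | _ | h | h)
    · exact Step.own (Or.inl ⟨rfl, rfl, Or.inl rfl⟩)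
    · exact Step.own (Or.inl ⟨rfl, rfl, Or.inr rfl⟩)
    · cases α with
      | tau => exact Step.tau rfl h
      | vis b => exact Step.sync rfl ⟨rfl, rfl⟩ h
    · exact Step.own (Or.inr ⟨_, _, rfl, h, rfl⟩)
  · have key : ∀ c (p : P.State) α y, (intCtx Q).Step Act.tau P (c, p) α y →
        (c = none ∧ α = Act.tau ∧ y.2 = p ∧
          (y.1 = some (Sum.inl ⟨⟩) ∨ y.1 = some (Sum.inr Q.init))) ∨
        (∃ q q', c = some (Sum.inr q) ∧ Q.tr q α q' ∧ y = (some (Sum.inr q'), p)) ∨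
        (c = some (Sum.inl ⟨⟩) ∧ y.1 = c ∧ P.tr p α y.2) := by
      rintro c p α y (⟨⟨h1, h2, h3⟩ | ⟨q, q', h1, h2, rfl⟩⟩ | ⟨h, h1⟩ | ⟨h, ⟨h1, rfl⟩, h3⟩)
      · exact Or.inl ⟨h1, h2, rfl, h3⟩
      · exact Or.inr (Or.inl ⟨_, _, h1, h2, rfl⟩)
      · exact Or.inr (Or.inr ⟨h, rfl, h1⟩)
      · exact Or.inr (Or.inr ⟨h, h1, h3⟩)
    rintro (_ | p | q) α ⟨y, p'⟩ h
    · rcases key _ _ _ _ h with ⟨-, rfl, h1, h2⟩ | ⟨q, q', h1, -⟩ | ⟨h1, -⟩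
      · simp only at h1 h2
        subst h1
        rcases h2 with rfl | rfl
        · exact ⟨_, LTS.IntTr.chooseL, rfl⟩
        · exact ⟨_, LTS.IntTr.chooseR, rfl⟩
      · cases h1
      · cases h1
    · rcases key _ _ _ _ h with ⟨h1, -⟩ | ⟨q, q', h1, -⟩ | ⟨-, h1, h2⟩
      · cases h1
      · cases h1
      · exact ⟨_, LTS.IntTr.left h2, Prod.ext h1.symm rfl⟩
    · rcases key _ _ _ _ h with ⟨h1, -⟩ | ⟨q, q', h1, h2, h3⟩ | ⟨h1, -⟩
      · cases h1
      · cases h1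
        exact ⟨_, LTS.IntTr.right h2, h3.symm⟩
      · cases h1

theorem bisimilar_extChoice :
    Bisimilar (LTS.extChoice P Q) ((extCtx Q).apply (Sum.inl Q.init) P) := by
  -- A relation rather than a map: internal steps of P may precede the choice of Q, so the suspended
  -- state of P is then arbitrary.
  let B : (P.State × Q.State) ⊕ (P.State ⊕ Q.State) →
      (Q.State ⊕ (PUnit.{v + 1} ⊕ Q.State)) × P.State → Prop
    | Sum.inl (p, q), y => y = (Sum.inl q, p)
    | Sum.inr (Sum.inl p), y => y = (Sum.inr (Sum.inl ⟨⟩), p)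
    | Sum.inr (Sum.inr q), y => y.1 = Sum.inr (Sum.inr q)
  refine ⟨B, rfl, ?_, ?_⟩
  · rintro x ⟨c, p₀⟩ α y hB (h | h | h | h | h | h)
    · cases hB
      exact ⟨_, Step.tau (by simp [extCtx]) h, rfl⟩
    · cases hB
      exact ⟨_, Step.own (Or.inl ⟨_, _, rfl, h, Or.inl ⟨rfl, rfl⟩⟩), rfl⟩
    · cases hB
      exact ⟨_, Step.sync (by simp [extCtx]) ⟨rfl, rfl⟩ h, rfl⟩
    · cases hB
      exact ⟨_, Step.own (Or.inl ⟨_, _, rfl, h, Or.inr ⟨by simp, rfl⟩⟩), rfl⟩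
    · cases hB
      cases α with
      | tau => exact ⟨_, Step.tau (by simp [extCtx]) h, rfl⟩
      | vis b => exact ⟨_, Step.sync (by simp [extCtx]) ⟨rfl, rfl⟩ h, rfl⟩
    · cases hB
      exact ⟨_, Step.own (Or.inr ⟨_, _, rfl, h, rfl⟩), rfl⟩
  · have key : ∀ c (p : P.State) α y, (extCtx Q).Step Act.tau P (c, p) α y →
        (y.2 = p ∧ (extCtx Q).own c α y.1) ∨ ((extCtx Q).live c ∧
          ((α = Act.tau ∧ P.tr p Act.tau y.2 ∧ y.1 = c) ∨
            ∃ b, α = Act.vis b ∧ P.tr p α y.2 ∧ y.1 = Sum.inr (Sum.inl ⟨⟩))) := by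
      rintro c p α y (h | ⟨h, h1⟩ | ⟨h, ⟨h1, rfl⟩, h3⟩)
      · exact Or.inl ⟨rfl, h⟩
      · exact Or.inr ⟨h, Or.inl ⟨rfl, h1, rfl⟩⟩
      · exact Or.inr ⟨h, Or.inr ⟨_, rfl, h3, h1⟩⟩
    rintro (⟨p, q⟩ | p | q) ⟨c, p₀⟩ α ⟨c', p'⟩ hB h
    · cases hB
      rcases key _ _ _ _ h with ⟨h1, ⟨q, q', hq, h2, h3⟩ | ⟨q, q', hq, -⟩⟩ | ⟨-, ⟨rfl, h1, h2⟩
          | ⟨b, rfl, h1, h2⟩⟩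
      · cases hq
        simp only at h1 h3
        subst h1
        rcases h3 with ⟨rfl, rfl⟩ | ⟨hα, rfl⟩
        · exact ⟨_, LTS.ExtTr.tauR h2, rfl⟩
        · cases α with
          | tau => exact (hα rfl).elim
          | vis b => exact ⟨_, LTS.ExtTr.visR h2, rfl⟩
      · cases hq
      · exact ⟨_, LTS.ExtTr.tauL h1, Prod.ext h2 rfl⟩
      · exact ⟨_, LTS.ExtTr.visL h1, Prod.ext h2 rfl⟩
    · cases hB
      rcases key _ _ _ _ h with ⟨h1, ⟨q, q', hq, -⟩ | ⟨q, q', hq, -⟩⟩ | ⟨-, ⟨rfl, h1, h2⟩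
          | ⟨b, rfl, h1, h2⟩⟩
      · cases hq
      · cases hq
      · exact ⟨_, LTS.ExtTr.left h1, Prod.ext h2 rfl⟩
      · exact ⟨_, LTS.ExtTr.left h1, Prod.ext h2 rfl⟩
    · have hc : c = Sum.inr (Sum.inr q) := hB
      subst hc
      rcases key _ _ _ _ h with ⟨h1, ⟨q, q', hq, -⟩ | ⟨q, q', hq, h2, h3⟩⟩ | ⟨h1, -⟩
      · cases hq
      · cases hq
        exact ⟨_, LTS.ExtTr.right h2, h3⟩
      · exact (h1 q rfl).elim

theorem bisimilar_intChoice_comm : Bisimilar (LTS.intChoice P Q) (LTS.intChoice Q P) := by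
  refine Bisimilar.of_map (Option.map Sum.swap) rfl ?_ ?_
  · rintro x α y (_ | _ | h | h)
    · exact LTS.IntTr.chooseR
    · exact LTS.IntTr.chooseL
    · exact LTS.IntTr.right h
    · exact LTS.IntTr.left h
  · rintro (_ | p | q) α y h
    · cases h with
      | chooseL => exact ⟨_, LTS.IntTr.chooseR, rfl⟩
      | chooseR => exact ⟨_, LTS.IntTr.chooseL, rfl⟩
    · cases h with
      | right h => exact ⟨_, LTS.IntTr.left h, rfl⟩
    · cases h with
      | left h => exact ⟨_, LTS.IntTr.right h, rfl⟩

theorem bisimilar_extChoice_comm : Bisimilar (LTS.extChoice P Q) (LTS.extChoice Q P) := by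
  refine Bisimilar.of_map (Sum.map Prod.swap Sum.swap) rfl ?_ ?_
  · rintro x α y (h | h | h | h | h | h)
    · exact LTS.ExtTr.tauR h
    · exact LTS.ExtTr.tauL h
    · exact LTS.ExtTr.visR h
    · exact LTS.ExtTr.visL h
    · exact LTS.ExtTr.right h
    · exact LTS.ExtTr.left h
  · rintro (⟨p, q⟩ | p | q) α y h
    · cases h with
      | tauL h => exact ⟨_, LTS.ExtTr.tauR h, rfl⟩
      | tauR h => exact ⟨_, LTS.ExtTr.tauL h, rfl⟩
      | visL h => exact ⟨_, LTS.ExtTr.visR h, rfl⟩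
      | visR h => exact ⟨_, LTS.ExtTr.visL h, rfl⟩
    · cases h with
      | right h => exact ⟨_, LTS.ExtTr.left h, rfl⟩
    · cases h with
      | left h => exact ⟨_, LTS.ExtTr.right h, rfl⟩

theorem bisimilar_interleave_comm (S : Set A) :
    Bisimilar (LTS.interleave S P Q) (LTS.interleave S Q P) := by
  refine Bisimilar.of_map Prod.swap rfl ?_ ?_
  · rintro x α y (⟨h, h'⟩ | ⟨h, h'⟩ | ⟨h, h1, h2⟩)
    · exact LTS.InterleaveTr.right h h'
    · exact LTS.InterleaveTr.left h h'
    · exact LTS.InterleaveTr.both h h2 h1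
  · rintro ⟨p, q⟩ α y (⟨h, h'⟩ | ⟨h, h'⟩ | ⟨h, h1, h2⟩)
    · exact ⟨_, LTS.InterleaveTr.right h h', rfl⟩
    · exact ⟨_, LTS.InterleaveTr.left h h', rfl⟩
    · exact ⟨_, LTS.InterleaveTr.both h h2 h1, rfl⟩

/-- A preorder that contains the NDFD preorder and is preserved by all contexts is a precongruence
for the operators of CSP. -/
theorem cspPrecongruence_of_apply {R : LTS.{u, v} A → LTS.{u, v} A → Prop}
    (htrans : ∀ P Q T, R P Q → R Q T → R P T) (hndfd : ∀ P Q, NDFD P Q → R P Q)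
    (happ : ∀ {S : Type v} (C : Ctx A S (Act A)) (c : S) (P Q : LTS.{u, v} A),
      R P Q → R (C.apply c P) (C.apply c Q)) : CSPPrecongruence R := by
  have un : ∀ {S : Type v} (C : Ctx A S (Act A)) (c : S) (op : LTS.{u, v} A → LTS.{u, v} A),
      (∀ P, Bisimilar (op P) (C.apply c P)) → ∀ P Q, R P Q → R (op P) (op Q) :=
    fun C c op hop P Q h => htrans _ _ _ (hndfd _ _ (hop P).ndfd)
      (htrans _ _ _ (happ C c P Q h) (hndfd _ _ (hop Q).symm.ndfd))
  -- The arguments are replaced one at a time; commutativity up to bisimilarity brings the second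
  -- into the position of the first.
  have bin : ∀ (op : LTS.{u, v} A → LTS.{u, v} A → LTS.{u, v} A),
      (∀ Q P P', R P P' → R (op P Q) (op P' Q)) → (∀ P Q, Bisimilar (op P Q) (op Q P)) →
      ∀ P P' Q Q', R P P' → R Q Q' → R (op P Q) (op P' Q') :=
    fun op h hc P P' Q Q' hP hQ => htrans _ _ _ (h Q P P' hP)
      (htrans _ _ _ (hndfd _ _ (hc P' Q).ndfd)
        (htrans _ _ _ (h P' Q Q' hQ) (hndfd _ _ (hc Q' P').ndfd)))
  exact
    { pre := fun a => un _ _ _ (bisimilar_pre · a)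
      intChoice := bin _ (fun Q => un _ _ (LTS.intChoice · Q) (bisimilar_intChoice · Q))
        bisimilar_intChoice_comm
      extChoice := bin _ (fun Q => un _ _ (LTS.extChoice · Q) (bisimilar_extChoice · Q))
        bisimilar_extChoice_comm
      interleave := fun S => bin _
        (fun Q => un _ _ (LTS.interleave S · Q) (bisimilar_interleave · Q S))
        (bisimilar_interleave_comm · · S)
      hide := fun H => un _ _ _ (bisimilar_hide · H)
      rename := fun f => un _ _ _ (bisimilar_rename · f) }

end RewardTesting

namespace RewardTesting

/-! ### Chain contexts built from injective renaming and partially synchronous interleaving -/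

section ChainTest

variable {A : Type u}

/-- The process that performs the actions `c 0, c 1, …` (up to the first `none`), and that after `i`
of these can also stop by performing an action in `e i`. State `0` is the stopped state. -/
def chainLTS (c : ℕ → Option A) (e : ℕ → A → Prop) : LTS.{u, v} A where
  State := ULift ℕ
  tr x α y := ∃ i a, x.down = i + 1 ∧ α = Act.vis a ∧
    ((c i = some a ∧ y.down = i + 2) ∨ (e i a ∧ y.down = 0))
  init := ⟨1⟩

/-- The renamed process `P` synchronised with a chain on all actions of `P`. -/
def chainTest (f : A → A) (c : ℕ → Option A) (e : ℕ → A → Prop) (P : LTS.{u, v} A) :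
    LTS.{u, v} A :=
  LTS.interleave (Set.range f) (LTS.rename f P) (chainLTS (fun i => (c i).map f) e)

variable {f : A → A} {c : ℕ → Option A} {e : ℕ → A → Prop} {P Q : LTS.{u, v} A}

theorem length_traceUpTo {i : ℕ} (h : ∀ j < i, c j ≠ none) : (traceUpTo c i).length = i := by
  induction i with
  | zero => simp [traceUpTo]
  | succ i ih =>
    obtain ⟨b, hb⟩ := Option.ne_none_iff_exists'.1 (h i i.lt_succ_self)
    rw [traceUpTo_succ, List.length_append, ih fun j hj => h j (hj.trans i.lt_succ_self), hb]
    rfl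

theorem traceUpTo_prefix (c : ℕ → Option A) {i j : ℕ} (h : i ≤ j) :
    traceUpTo c i <+: traceUpTo c j := by
  induction j, h using Nat.le_induction with
  | base => exact List.prefix_rfl
  | succ j _ ih => rw [traceUpTo_succ]; exact ih.trans (List.prefix_append _ _)

theorem renameTr_vis {p q : P.State} {a : A} (h : LTS.RenameTr f P p (Act.vis a) q) :
    ∃ b, f b = a ∧ P.tr p (Act.vis b) q := by
  cases h with
  | vis h => exact ⟨_, rfl, h⟩

/-- All visible actions of the renamed process lie in the synchronisation set. Alone the process can
only move internally, and the chain alone can only escape, by an action outside the range of f. -/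
theorem chainTest_tr (hf : Function.Injective f) {p p' : P.State} {k k' : ℕ} {α : Act A}
    (h : (chainTest f c e P).tr (p, ⟨k⟩) α (p', ⟨k'⟩)) :
    (α = Act.tau ∧ P.tr p Act.tau p' ∧ k' = k) ∨
    ∃ i, k = i + 1 ∧ ((∃ b, c i = some b ∧ α = Act.vis (f b) ∧ P.tr p (Act.vis b) p' ∧ k' = i + 2) ∨
      (∃ a, e i a ∧ α = Act.vis a ∧ k' = 0)) := by
  rcases h with ⟨h, h' | h'⟩ | ⟨h, i, a, hi, rfl, ⟨h1, h2⟩ | ⟨h1, h2⟩⟩ |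
    ⟨h, h', i, a, hi, ha, ⟨h1, h2⟩ | ⟨h1, h2⟩⟩
  · exact Or.inl ⟨rfl, h', rfl⟩
  · exact (h ⟨_, ⟨_, rfl⟩, rfl⟩).elim
  · obtain ⟨b, -, rfl⟩ := Option.map_eq_some_iff.1 h1
    exact (h ⟨_, ⟨b, rfl⟩, rfl⟩).elim
  · exact Or.inr ⟨i, hi, Or.inr ⟨a, h1, rfl, h2⟩⟩
  · obtain ⟨b, hb, rfl⟩ := Option.map_eq_some_iff.1 h1
    cases ha
    obtain ⟨b', hbb, h'⟩ := renameTr_vis h'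
    cases hf hbb
    exact Or.inr ⟨i, hi, Or.inl ⟨b, hb, rfl, h', h2⟩⟩
  · cases ha
    exact Or.inr ⟨i, hi, Or.inr ⟨_, h1, rfl, h2⟩⟩

theorem chainTest_weak_cases (hf : Function.Injective f) {x y : (chainTest f c e P).State}
    {ρ : List A} (h : Weak (chainTest f c e P).tr x ρ y) :
    (x.2.down = 0 → y.2.down = 0 ∧ ρ = []) ∧
      ∀ i, x.2.down = i + 1 → (∀ j < i, c j ≠ none) →
      (∃ i' τ, y.2.down = i' + 1 ∧ traceUpTo c i' = traceUpTo c i ++ τ ∧ ρ = τ.map f ∧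
        Weak P.tr x.1 τ y.1 ∧ ∀ j < i', c j ≠ none) ∨
      (y.2.down = 0 ∧ ∃ i' a, e i' a ∧
        (traceUpTo c i).map f ++ ρ = (traceUpTo c i').map f ++ [a]) := by
  induction h with
  | refl x =>
    exact ⟨fun h => ⟨h, rfl⟩, fun i hi hall =>
      Or.inl ⟨i, [], hi, by simp, rfl, Weak.refl _, hall⟩⟩
  | @tau x x' y ρ h _ ih =>
    obtain ⟨p, ⟨k⟩⟩ := x
    obtain ⟨p', ⟨k'⟩⟩ := x'
    rcases chainTest_tr hf h with ⟨-, h1, rfl⟩ | ⟨i, -, ⟨b, -, h1, -⟩ | ⟨a, -, h1, -⟩⟩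
    · refine ⟨ih.1, fun i hi hall => ?_⟩
      rcases ih.2 i hi hall with ⟨i', τ, h2, h3, h4, h5, h6⟩ | h2
      · exact Or.inl ⟨i', τ, h2, h3, h4, Weak.tau h1 h5, h6⟩
      · exact Or.inr h2
    · cases h1
    · cases h1
  | @vis x x' y a ρ h _ ih =>
    obtain ⟨p, ⟨k⟩⟩ := x
    obtain ⟨p', ⟨k'⟩⟩ := x'
    rcases chainTest_tr hf h with ⟨h1, -⟩ | ⟨i, rfl, ⟨b, hb, h1, h2, rfl⟩ | ⟨a, ha, h1, rfl⟩⟩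
    · cases h1
    · cases h1
      refine ⟨fun h => by simp at h, fun i' hi' hall => ?_⟩
      obtain rfl : i = i' := by simpa using hi'
      have hall' : ∀ j < i + 1, c j ≠ none := fun j hj => by
        rcases Nat.lt_succ_iff_lt_or_eq.1 hj with hj | rfl
        · exact hall j hj
        · simp [hb]
      rcases ih.2 (i + 1) rfl hall' with ⟨i', τ, h3, h4, h5, h6, h7⟩ | ⟨h3, i', a, h4, h5⟩
      · refine Or.inl ⟨i', b :: τ, h3, ?_, by rw [h5]; rfl, Weak.vis h2 h6, h7⟩
        rw [h4, traceUpTo_succ, hb]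
        simp
      · refine Or.inr ⟨h3, i', a, h4, ?_⟩
        rw [← h5, traceUpTo_succ, hb]
        simp
    · cases h1
      refine ⟨fun h => by simp at h, fun i' hi' hall => ?_⟩
      obtain rfl : i = i' := by simpa using hi'
      obtain ⟨h2, rfl⟩ := ih.1 rfl
      exact Or.inr ⟨h2, i, _, ha, rfl⟩

/-- `P` can get stuck or diverge after `i` actions of the chain. -/
def StopsAt (f : A → A) (c : ℕ → Option A) (e : ℕ → A → Prop) (P : LTS.{u, v} A) (i : ℕ) : Prop :=
  (∀ j < i, c j ≠ none) ∧ (traceUpTo c i ∈ P.divergences ∨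
    ((∀ a, e i a → a ∈ Set.range f) ∧
      (traceUpTo c i, {b | c i = some b ∨ e i (f b)}) ∈ P.failures))

/-- After an escape no visible action is possible, so the escape ends the trace. Otherwise the trace
is the image of a part of the chain, and its completeness says that P stops there or performs the
whole infinite sequence. -/
theorem chainTest_ctraces_cases (hf : Function.Injective f) {t : List A ⊕ (ℕ → A)}
    (ht : t ∈ (chainTest f c e P).ctraces) :
    (∃ i, t = Sum.inl ((traceUpTo c i).map f) ∧ StopsAt f c e P i) ∨
    (∃ i a, e i a ∧ t = Sum.inl ((traceUpTo c i).map f ++ [a])) ∨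
    ∃ ν, (∀ n, c n = some (ν n)) ∧ t = Sum.inr (f ∘ ν) ∧ ν ∈ P.infTraces := by
  rcases ht with (⟨μ, ⟨s, h0, hs⟩, rfl⟩ | ⟨ρ, ⟨⟨p, ⟨k⟩⟩, hw, x, hx0, hx⟩, rfl⟩) |
    ⟨ρ, ⟨⟨p, ⟨k⟩⟩, hw, hd⟩, rfl⟩
  · refine Or.inr (Or.inr ?_)
    have hne : ∀ n, (s n).2.down ≠ 0 := fun n hn => by
      have := ((chainTest_weak_cases hf (hs n)).1 hn).2
      simp at this
    have step : ∀ n, (s n).2.down = n + 1 → (∀ j < n, c j ≠ none) →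
        (s (n + 1)).2.down = n + 2 ∧ ∃ b, c n = some b ∧ μ n = f b ∧
          Weak P.tr (s n).1 [b] (s (n + 1)).1 := by
      intro n hn hall
      rcases (chainTest_weak_cases hf (hs n)).2 n hn hall with ⟨i', τ, h1, h2, h3, h4, h5⟩ | ⟨h1, -⟩
      · have hlen := congrArg List.length h2
        have hlen' := congrArg List.length h3
        rw [List.length_append, length_traceUpTo h5, length_traceUpTo hall] at hlen
        simp only [List.length_map, List.length_singleton] at hlen'
        obtain rfl : i' = n + 1 := by omega
        rw [traceUpTo_succ] at h2
        obtain rfl := List.append_cancel_left h2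
        obtain ⟨b, hb⟩ := Option.ne_none_iff_exists'.1 (h5 n n.lt_succ_self)
        rw [hb] at h3 h4
        exact ⟨h1, b, hb, by simpa using h3, h4⟩
      · exact (hne _ h1).elim
    have hall : ∀ n, (s n).2.down = n + 1 ∧ ∀ j < n, c j ≠ none := by
      intro n
      induction n with
      | zero => rw [h0]; exact ⟨rfl, by simp⟩
      | succ n ih =>
        obtain ⟨h1, b, hb, -⟩ := step n ih.1 ih.2
        refine ⟨h1, fun j hj => ?_⟩
        rcases Nat.lt_succ_iff_lt_or_eq.1 hj with hj | rfl
        · exact ih.2 j hj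
        · simp [hb]
    choose ν h1 h2 h3 using fun n => (step n (hall n).1 (hall n).2).2
    exact ⟨ν, h1, congrArg Sum.inr (funext h2), fun n => (s n).1, congrArg Prod.fst h0, h3⟩
  · rcases (chainTest_weak_cases hf hw).2 0 rfl (by simp) with
      ⟨i, τ, h1, h2, rfl, h4, h5⟩ | ⟨-, i, a, h1, h2⟩
    · have h2 : traceUpTo c i = τ := h2
      subst h2
      refine Or.inl ⟨i, rfl, h5, Or.inl ⟨p, h4, fun n => (x n).1, congrArg Prod.fst hx0,
          fun n => ?_⟩⟩
      rcases chainTest_tr hf (hx n) with ⟨-, h, -⟩ | ⟨i, -, ⟨b, -, h, -⟩ | ⟨a, -, h, -⟩⟩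
      · exact h
      · cases h
      · cases h
    · exact Or.inr (Or.inl ⟨i, a, h1, congrArg Sum.inl h2⟩)
  · have hd' : ∀ α y, ¬ (chainTest f c e P).tr (p, ⟨k⟩) α y := fun α y hy => by
      have : α ∈ (chainTest f c e P).initials (p, ⟨k⟩) := ⟨y, hy⟩
      rw [hd] at this
      exact this
    rcases (chainTest_weak_cases hf hw).2 0 rfl (by simp) with
      ⟨i, τ, h1, h2, rfl, h4, h5⟩ | ⟨-, i, a, h1, h2⟩
    · have h2 : traceUpTo c i = τ := h2
      subst h2
      have h1 : k = i + 1 := h1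
      subst h1
      refine Or.inl ⟨i, rfl, h5, Or.inr ⟨fun a ha => ?_, LTS.mem_failures.2 ⟨p, h4,
          fun p' hp' => ?_, ?_⟩⟩⟩
      · by_contra hr
        exact hd' (Act.vis a) (p, ⟨0⟩) (LTS.InterleaveTr.right
          (by rintro ⟨b, hb, hba⟩; cases hba; exact hr hb) ⟨i, a, rfl, rfl, Or.inr ⟨ha, rfl⟩⟩)
      · exact hd' Act.tau (p', _) (LTS.InterleaveTr.left (by simp) (LTS.RenameTr.tau hp'))
      · rintro b (hb | hb) p' hp'
        · exact hd' (Act.vis (f b)) (p', ⟨i + 2⟩) (LTS.InterleaveTr.both ⟨b, rfl⟩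
            (LTS.RenameTr.vis hp') ⟨i, f b, rfl, rfl, Or.inl ⟨by simp [hb], rfl⟩⟩)
        · exact hd' (Act.vis (f b)) (p', ⟨0⟩) (LTS.InterleaveTr.both ⟨b, rfl⟩
            (LTS.RenameTr.vis hp') ⟨i, f b, rfl, rfl, Or.inr ⟨hb, rfl⟩⟩)
    · exact Or.inr (Or.inl ⟨i, a, h1, congrArg Sum.inl h2⟩)

theorem chainTest_weak {p q : P.State} {τ : List A} (h : Weak P.tr p τ q) (i : ℕ)
    (hc : ∀ j < τ.length, c (i + j) = τ[j]?) :
    Weak (chainTest f c e P).tr (p, ⟨i + 1⟩) (τ.map f) (q, ⟨i + τ.length + 1⟩) := by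
  induction h generalizing i with
  | refl p => exact Weak.refl _
  | tau h _ ih =>
    exact Weak.tau (LTS.InterleaveTr.left (by simp) (LTS.RenameTr.tau h)) (ih i hc)
  | @vis p p' q b τ h _ ih =>
    have h1 := ih (i + 1) fun j hj => by
      have := hc (j + 1) (by simpa using hj)
      rw [show i + (j + 1) = i + 1 + j by omega] at this
      simpa using this
    rw [show i + 1 + τ.length + 1 = i + (b :: τ).length + 1 by simp; omega] at h1
    refine Weak.vis (LTS.InterleaveTr.both ⟨b, rfl⟩ (LTS.RenameTr.vis h)
      ⟨i, f b, rfl, rfl, Or.inl ⟨?_, rfl⟩⟩) h1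
    have := hc 0 (by simp)
    simp only [add_zero, List.getElem?_cons_zero] at this
    simp [this]

theorem chainTest_mem_ctraces_of_divergence {σ : List A} (hc : ∀ j < σ.length, c j = σ[j]?)
    (h : σ ∈ P.divergences) : Sum.inl (σ.map f) ∈ (chainTest f c e P).ctraces := by
  obtain ⟨q, hq, s, h0, hs⟩ := h
  refine Or.inl (Or.inr ⟨_, ⟨_, chainTest_weak hq 0 (by simpa using hc),
    fun n => (s n, ⟨0 + σ.length + 1⟩), congrArg (fun x => (x, _)) h0, fun n => ?_⟩, rfl⟩)
  exact LTS.InterleaveTr.left (by simp) (LTS.RenameTr.tau (hs n))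

/-- Escapes at the end of σ must lie in the range of f: any other escape needs no partner and would
prevent the deadlock. -/
theorem chainTest_mem_ctraces_of_failure (hf : Function.Injective f) {σ : List A}
    (hc : ∀ j < σ.length, c j = σ[j]?) (he : ∀ a, e σ.length a → a ∈ Set.range f)
    (h : (σ, {b | c σ.length = some b ∨ e σ.length (f b)}) ∈ P.failures) :
    Sum.inl (σ.map f) ∈ (chainTest f c e P).ctraces := by
  obtain ⟨q, hq, h1, h2⟩ := LTS.mem_failures.1 h
  refine Or.inr ⟨_, ⟨_, chainTest_weak hq 0 (by simpa using hc),
    Set.eq_empty_iff_forall_notMem.2 ?_⟩, rfl⟩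
  have key : ∀ b q', P.tr q (Act.vis b) q' → ∀ i, 0 + σ.length + 1 = i + 1 →
      c i ≠ some b ∧ ¬ e i (f b) := by
    intro b q' hq' i hi
    obtain rfl : i = σ.length := by omega
    exact ⟨fun h => h2 b (Or.inl h) q' hq', fun h => h2 b (Or.inr h) q' hq'⟩
  rintro α ⟨⟨q', ⟨k'⟩⟩, ht⟩
  rcases ht with ⟨h, h' | h'⟩ | ⟨h, i, a, hi, rfl, ⟨h3, h4⟩ | ⟨h3, h4⟩⟩ |
    ⟨h, h', i, a, hi, ha, h3⟩
  · exact h1 _ h'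
  · exact (h ⟨_, ⟨_, rfl⟩, rfl⟩).elim
  · obtain ⟨b, -, rfl⟩ := Option.map_eq_some_iff.1 h3
    exact (h ⟨_, ⟨b, rfl⟩, rfl⟩).elim
  · obtain rfl : i = σ.length := by simp only at hi; omega
    exact h ⟨a, he a h3, rfl⟩
  · cases ha
    obtain ⟨b, rfl⟩ := h
    obtain ⟨b', hbb, h'⟩ := renameTr_vis h'
    cases hf hbb
    obtain ⟨h5, h6⟩ := key b _ h' i hi
    rcases h3 with ⟨h3, -⟩ | ⟨h3, -⟩
    · obtain ⟨b', hb', hbb⟩ := Option.map_eq_some_iff.1 h3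
      cases hf hbb
      exact h5 hb'
    · exact h6 h3

theorem chainTest_mem_ctraces_of_infTrace {ν : ℕ → A} (hc : ∀ n, c n = some (ν n))
    (h : ν ∈ P.infTraces) : Sum.inr (f ∘ ν) ∈ (chainTest f c e P).ctraces := by
  obtain ⟨s, h0, hs⟩ := h
  refine Or.inl (Or.inl ⟨_, ⟨fun n => (s n, ⟨n + 1⟩), by simp only [h0]; rfl, fun n => ?_⟩, rfl⟩)
  exact chainTest_weak (hs n) n (by simp [hc])

end ChainTest

end RewardTesting

namespace RewardTesting

/-! ### The coarsest precongruences -/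

section Preserves

variable {A : Type u} {P Q : LTS.{u, v} A}

theorem LTS.inl_mem_ctraces {σ : List A} :
    Sum.inl σ ∈ P.ctraces ↔ σ ∈ P.divergences ∨ (σ, Set.univ) ∈ P.failures := by
  rw [← LTS.mem_deadlocks]
  simp [LTS.ctraces]

theorem LTS.inr_mem_ctraces {ν : ℕ → A} : Sum.inr ν ∈ P.ctraces ↔ ν ∈ P.infTraces := by
  simp [LTS.ctraces]

theorem NDFD.ctraces_subset (h : NDFD P Q) : Q.ctraces ⊆ P.ctraces := by
  rintro (σ | ν) ht
  · rw [LTS.inl_mem_ctraces] at ht ⊢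
    rcases ht with ht | ht
    · exact Or.inl (h.1 ht)
    · exact (h.2.2 (Or.inl ht)).symm
  · rw [LTS.inr_mem_ctraces] at ht ⊢
    exact h.2.1 ht

theorem preservesLinearTime_ndfd : PreservesLinearTime (NDFD (A := A)) :=
  fun _ _ h _ hP => h.ctraces_subset.trans hP

/-- If P answers an infinite trace ν of Q only by divergences along ν, take one extending the prefix
of ν that lies in C. It is a complete trace of P subject to the condition, and its prefix in G is
also a prefix of ν. -/
theorem preservesCondLiveness_fdid : PreservesCondLiveness (FDId (A := A)) := by
  rintro P Q h C G hP (σ | ν) ht hC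
  · refine hP _ ?_ hC
    rw [LTS.inl_mem_ctraces] at ht ⊢
    rcases ht with ht | ht
    · exact Or.inl (h.1 ht)
    · exact (h.2.2 (Or.inl ht)).symm
  · rw [LTS.inr_mem_ctraces] at ht
    rcases h.2.1 (Or.inl ht) with hν | hν
    · exact hP _ (LTS.inr_mem_ctraces.2 hν) hC
    · obtain ⟨κ, hκ, hκν⟩ := hC
      obtain ⟨ρ, hρ, h1, h2⟩ := hν κ hκν
      obtain ⟨γ, hγ, h3⟩ := hP (Sum.inl ρ) (LTS.inl_mem_ctraces.2 (Or.inl hρ)) ⟨κ, hκ, h1⟩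
      exact ⟨γ, hγ, PrefixInf.of_prefix h2 h3⟩

theorem preservesLiveness_fdibot : PreservesLiveness (FDIbot (A := A)) := by
  rintro P Q h G hP (σ | ν) ht
  · have key : (∃ ρ ∈ P.divergences, ρ <+: σ) ∨ (σ, Set.univ) ∈ P.failures := by
      rcases LTS.inl_mem_ctraces.1 ht with ht | ht
      · exact Or.inl (h.1 ⟨σ, ht, List.prefix_rfl⟩)
      · exact (h.2.2 (Or.inl ht)).symm
    rcases key with ⟨ρ, h1, h2⟩ | h1
    · obtain ⟨γ, hγ, h3⟩ := hP (Sum.inl ρ) (LTS.inl_mem_ctraces.2 (Or.inl h1))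
      exact ⟨γ, hγ, List.IsPrefix.trans h3 h2⟩
    · exact hP _ (LTS.inl_mem_ctraces.2 (Or.inr h1))
  · rcases h.2.1 (Or.inl (LTS.inr_mem_ctraces.1 ht)) with hν | ⟨ρ, h1, h2⟩
    · exact hP _ (LTS.inr_mem_ctraces.2 hν)
    · obtain ⟨γ, hγ, h3⟩ := hP (Sum.inl ρ) (LTS.inl_mem_ctraces.2 (Or.inl h1))
      exact ⟨γ, hγ, PrefixInf.of_prefix h2 h3⟩

theorem preservesSafety_trace : PreservesSafety (Trace (A := A)) := fun P Q h B hP => by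
  have h' : Q.ptraces ∩ B ⊆ P.ptraces ∩ B := Set.inter_subset_inter_left B h
  unfold SatSafety at hP ⊢
  rw [hP] at h'
  exact Set.subset_empty_iff.1 h'

end Preserves

/-! ### Maximality among the property-preserving precongruences -/

section Coarsest

variable {A : Type u} {R : LTS.{u, v} A → LTS.{u, v} A → Prop}

theorem CSPPrecongruence.interleavingPrecongruence (h : CSPPrecongruence R) :
    InterleavingPrecongruence R :=
  ⟨fun f _ => h.rename f, h.interleave⟩

theorem InterleavingPrecongruence.chainTest (hR : InterleavingPrecongruence R) (hp : IsPreord R)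
    {f : A → A} (hf : Function.Injective f) (c : ℕ → Option A) (e : ℕ → A → Prop)
    {P Q : LTS.{u, v} A} (h : R P Q) : R (chainTest f c e P) (chainTest f c e Q) :=
  hR.interleave _ _ _ _ _ (hR.rename f hf _ _ h) (hp.refl _)

/-- Adjoining one element does not change an infinite cardinal; a bijection from `Option A` to A
supplies f on the old elements and d as the image of the new one. -/
theorem exists_injective_not_mem_range (A : Type u) [Infinite A] :
    ∃ (f : A → A) (d : A), Function.Injective f ∧ d ∉ Set.range f := by
  have h : Cardinal.mk (Option A) = Cardinal.mk A := by
    rw [Cardinal.mk_option, Cardinal.add_one_eq (Cardinal.aleph0_le_mk A)]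
  obtain ⟨g⟩ := Cardinal.eq.1 h
  refine ⟨fun a => g (some a), g none, fun a b hab => Option.some.inj (g.injective hab), ?_⟩
  rintro ⟨a, ha⟩
  cases g.injective ha

/-- Asking for fewer operators enlarges the class of candidates, so maximality in the larger class
settles both claims. -/
theorem isCoarsest_of {Pres : (LTS.{u, v} A → LTS.{u, v} A → Prop) → Prop} (hp : IsPreord R)
    (hcsp : CSPPrecongruence R) (hpres : Pres R)
    (hle : ∀ R', IsPreord R' → InterleavingPrecongruence R' → Pres R' → R' ≤ R) :
    IsCoarsestPrecongruence R Pres :=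
  ⟨⟨⟨hp, hcsp, hpres⟩, fun R' h => hle R' h.1 h.2.1.interleavingPrecongruence h.2.2⟩,
    ⟨⟨hp, hcsp.interleavingPrecongruence, hpres⟩, fun R' h => hle R' h.1 h.2.1 h.2.2⟩⟩

theorem isPreord_ndfd : IsPreord (NDFD (A := A)) :=
  ⟨fun _ => ⟨subset_rfl, subset_rfl, subset_rfl⟩,
    fun _ _ _ h h' => ⟨h'.1.trans h.1, h'.2.1.trans h.2.1, h'.2.2.trans h.2.2⟩⟩

theorem isPreord_fdid : IsPreord (FDId (A := A)) :=
  ⟨fun _ => ⟨subset_rfl, subset_rfl, subset_rfl⟩,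
    fun _ _ _ h h' => ⟨h'.1.trans h.1, h'.2.1.trans h.2.1, h'.2.2.trans h.2.2⟩⟩

theorem isPreord_fdibot : IsPreord (FDIbot (A := A)) :=
  ⟨fun _ => ⟨subset_rfl, subset_rfl, subset_rfl⟩,
    fun _ _ _ h h' => ⟨h'.1.trans h.1, h'.2.1.trans h.2.1, h'.2.2.trans h.2.2⟩⟩

theorem isPreord_trace : IsPreord (Trace (A := A)) :=
  ⟨fun _ => Set.Subset.rfl, fun _ _ _ h h' => Set.Subset.trans h' h⟩

/-- Maximality uses no operator: P satisfies the safety property whose bad sequences are exactly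
those that are not partial traces of P. -/
theorem isCoarsest_trace : IsCoarsestPrecongruence (Trace (A := A)) PreservesSafety := by
  refine isCoarsest_of isPreord_trace (cspPrecongruence_of_apply isPreord_trace.trans
    (fun _ _ h => h.traceInf.trace) fun C c _ _ h => Trace.apply C c h) preservesSafety_trace ?_
  intro R' _ _ hpres P Q h σ hσ
  by_contra hP
  have : Q.ptraces ∩ (P.ptracesᶜ) = ∅ := hpres P Q h _ (Set.inter_compl_self _)
  exact (this ▸ (⟨hσ, hP⟩ : σ ∈ Q.ptraces ∩ (P.ptracesᶜ)) : σ ∈ (∅ : Set (List A)))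

theorem list_stopsAt {P : LTS.{u, v} A} {f : A → A} {σ : List A} {e : ℕ → A → Prop} {i : ℕ}
    (h : StopsAt f (fun i => σ[i]?) e P i) :
    i ≤ σ.length ∧ (σ.take i ∈ P.divergences ∨ ((∀ a, e i a → a ∈ Set.range f) ∧
      (σ.take i, {b | σ[i]? = some b ∨ e i (f b)}) ∈ P.failures)) := by
  refine ⟨?_, by simpa only [StopsAt, traceUpTo_getElem?] using h.2⟩
  by_contra hi
  exact h.1 σ.length (by omega) (by simp)

/-- The linear-time property used is the set of complete traces of the chain test of P itself, so
these sets are compared directly. -/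
theorem le_ndfd_of_preservesLinearTime [Infinite A] (hp : IsPreord R)
    (hR : InterleavingPrecongruence R) (hpres : PreservesLinearTime R) : R ≤ NDFD := by
  intro P Q h
  obtain ⟨f, d, hf, hd⟩ := exists_injective_not_mem_range A
  have hsub : ∀ c e, (chainTest f c e Q).ctraces ⊆ (chainTest f c e P).ctraces := fun c e =>
    hpres _ _ (hR.chainTest hp hf c e h) _ Set.Subset.rfl
  have key : ∀ (σ : List A) (E : A → Prop),
      Sum.inl (σ.map f) ∈ (chainTest f (fun i => σ[i]?) (fun i a => i = σ.length ∧ E a) Q).ctraces →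
      σ ∈ P.divergences ∨ ((∀ a, E a → a ∈ Set.range f) ∧ (σ, {b | E (f b)}) ∈ P.failures) := by
    intro σ E hσ
    rcases chainTest_ctraces_cases hf (hsub _ _ hσ) with ⟨i, h1, h2⟩ | ⟨i, a, ⟨rfl, -⟩, h2⟩
        | ⟨ν, -, h1, -⟩
    · obtain ⟨h3, h4⟩ := list_stopsAt h2
      rw [traceUpTo_getElem?] at h1
      have h5 := congrArg List.length (Sum.inl.inj h1)
      simp only [List.length_map, List.length_take] at h5
      obtain rfl : i = σ.length := by omega
      simpa using h4
    · have h5 := congrArg List.length (Sum.inl.inj h2)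
      simp [traceUpTo_getElem?] at h5
    · cases h1
  have hdiv : Q.divergences ⊆ P.divergences := fun σ hσ => by
    -- The escape d is never synchronised, hence never blocked; it rules out deadlock at the end of
    -- σ and leaves only divergence.
    rcases key σ (· = d) (chainTest_mem_ctraces_of_divergence (fun _ _ => rfl) hσ) with h1 | ⟨h1, -⟩
    · exact h1
    · exact (hd (h1 d rfl)).elim
  refine ⟨hdiv, fun ν hν => ?_, ?_⟩
  · rcases chainTest_ctraces_cases hf (hsub _ _ (chainTest_mem_ctraces_of_infTrace
      (c := fun n => some (ν n)) (e := fun _ _ => False) (fun _ => rfl) hν)) with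
      ⟨i, h1, -⟩ | ⟨i, a, h1, -⟩ | ⟨ν', h1, -, h2⟩
    · cases h1
    · exact h1.elim
    · obtain rfl : ν = ν' := funext fun n => Option.some.inj (h1 n)
      exact h2
  · rintro ⟨σ, X⟩ (hσ | hσ)
    · rcases key σ (fun a => ∃ x ∈ X, a = f x) (chainTest_mem_ctraces_of_failure hf (fun _ _ => rfl)
        (by rintro a ⟨-, x, -, rfl⟩; exact ⟨x, rfl⟩) (by simpa [hf.eq_iff] using hσ)) with h1
            | ⟨-, h1⟩
      · exact Or.inr h1
      · exact Or.inl (by simpa [hf.eq_iff] using h1)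
    · exact Or.inr (hdiv hσ)

/-- If P neither stops at or after position k nor performs the whole chain, then every complete
trace of its chain test that passes position k ends in an escape. This is a conditional liveness
property, and t violates it: by `he` no trace ending in an escape is a prefix of t, as the escape
comes after the end of the chain or lies outside the range of f. -/
theorem exists_stopsAt_of_condLiveness {P Q : LTS.{u, v} A} {f : A → A}
    (hf : Function.Injective f) {c : ℕ → Option A} {e : ℕ → A → Prop} {k : ℕ}
    (h : ∀ G, SatCondLiveness (chainTest f c e P) {(traceUpTo c k).map f} G →
      SatCondLiveness (chainTest f c e Q) {(traceUpTo c k).map f} G)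
    (hk : ∀ j < k, c j ≠ none) (he : ∀ i a, e i a → c i = none ∨ a ∉ Set.range f)
    {t : List A ⊕ (ℕ → A)} (ht : t ∈ (chainTest f c e Q).ctraces)
    (ht' : (∃ i, k ≤ i ∧ (∀ j < i, c j ≠ none) ∧ t = Sum.inl ((traceUpTo c i).map f)) ∨
      ∃ ν, (∀ n, c n = some (ν n)) ∧ t = Sum.inr (f ∘ ν)) :
    (∃ i, k ≤ i ∧ StopsAt f c e P i) ∨ ∃ ν, (∀ n, c n = some (ν n)) ∧ ν ∈ P.infTraces := by
  by_contra! hcon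
  have hP : SatCondLiveness (chainTest f c e P) {(traceUpTo c k).map f}
      {ρ | ∃ i a, e i a ∧ ρ = (traceUpTo c i).map f ++ [a]} := by
    intro t ht hC
    rcases chainTest_ctraces_cases hf ht with ⟨i, rfl, h2⟩ | ⟨i, a, h1, rfl⟩ | ⟨ν, h1, -, h2⟩
    · obtain ⟨ρ, rfl, hρ⟩ := hC
      have := List.IsPrefix.length_le hρ
      rw [List.length_map, List.length_map, length_traceUpTo hk, length_traceUpTo h2.1] at this
      exact (hcon.1 i this h2).elim
    · exact ⟨_, ⟨i, a, h1, rfl⟩, List.prefix_rfl⟩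
    · exact (hcon.2 ν h1 h2).elim
  have hC : HasPrefixIn t {(traceUpTo c k).map f} := by
    rcases ht' with ⟨i, hi, -, rfl⟩ | ⟨ν, hν, rfl⟩
    · exact ⟨_, rfl, (traceUpTo_prefix c hi).map f⟩
    · refine ⟨_, rfl, ?_⟩
      obtain rfl : c = fun n => some (ν n) := funext hν
      rw [traceUpTo_some, List.map_map]
      exact prefixInf_map_range _ _
  obtain ⟨-, ⟨i, a, hia, rfl⟩, hpre⟩ := h _ hP t ht hC
  rcases ht' with ⟨j, -, hj, rfl⟩ | ⟨ν, hν, rfl⟩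
  · rcases he i a hia with hn | ha
    · have hji : j ≤ i := not_lt.1 fun hij => hj i hij hn
      have h1 := List.IsPrefix.length_le hpre
      have h2 := (traceUpTo_prefix c hji).length_le
      simp only [List.length_append, List.length_map, List.length_singleton] at h1
      omega
    · have : a ∈ (traceUpTo c j).map f := List.IsPrefix.subset hpre (by simp)
      obtain ⟨b, -, rfl⟩ := List.mem_map.1 this
      exact ha ⟨b, rfl⟩
  · have ha := (he i a hia).resolve_left (by simp [hν])
    have hmem : a ∈ (traceUpTo c i).map f ++ [a] := by simp
    have hpre' : PrefixInf ((traceUpTo c i).map f ++ [a]) (f ∘ ν) := hpre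
    rw [hpre'] at hmem
    obtain ⟨n, -, rfl⟩ := List.mem_map.1 hmem
    exact ha ⟨_, rfl⟩

/-- The argument parallels `Ctx.fdid_of_chain`: the condition of having passed the prefix σ takes
over the role of the penalties, and the action d that of the internal escape. -/
theorem le_fdid_of_preservesCondLiveness [Infinite A] (hp : IsPreord R)
    (hR : InterleavingPrecongruence R) (hpres : PreservesCondLiveness R) : R ≤ FDId := by
  intro P Q h
  obtain ⟨f, d, hf, hd⟩ := exists_injective_not_mem_range A
  have htest : ∀ c e C G, SatCondLiveness (chainTest f c e P) C G →
      SatCondLiveness (chainTest f c e Q) C G := fun c e => hpres _ _ (hR.chainTest hp hf c e h)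
  have key : ∀ (σ : List A) (E : A → Prop),
      Sum.inl (σ.map f) ∈ (chainTest f (fun i => σ[i]?) (fun i a => i = σ.length ∧ E a) Q).ctraces →
      σ ∈ P.divergences ∨ ((∀ a, E a → a ∈ Set.range f) ∧ (σ, {b | E (f b)}) ∈ P.failures) := by
    intro σ E hσ
    rcases exists_stopsAt_of_condLiveness (k := σ.length) hf (htest _ _ _)
      (fun j hj => Ctx.getElem?_ne_none_of_lt hj) (by rintro i a ⟨rfl, -⟩; simp) hσ
      (Or.inl ⟨σ.length, le_rfl, fun j hj => Ctx.getElem?_ne_none_of_lt hj,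
        by rw [traceUpTo_getElem?, List.take_length]⟩) with ⟨i, h1, h2⟩ | ⟨ν, h1, -⟩
    · obtain ⟨h3, h4⟩ := list_stopsAt h2
      obtain rfl : i = σ.length := by omega
      simpa using h4
    · simpa using h1 σ.length
  have hdiv : Q.divergences ⊆ P.divergences := fun σ hσ => by
    rcases key σ (· = d) (chainTest_mem_ctraces_of_divergence (fun _ _ => rfl) hσ) with h1 | ⟨h1, -⟩
    · exact h1
    · exact (hd (h1 d rfl)).elim
  refine ⟨hdiv, ?_, ?_⟩
  · rintro ν (hν | hν)
    · by_contra hcon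
      have hcon' : ∃ σ, PrefixInf σ ν ∧ ∀ ρ ∈ P.divergences, σ <+: ρ → ¬ PrefixInf ρ ν := by
        by_contra! h
        exact hcon (Or.inr h)
      obtain ⟨σ, hσ, hσd⟩ := hcon'
      rcases exists_stopsAt_of_condLiveness (k := σ.length) (c := fun n => some (ν n))
        (e := fun i a => a = d) hf (htest _ _ _) (by simp)
        (by rintro i a rfl; exact Or.inr hd)
        (chainTest_mem_ctraces_of_infTrace (fun _ => rfl) hν) (Or.inr ⟨ν, fun _ => rfl, rfl⟩) with
        ⟨i, h1, -, h2 | ⟨h2, -⟩⟩ | ⟨ν', h1, h2⟩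
      · rw [traceUpTo_some] at h2
        refine hσd _ h2 ?_ (prefixInf_map_range ν i)
        rw [hσ]
        exact map_range_prefix ν h1
      · exact hd (h2 d rfl)
      · obtain rfl : ν = ν' := funext fun n => Option.some.inj (h1 n)
        exact hcon (Or.inl h2)
    · exact Or.inr fun σ hσ => let ⟨ρ, h1, h2⟩ := hν σ hσ; ⟨ρ, hdiv h1, h2⟩
  · rintro ⟨σ, X⟩ (hσ | hσ)
    · rcases key σ (fun a => ∃ x ∈ X, a = f x) (chainTest_mem_ctraces_of_failure hf (fun _ _ => rfl)
        (by rintro a ⟨-, x, -, rfl⟩; exact ⟨x, rfl⟩) (by simpa [hf.eq_iff] using hσ)) with h1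
            | ⟨-, h1⟩
      · exact Or.inr h1
      · exact Or.inl (by simpa [hf.eq_iff] using h1)
    · exact Or.inr (hdiv hσ)

theorem le_fdibot_of_preservesLiveness [Infinite A] (hp : IsPreord R)
    (hR : InterleavingPrecongruence R) (hpres : PreservesLiveness R) : R ≤ FDIbot := by
  intro P Q h
  obtain ⟨f, d, hf, hd⟩ := exists_injective_not_mem_range A
  -- The condition is the empty sequence, a prefix of everything, so this conditional liveness is
  -- ordinary liveness.
  have htest : ∀ c e G, SatCondLiveness (chainTest f c e P) {(traceUpTo c 0).map f} G →
      SatCondLiveness (chainTest f c e Q) {(traceUpTo c 0).map f} G := fun c e G hG t ht _ => by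
    refine hpres _ _ (hR.chainTest hp hf c e h) G (fun t ht => hG t ht ⟨[], rfl, ?_⟩) t ht
    rcases t with σ | ν
    · exact List.nil_prefix
    · exact rfl
  have hdiv : ∀ σ ∈ Q.divergences, ∃ ρ ∈ P.divergences, ρ <+: σ := by
    intro σ hσ
    rcases exists_stopsAt_of_condLiveness (k := 0) (c := fun i => σ[i]?) (e := fun i a => a = d) hf
      (htest _ _) (by simp) (by rintro i a rfl; exact Or.inr hd)
      (chainTest_mem_ctraces_of_divergence (fun _ _ => rfl) hσ)
      (Or.inl ⟨σ.length, Nat.zero_le _, fun j hj => Ctx.getElem?_ne_none_of_lt hj,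
        by rw [traceUpTo_getElem?, List.take_length]⟩) with ⟨i, -, h2⟩ | ⟨ν, h1, -⟩
    · obtain ⟨-, h4 | ⟨h4, -⟩⟩ := list_stopsAt h2
      · exact ⟨_, h4, List.take_prefix _ _⟩
      · exact (hd (h4 d rfl)).elim
    · simpa using h1 σ.length
  refine ⟨?_, ?_, ?_⟩
  · rintro σ ⟨ρ, h1, h2⟩
    obtain ⟨ρ', h3, h4⟩ := hdiv ρ h1
    exact ⟨ρ', h3, h4.trans h2⟩
  · rintro ν (hν | ⟨ρ, h1, h2⟩)
    · rcases exists_stopsAt_of_condLiveness (k := 0) (c := fun n => some (ν n))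
        (e := fun i a => a = d) hf (htest _ _) (by simp)
        (by rintro i a rfl; exact Or.inr hd)
        (chainTest_mem_ctraces_of_infTrace (fun _ => rfl) hν) (Or.inr ⟨ν, fun _ => rfl, rfl⟩) with
        ⟨i, h1, -, h2 | ⟨h2, -⟩⟩ | ⟨ν', h1, h2⟩
      · rw [traceUpTo_some] at h2
        exact Or.inr ⟨_, h2, prefixInf_map_range ν i⟩
      · exact (hd (h2 d rfl)).elim
      · obtain rfl : ν = ν' := funext fun n => Option.some.inj (h1 n)
        exact Or.inl h2
    · obtain ⟨ρ', h3, h4⟩ := hdiv ρ h1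
      exact Or.inr ⟨ρ', h3, h2.of_prefix h4⟩
  · rintro ⟨σ, X⟩ (hσ | ⟨ρ, h1, h2⟩)
    · rcases exists_stopsAt_of_condLiveness (k := 0) (c := fun i => σ[i]?)
        (e := fun i a => (i < σ.length ∧ a = d) ∨ (i = σ.length ∧ ∃ x ∈ X, a = f x)) hf
        (htest _ _) (by simp)
        (by rintro i a (⟨-, rfl⟩ | ⟨rfl, -⟩); exacts [Or.inr hd, Or.inl (by simp)])
        (chainTest_mem_ctraces_of_failure (σ := σ) hf (fun _ _ => rfl)
          (by rintro a (⟨h, -⟩ | ⟨-, x, -, rfl⟩); exacts [(lt_irrefl _ h).elim, ⟨x, rfl⟩])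
          (by simpa [hf.eq_iff] using hσ))
        (Or.inl ⟨σ.length, Nat.zero_le _, fun j hj => Ctx.getElem?_ne_none_of_lt hj,
          by rw [traceUpTo_getElem?, List.take_length]⟩) with ⟨i, -, h2⟩ | ⟨ν, h1, -⟩
      · obtain ⟨h3, h4 | ⟨h4, h5⟩⟩ := list_stopsAt h2
        · exact Or.inr ⟨_, h4, List.take_prefix _ _⟩
        · have hi : ¬ i < σ.length := fun hi => hd (h4 d (Or.inl ⟨hi, rfl⟩))
          obtain rfl : i = σ.length := by omega
          exact Or.inl (by simpa [hf.eq_iff] using h5)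
      · simpa using h1 σ.length
    · obtain ⟨ρ', h3, h4⟩ := hdiv ρ h1
      exact Or.inr ⟨ρ', h3, h4.trans h2⟩

theorem isCoarsest_ndfd [Infinite A] :
    IsCoarsestPrecongruence (NDFD (A := A)) PreservesLinearTime :=
  isCoarsest_of isPreord_ndfd (cspPrecongruence_of_apply isPreord_ndfd.trans
    (fun _ _ h => h) fun C c _ _ h => NDFD.apply C c h) preservesLinearTime_ndfd
    fun _ => le_ndfd_of_preservesLinearTime

theorem isCoarsest_fdid [Infinite A] :
    IsCoarsestPrecongruence (FDId (A := A)) PreservesCondLiveness :=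
  isCoarsest_of isPreord_fdid (cspPrecongruence_of_apply isPreord_fdid.trans
    (fun _ _ h => h.fdid) fun C c _ _ h => FDId.apply C c h) preservesCondLiveness_fdid
    fun _ => le_fdid_of_preservesCondLiveness

theorem isCoarsest_fdibot [Infinite A] :
    IsCoarsestPrecongruence (FDIbot (A := A)) PreservesLiveness :=
  isCoarsest_of isPreord_fdibot (cspPrecongruence_of_apply isPreord_fdibot.trans
    (fun _ _ h => h.fdid.fdibot) fun C c _ _ h => FDIbot.apply C c h) preservesLiveness_fdibot
    fun _ => le_fdibot_of_preservesLiveness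

end Coarsest

end RewardTesting

namespace RewardTesting

/-! ### Metatheory of CCS -/

namespace Expr

variable {Ch V L L' : Type u}

theorem ClosedIn.mono {E : Expr Ch V L} : ∀ {Γ Δ : Set V}, Γ ⊆ Δ → ClosedIn Γ E → ClosedIn Δ E := by
  induction E with
  | pre ℓ E ih => intro Γ Δ h hE; exact ih h hE
  | sum I E ih => intro Γ Δ h hE i; exact ih i h (hE i)
  | par E F ihE ihF => intro Γ Δ h hE; exact ⟨ihE h hE.1, ihF h hE.2⟩
  | res E H ih => intro Γ Δ h hE; exact ih h hE
  | ren E f ih => intro Γ Δ h hE; exact ih h hE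
  | var X => intro Γ Δ h hE; exact h hE
  | fix D S X ih =>
    intro Γ Δ h hE Y
    exact ih Y (Set.union_subset_union_left D h) (hE Y)

theorem ClosedIn.subst {E : Expr Ch V L} : ∀ {Γ Δ : Set V} {σ : V → Expr Ch V L},
    (∀ Z ∈ Γ, ClosedIn Δ (σ Z)) → ClosedIn Γ E → ClosedIn Δ (Expr.subst σ E) := by
  induction E with
  | pre ℓ E ih => intro Γ Δ σ h hE; exact ih h hE
  | sum I E ih => intro Γ Δ σ h hE i; exact ih i h (hE i)
  | par E F ihE ihF => intro Γ Δ σ h hE; exact ⟨ihE h hE.1, ihF h hE.2⟩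
  | res E H ih => intro Γ Δ σ h hE; exact ih h hE
  | ren E f ih => intro Γ Δ σ h hE; exact ih h hE
  | var X => intro Γ Δ σ h hE; exact h X hE
  | fix D S X ih =>
    intro Γ Δ σ h hE Y
    refine ih Y (Γ := Γ ∪ D) (fun Z hZ => ?_) (hE Y)
    by_cases hD : Z ∈ D
    · simp only [if_pos hD]
      exact Or.inr hD
    · simp only [if_neg hD]
      exact (h Z (hZ.resolve_right hD)).mono Set.subset_union_left

theorem Closed.unfold {D : Set V} {S : D → Expr Ch V L} {X : D} (h : (fix D S X).Closed) :
    (unfold D S X).Closed := by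
  refine ClosedIn.subst (fun Y hY => ?_) (h X)
  have hY : Y ∈ D := hY.resolve_left id
  simp only [dif_pos hY]
  exact h

theorem Closed.of_tr [Labels Ch L] {E E' : Expr Ch V L} {ℓ : L} (h : Tr E ℓ E') (hE : E.Closed) :
    E'.Closed := by
  induction h with
  | pre ℓ E => exact hE
  | sum j _ ih => exact ih (hE j)
  | parL _ ih => exact ⟨ih hE.1, hE.2⟩
  | parR _ ih => exact ⟨hE.1, ih hE.2⟩
  | comm _ _ _ ih ih' => exact ⟨ih hE.1, ih' hE.2⟩
  | res _ _ ih => exact ih hE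
  | ren _ ih => exact ih hE
  | fix _ ih => exact ih (Closed.unfold hE)

theorem AllLabels.subst {p : L → Prop} {E : Expr Ch V L} : ∀ {σ : V → Expr Ch V L},
    (∀ Z, AllLabels p (σ Z)) → AllLabels p E → AllLabels p (Expr.subst σ E) := by
  induction E with
  | pre ℓ E ih => intro σ h hE; exact ⟨hE.1, ih h hE.2⟩
  | sum I E ih => intro σ h hE i; exact ih i h (hE i)
  | par E F ihE ihF => intro σ h hE; exact ⟨ihE h hE.1, ihF h hE.2⟩
  | res E H ih => intro σ h hE; exact ih h hE
  | ren E f ih => intro σ h hE; exact ih h hE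
  | var X => intro σ h hE; exact h X
  | fix D S X ih =>
    intro σ h hE Y
    refine ih Y (fun Z => ?_) (hE Y)
    by_cases hD : Z ∈ D
    · simp only [if_pos hD]
      trivial
    · simp only [if_neg hD]
      exact h Z

theorem AllLabels.of_tr [Labels Ch L] {p : L → Prop}
    (hren : ∀ (f : Ch → Ch) (ℓ : L), p ℓ → p (Labels.ren f ℓ))
    (hcomm : ∀ ℓ ℓ' ℓ'' : L, Labels.Comm Ch ℓ ℓ' ℓ'' → p ℓ → p ℓ' → p ℓ'')
    {E E' : Expr Ch V L} {ℓ : L} (h : Tr E ℓ E') (hE : E.AllLabels p) :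
    E'.AllLabels p ∧ p ℓ := by
  induction h with
  | pre ℓ E => exact ⟨hE.2, hE.1⟩
  | sum j _ ih => exact ih (hE j)
  | parL _ ih => exact ⟨⟨(ih hE.1).1, hE.2⟩, (ih hE.1).2⟩
  | parR _ ih => exact ⟨⟨hE.1, (ih hE.2).1⟩, (ih hE.2).2⟩
  | comm h _ _ ih ih' =>
    exact ⟨⟨(ih hE.1).1, (ih' hE.2).1⟩, hcomm _ _ _ h (ih hE.1).2 (ih' hE.2).2⟩
  | res _ _ ih => exact ih hE
  | ren _ ih => exact ⟨(ih hE).1, hren _ _ (ih hE).2⟩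
  | @fix D S X _ _ _ ih =>
    refine ih (AllLabels.subst (fun Y => ?_) (hE X))
    by_cases hY : Y ∈ D
    · simp only [dif_pos hY]
      exact hE
    · simp only [dif_neg hY]
      trivial

theorem mapLabel_subst (g : L → L') {E : Expr Ch V L} : ∀ {σ : V → Expr Ch V L},
    (Expr.subst σ E).mapLabel g = Expr.subst (fun X => (σ X).mapLabel g) (E.mapLabel g) := by
  induction E with
  | pre ℓ E ih => intro σ; simp only [Expr.subst, mapLabel, ih]
  | sum I E ih => intro σ; simp only [Expr.subst, mapLabel, ih]
  | par E F ihE ihF => intro σ; simp only [Expr.subst, mapLabel, ihE, ihF]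
  | res E H ih => intro σ; simp only [Expr.subst, mapLabel, ih]
  | ren E f ih => intro σ; simp only [Expr.subst, mapLabel, ih]
  | var X => intro σ; rfl
  | fix D S X ih =>
    intro σ
    simp only [Expr.subst, mapLabel, ih]
    congr 1
    funext Y
    congr 1
    funext Z
    split_ifs <;> rfl

theorem mapLabel_unfold (g : L → L') (D : Set V) (S : D → Expr Ch V L) (X : D) :
    (unfold D S X).mapLabel g = unfold D (fun Y => (S Y).mapLabel g) X := by
  unfold unfold
  rw [mapLabel_subst]
  congr 1
  funext Y
  split_ifs <;> rfl

end Expr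

/-- The map `g` between label sets is compatible with the operational semantics. -/
structure LabelHom (Ch : Type u) {L L' : Type u} [Labels Ch L] [Labels Ch L'] (g : L → L') :
    Prop where
  unrestricted : ∀ (H : Set Ch) ℓ, Labels.Unrestricted H (g ℓ) ↔ Labels.Unrestricted H ℓ
  ren : ∀ (f : Ch → Ch) ℓ, Labels.ren f (g ℓ) = g (Labels.ren f ℓ)
  comm : ∀ ℓ ℓ' m, Labels.Comm Ch (g ℓ) (g ℓ') m ↔ ∃ ℓ'', m = g ℓ'' ∧ Labels.Comm Ch ℓ ℓ' ℓ''

namespace Expr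

variable {Ch V L L' : Type u} [Labels Ch L] [Labels Ch L'] {g : L → L'}

theorem Tr.mapLabel (hg : LabelHom Ch g) {E E' : Expr Ch V L} {ℓ : L} (h : Tr E ℓ E') :
    Tr (E.mapLabel g) (g ℓ) (E'.mapLabel g) := by
  induction h with
  | pre ℓ E => exact Tr.pre _ _
  | sum j _ ih => exact Tr.sum j ih
  | parL _ ih => exact Tr.parL ih
  | parR _ ih => exact Tr.parR ih
  | comm h _ _ ih ih' => exact Tr.comm ((hg.comm _ _ _).2 ⟨_, rfl, h⟩) ih ih'
  | res h _ ih => exact Tr.res ((hg.unrestricted _ _).2 h) ih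
  | ren _ ih => rw [← hg.ren]; exact Tr.ren ih
  | fix _ ih => rw [mapLabel_unfold] at ih; exact Tr.fix ih

/-- Relabelling prefixes creates no new transitions. The induction is on the transition, with E left
general, because unfolding a recursion changes the expression but commutes with relabelling. -/
theorem Tr.of_mapLabel (hg : LabelHom Ch g) {F F' : Expr Ch V L'} {m : L'} (h : Tr F m F') :
    ∀ {E : Expr Ch V L}, F = E.mapLabel g →
      ∃ ℓ E', m = g ℓ ∧ F' = E'.mapLabel g ∧ Tr E ℓ E' := by
  induction h with
  | pre ℓ F =>
    intro E hE
    cases E <;> cases hE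
    exact ⟨_, _, rfl, rfl, Tr.pre _ _⟩
  | sum j _ ih =>
    intro E hE
    cases E <;> cases hE
    obtain ⟨ℓ, E', rfl, rfl, h⟩ := ih rfl
    exact ⟨_, _, rfl, rfl, Tr.sum j h⟩
  | parL _ ih =>
    intro E hE
    cases E <;> cases hE
    obtain ⟨ℓ, E', rfl, rfl, h⟩ := ih rfl
    exact ⟨_, par E' _, rfl, rfl, Tr.parL h⟩
  | parR _ ih =>
    intro E hE
    cases E <;> cases hE
    obtain ⟨ℓ, E', rfl, rfl, h⟩ := ih rfl
    exact ⟨_, par _ E', rfl, rfl, Tr.parR h⟩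
  | comm hc _ _ ih ih' =>
    intro E hE
    cases E <;> cases hE
    obtain ⟨ℓ, E₁, rfl, rfl, h⟩ := ih rfl
    obtain ⟨ℓ', E₂, rfl, rfl, h'⟩ := ih' rfl
    obtain ⟨ℓ'', rfl, hc'⟩ := (hg.comm _ _ _).1 hc
    exact ⟨_, par E₁ E₂, rfl, rfl, Tr.comm hc' h h'⟩
  | res hu _ ih =>
    intro E hE
    cases E <;> cases hE
    obtain ⟨ℓ, E', rfl, rfl, h⟩ := ih rfl
    exact ⟨_, Expr.res E' _, rfl, rfl, Tr.res ((hg.unrestricted _ _).1 hu) h⟩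
  | ren _ ih =>
    intro E hE
    cases E <;> cases hE
    obtain ⟨ℓ, E', rfl, rfl, h⟩ := ih rfl
    exact ⟨_, Expr.ren E' _, hg.ren _ _, rfl, Tr.ren h⟩
  | fix _ ih =>
    intro E hE
    cases E <;> cases hE
    obtain ⟨ℓ, E', rfl, rfl, h⟩ := ih (mapLabel_unfold g _ _ _).symm
    exact ⟨_, _, rfl, rfl, Tr.fix h⟩

end Expr

namespace Closed

variable {Ch V L L' : Type u} [Labels Ch L] [Labels Ch L'] {g : L → L'}

/-- The target of a transition from a closed expression, as a closed expression. -/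
def target (E : Closed Ch V L) {ℓ : L} {E' : Expr Ch V L} (h : Expr.Tr E.1 ℓ E') : Closed Ch V L :=
  ⟨E', Expr.Closed.of_tr h E.2⟩

theorem step_mapLabel (hg : LabelHom Ch g) {E E' : Closed Ch V L} {ℓ : L} (h : E.Step ℓ E') :
    (E.mapLabel g).Step (g ℓ) (E'.mapLabel g) :=
  Expr.Tr.mapLabel hg h

theorem of_step_mapLabel (hg : LabelHom Ch g) {E : Closed Ch V L} {F : Closed Ch V L'} {m : L'}
    (h : (E.mapLabel g).Step m F) : ∃ ℓ E', m = g ℓ ∧ F = E'.mapLabel g ∧ E.Step ℓ E' := by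
  obtain ⟨ℓ, E', rfl, h1, h2⟩ := Expr.Tr.of_mapLabel hg h rfl
  exact ⟨ℓ, E.target h2, rfl, Subtype.ext h1, h2⟩

theorem step_par {E F G : Closed Ch V L} {ℓ : L} : (E.par F).Step ℓ G ↔
    (∃ E', E.Step ℓ E' ∧ G = E'.par F) ∨ (∃ F', F.Step ℓ F' ∧ G = E.par F') ∨
    ∃ ℓ₁ ℓ₂ E' F', Labels.Comm Ch ℓ₁ ℓ₂ ℓ ∧ E.Step ℓ₁ E' ∧ F.Step ℓ₂ F' ∧ G = E'.par F' := by
  constructor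
  · obtain ⟨G, hG⟩ := G
    intro h
    generalize hx : (E.par F).1 = x at h
    unfold Step at h
    cases h with
    | parL h => cases hx; exact Or.inl ⟨E.target h, h, rfl⟩
    | parR h => cases hx; exact Or.inr (Or.inl ⟨F.target h, h, rfl⟩)
    | comm hc h h' =>
      cases hx; exact Or.inr (Or.inr ⟨_, _, E.target h, F.target h', hc, h, h', rfl⟩)

  · rintro (⟨E', h, rfl⟩ | ⟨F', h, rfl⟩ | ⟨ℓ₁, ℓ₂, E', F', hc, h, h', rfl⟩)
    · exact Expr.Tr.parL h
    · exact Expr.Tr.parR h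
    · exact Expr.Tr.comm hc h h'

end Closed

/-! ### Countable transition systems as CCS expressions -/

section Graph

variable {Ch V L : Type u} [Infinite V]

/-- The body of the recursive specification of a transition relation between natural numbers. -/
noncomputable def graphSpec (Ch : Type u) (t : ℕ → L → ℕ → Prop)
    (Y : Set.range (Infinite.natEmbedding V)) : Expr Ch V L :=
  Expr.sum {x : L × ULift.{u} ℕ //
      t (Function.invFun (Infinite.natEmbedding V) Y.1) x.1 x.2.down}
    fun x => Expr.pre x.1.1 (Expr.var (Infinite.natEmbedding V x.1.2.down))

/-- The state `n` of a transition relation between natural numbers, as a CCS expression. -/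
noncomputable def graph (Ch V : Type u) [Infinite V] (t : ℕ → L → ℕ → Prop) (n : ℕ) :
    Closed Ch V L :=
  ⟨Expr.fix (Set.range (Infinite.natEmbedding V)) (graphSpec Ch t)
    ⟨Infinite.natEmbedding V n, n, rfl⟩, fun _ _ => Or.inr ⟨_, rfl⟩⟩

/-- Numbers are encoded as variables by an embedding, and `Function.invFun` decodes them. Unfolding
replaces the variable for m by the expression for state m, so the summands are exactly the steps of
t from n. -/
theorem graph_tr [Labels Ch L] {t : ℕ → L → ℕ → Prop} {n : ℕ} {ℓ : L} {E : Closed Ch V L} :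
    (graph Ch V t n).Step ℓ E ↔ ∃ m, t n ℓ m ∧ E = graph Ch V t m := by
  have hinv : Function.invFun (Infinite.natEmbedding V) (Infinite.natEmbedding V n) = n :=
    Function.leftInverse_invFun (Infinite.natEmbedding V).injective n
  have hunf : Expr.unfold (Set.range (Infinite.natEmbedding V)) (graphSpec Ch t)
      ⟨Infinite.natEmbedding V n, n, rfl⟩ =
      Expr.sum {x : L × ULift.{u} ℕ //
        t (Function.invFun (Infinite.natEmbedding V) (Infinite.natEmbedding V n)) x.1 x.2.down}
        fun x => Expr.pre x.1.1 (graph Ch V t x.1.2.down).1 := by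
    simp only [Expr.unfold, graphSpec, Expr.subst]
    congr 1
    funext x
    rw [dif_pos ⟨_, rfl⟩]
    rfl
  constructor
  · intro h
    obtain ⟨E, hE⟩ := E
    cases h with
    | fix h =>
      rw [hunf] at h
      cases h with
      | sum j h =>
        obtain ⟨⟨ℓ', ⟨m⟩⟩, hj⟩ := j
        rw [hinv] at hj
        cases h
        exact ⟨m, hj, rfl⟩
  · rintro ⟨m, h, rfl⟩
    refine Expr.Tr.fix ?_
    rw [hunf]
    exact Expr.Tr.sum ⟨(ℓ, ⟨m⟩), by rwa [hinv]⟩ (Expr.Tr.pre _ _)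

theorem graph_allLabels {t : ℕ → L → ℕ → Prop} {p : L → Prop} (h : ∀ n ℓ m, t n ℓ m → p ℓ)
    (n : ℕ) : (graph Ch V t n).1.AllLabels p :=
  fun _ x => ⟨h _ _ _ x.2, trivial⟩

end Graph

end RewardTesting

namespace RewardTesting

/-! ### Reward tests as contexts -/

theorem Ctx.outcomes_map_mv {A : Type u} {S S' : Type*} {C : Ctx A S ℝ} {D : Ctx A S' ℝ}
    (F : S → S') (hC : ∀ s, C.live s) (hD : ∀ s, D.live s)
    (hf : ∀ s a r s', C.Mv s a r s' → D.Mv (F s) a r (F s'))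
    (hb : ∀ s a r y, D.Mv (F s) a r y → ∃ s', F s' = y ∧ C.Mv s a r s') (s : S)
    (P : LTS.{u, v} A) : D.outcomes (F s) P = C.outcomes s P := by
  refine outcomes_map (X := S × P.State) (Y := S' × P.State)
    (fun x => (F x.1, x.2)) ?_ ?_ (s, P.init)
  · rintro ⟨s, p⟩ r ⟨s', p'⟩ hst
    replace hst : C.Step 0 P (s, p) r (s', p') := hst
    change D.Step 0 P (F s, p) r (F s', p')
    cases hst with
    | own h =>
      rcases hf s none r s' (Or.inl ⟨rfl, h⟩) with ⟨-, h1⟩ | ⟨b, h1, -⟩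
      · exact Step.own h1
      · cases h1
    | tau _ h => exact Step.tau (hD _) h
    | @sync _ _ a _ _ _ h1 h2 h3 =>
      rcases hf s (some a) r s' (Or.inr ⟨a, rfl, h1, h2⟩) with ⟨h4, -⟩ | ⟨b, h4, -, h5⟩
      · cases h4
      · cases h4
        exact Step.sync (hD _) h5 h3
  · rintro ⟨s, p⟩ r ⟨y, p'⟩ hst
    replace hst : D.Step 0 P (F s, p) r (y, p') := hst
    cases hst with
    | own h =>
      obtain ⟨s', rfl, ⟨-, h1⟩ | ⟨b, h1, -⟩⟩ := hb s none r y (Or.inl ⟨rfl, h⟩)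
      · exact ⟨(s', p), rfl, Step.own h1⟩
      · cases h1
    | tau _ h => exact ⟨(s, p'), rfl, Step.tau (hC s) h⟩
    | @sync _ _ a _ _ _ h1 h2 h3 =>
      obtain ⟨s', rfl, ⟨h4, -⟩ | ⟨b, h4, -, h5⟩⟩ := hb s (some a) r y (Or.inr ⟨a, rfl, h1, h2⟩)
      · cases h4
      · cases h4
        exact ⟨(s', p'), rfl, Step.sync (hC s) h5 h3⟩

section Interaction

variable {Ch V L : Type u}

theorem Vis.compl_compl (a : Vis Ch) : a.compl.compl = a := by
  cases a <;> rfl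

/-- The transitions of a test in parallel with a process. -/
theorem step_par_mapLabel [Labels Ch L] {g : Act (Vis Ch) → L} (hg : LabelHom Ch g)
    {T G : Closed Ch V L} {P : Proc Ch V} {ℓ : L} : (T.par (P.mapLabel g)).Step ℓ G ↔
    (∃ T', T.Step ℓ T' ∧ G = T'.par (P.mapLabel g)) ∨
    (∃ α P', P.Step α P' ∧ ℓ = g α ∧ G = T.par (P'.mapLabel g)) ∨
    ∃ ℓ' α T' P', Labels.Comm Ch ℓ' (g α) ℓ ∧ T.Step ℓ' T' ∧ P.Step α P' ∧
      G = T'.par (P'.mapLabel g) := by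
  rw [Closed.step_par]
  constructor
  · rintro (h | ⟨F, h, rfl⟩ | ⟨ℓ₁, ℓ₂, T', F, hc, h1, h2, rfl⟩)
    · exact Or.inl h
    · obtain ⟨α, P', rfl, rfl, h'⟩ := Closed.of_step_mapLabel hg h
      exact Or.inr (Or.inl ⟨α, P', h', rfl, rfl⟩)
    · obtain ⟨α, P', rfl, rfl, h⟩ := Closed.of_step_mapLabel hg h2
      exact Or.inr (Or.inr ⟨ℓ₁, α, T', P', hc, h1, h, rfl⟩)
  · rintro (h | ⟨α, P', h, rfl, rfl⟩ | ⟨ℓ', α, T', P', hc, h1, h2, rfl⟩)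
    · exact Or.inl h
    · exact Or.inr (Or.inl ⟨_, Closed.step_mapLabel hg h, rfl⟩)
    · exact Or.inr (Or.inr ⟨_, _, T', _, hc, h1, Closed.step_mapLabel hg h2, rfl⟩)

theorem RewAct.labelHom (Ch : Type u) :
    LabelHom Ch (fun α : Act (Vis Ch) => (⟨α, 0⟩ : RewAct Ch)) where
  unrestricted _ _ := Iff.rfl
  ren _ _ := rfl
  comm α β := by
    rintro ⟨γ, r⟩
    constructor
    · rintro ⟨h, hr⟩
      have hr : r = 0 := by simpa using hr
      subst hr
      exact ⟨γ, rfl, h⟩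
    · rintro ⟨γ, h, hc⟩
      cases h
      exact ⟨hc, by simp⟩

theorem TestAct.labelHom (Ch : Type u) : LabelHom Ch (TestAct.act (Ch := Ch)) where
  unrestricted _ _ := Iff.rfl
  ren _ _ := rfl
  comm α β m := by
    constructor
    · rintro ⟨α', β', γ, h, h1, h2, rfl⟩
      cases h1
      cases h2
      exact ⟨γ, rfl, h⟩
    · rintro ⟨γ, rfl, h⟩
      exact ⟨α, β, γ, h, rfl, rfl, rfl⟩

end Interaction

section RewardTests

variable {Ch V : Type u}

theorem RewTest.run_step {T G : RewTest Ch V} {P : Proc Ch V} {r : ℝ} :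
    (T.run P).Step ⟨.tau, r⟩ G ↔
      (∃ T', T.Step ⟨.tau, r⟩ T' ∧ G = RewTest.run T' P) ∨
      (∃ P', P.Step .tau P' ∧ r = 0 ∧ G = T.run P') ∨
      ∃ a T' P', T.Step ⟨.vis a.compl, r⟩ T' ∧ P.Step (.vis a) P' ∧ G = RewTest.run T' P' := by
  unfold RewTest.run
  rw [step_par_mapLabel (RewAct.labelHom Ch)]
  refine or_congr Iff.rfl (or_congr ⟨?_, ?_⟩ ⟨?_, ?_⟩)
  · rintro ⟨α, P', h, h', rfl⟩
    cases h'
    exact ⟨P', h, rfl, rfl⟩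
  · rintro ⟨P', h, rfl, rfl⟩
    exact ⟨_, P', h, rfl, rfl⟩
  · rintro ⟨⟨α', s⟩, α, T', P', ⟨⟨a, h1, h2, -⟩, hr⟩, h3, h4, rfl⟩
    simp only at h1 h2
    subst h1 h2
    obtain rfl : r = s := by simpa using hr
    exact ⟨a.compl, T', P', by rwa [Vis.compl_compl], h4, rfl⟩
  · rintro ⟨a, T', P', h1, h2, rfl⟩
    exact ⟨_, _, T', P', ⟨⟨a.compl, rfl, by rw [Vis.compl_compl], rfl⟩, by simp⟩, h1, h2, rfl⟩

/-- Reward tests as contexts. -/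
def rewCtx (Ch V : Type u) : Ctx (Vis Ch) (RewTest Ch V) ℝ where
  live _ := True
  own T r T' := T.Step ⟨.tau, r⟩ T'
  sync T a r T' := T.Step ⟨.vis a.compl, r⟩ T'

theorem rewards_eq_outcomes (T : RewTest Ch V) :
    {o | ∃ π : RewComputation T, o = π.reward} =
      Outcomes (fun x r y => Closed.Step x (⟨.tau, r⟩ : RewAct Ch) y) T := by
  apply Set.Subset.antisymm
  · rintro o ⟨π, rfl⟩
    by_cases h : π.len = ⊤
    · refine Or.inr ⟨π.st, π.r, π.st_zero, fun n => π.step n (by simp [h]), ?_⟩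
      unfold RewComputation.reward
      rw [if_pos h]
      rfl
    · obtain ⟨n, hn⟩ := ENat.ne_top_iff_exists.1 h
      have hr : Run (fun x r y => Closed.Step x (⟨.tau, r⟩ : RewAct Ch) y) n (π.st 0)
          (∑ i ∈ Finset.range n, π.r i) (π.st n) :=
        Run.of_seq fun i hi => π.step i (by rw [← hn]; exact_mod_cast hi)
      rw [π.st_zero] at hr
      refine Or.inl ⟨n, _, _, hr, π.final n hn, ?_⟩
      unfold RewComputation.reward
      rw [if_neg h, ← hn]
      rfl
  · rintro o (⟨n, t, y, hr, hy, rfl⟩ | ⟨s, r, h0, hs, rfl⟩)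
    · obtain ⟨s, r, h0, rfl, hs, rfl⟩ := hr.exists_seq
      refine ⟨⟨n, s, r, h0, fun i hi => hs i (by exact_mod_cast hi), ?_⟩, ?_⟩
      · intro i hi
        obtain rfl : i = n := by exact_mod_cast hi
        exact hy
      · unfold RewComputation.reward
        simp
    · refine ⟨⟨⊤, s, r, h0, fun i _ => hs i, fun i hi => absurd hi (by simp)⟩, ?_⟩
      unfold RewComputation.reward
      simp only [if_true]
      rfl

/-- Parallel composition maps the steps of P in the context onto the internal steps of the combined
system, and every such internal step arises in this way. -/
theorem applyRew_eq_outcomes (T : RewTest Ch V) (P : Proc Ch V) :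
    applyRew T P = (rewCtx Ch V).outcomes T P.toLTS := by
  unfold applyRew
  rw [rewards_eq_outcomes]
  refine outcomes_map (X := RewTest Ch V × Proc Ch V) (st := (rewCtx Ch V).Step 0 P.toLTS)
    (fun x => RewTest.run x.1 x.2) ?_ ?_ (T, P)
  · rintro ⟨T, p⟩ r ⟨T', p'⟩ hst
    replace hst : (rewCtx Ch V).Step 0 P.toLTS (T, p) r (T', p') := hst
    cases hst with
    | own h => exact RewTest.run_step.2 (Or.inl ⟨_, h, rfl⟩)
    | tau _ h => exact RewTest.run_step.2 (Or.inr (Or.inl ⟨_, h, rfl, rfl⟩))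
    | sync _ h h' => exact RewTest.run_step.2 (Or.inr (Or.inr ⟨_, _, _, h, h', rfl⟩))
  · rintro ⟨T, p⟩ r G h
    rcases RewTest.run_step.1 h with ⟨T', h1, rfl⟩ | ⟨p', h1, rfl, rfl⟩ | ⟨a, T', p', h1, h2, rfl⟩
    · exact ⟨(T', p), rfl, Ctx.Step.own h1⟩
    · exact ⟨(T, p'), rfl, Ctx.Step.tau (P := P.toLTS) trivial h1⟩
    · exact ⟨(T', p'), rfl, Ctx.Step.sync (P := P.toLTS) trivial h1 h2⟩

theorem rewCtx_mv {T T' : RewTest Ch V} {a : Option (Vis Ch)} {r : ℝ}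
    (h : (rewCtx Ch V).Mv T a r T') : ∃ α, T.Step ⟨α, r⟩ T' := by
  rcases h with ⟨-, h⟩ | ⟨b, -, -, h⟩
  · exact ⟨_, h⟩
  · exact ⟨_, h⟩

theorem RewTest.FinitePenalty.rewCtx {T : RewTest Ch V} (h : T.FinitePenalty) :
    (rewCtx Ch V).FinitePenalty T := by
  intro st a r h0 hs
  choose α hα using fun n => rewCtx_mv (hs n)
  exact h st (fun n => ⟨α n, r n⟩) h0 hα

theorem rewCtx_rewardInv {p : ℝ → Prop} (hp : ∀ r s, p r → p s → p (r + s)) :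
    (rewCtx Ch V).RewardInv (fun T => T.1.AllLabels fun ℓ => p ℓ.rew) p := by
  intro T a r T' hT hm
  obtain ⟨α, h⟩ := rewCtx_mv hm
  exact Expr.AllLabels.of_tr (p := fun ℓ : RewAct Ch => p ℓ.rew) (fun _ _ h => h)
    (fun ℓ ℓ' ℓ'' h h1 h2 => by rw [h.2]; exact hp _ _ h1 h2) h hT

/-! ### Contexts on the natural numbers as reward tests -/

variable [Infinite V]

/-- A context on the natural numbers as a reward test. -/
noncomputable def rewTest (V : Type u) [Infinite V] (C : Ctx (Vis Ch) ℕ ℝ) (n : ℕ) :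
    RewTest Ch V :=
  graph Ch V (fun k ℓ k' => match ℓ.act with
    | .tau => C.own k ℓ.rew k'
    | .vis b => C.sync k b.compl ℓ.rew k') n

variable {C : Ctx (Vis Ch) ℕ ℝ}

theorem rewTest_step {n : ℕ} {ℓ : RewAct Ch} {G : RewTest Ch V} (hC : ∀ k, C.live k)
    (h : (rewTest V C n).Step ℓ G) : ∃ m a, C.Mv n a ℓ.rew m ∧ G = rewTest V C m := by
  obtain ⟨m, hm, rfl⟩ := graph_tr.1 h
  obtain ⟨_ | b, r⟩ := ℓ
  · exact ⟨m, none, Or.inl ⟨rfl, hm⟩, rfl⟩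
  · exact ⟨m, some b.compl, Or.inr ⟨_, rfl, hC n, hm⟩, rfl⟩

theorem rewTest_mv {n m : ℕ} {a : Option (Vis Ch)} {r : ℝ}
    (h : C.Mv n a r m) : (rewCtx Ch V).Mv (rewTest V C n) a r (rewTest V C m) := by
  rcases h with ⟨rfl, h⟩ | ⟨b, rfl, -, h⟩
  · exact Or.inl ⟨rfl, graph_tr.2 ⟨m, h, rfl⟩⟩
  · exact Or.inr ⟨b, rfl, trivial, graph_tr.2 ⟨m, by simpa only [Vis.compl_compl] using h, rfl⟩⟩

theorem rewTest_mv_cases (hC : ∀ k, C.live k) {n : ℕ} {a : Option (Vis Ch)} {r : ℝ}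
    {T : RewTest Ch V} (h : (rewCtx Ch V).Mv (rewTest V C n) a r T) :
    ∃ m, rewTest V C m = T ∧ C.Mv n a r m := by
  rcases h with ⟨rfl, h⟩ | ⟨b, rfl, -, h⟩
  · obtain ⟨m, hm, rfl⟩ := graph_tr.1 h
    exact ⟨m, rfl, Or.inl ⟨rfl, hm⟩⟩
  · obtain ⟨m, hm, rfl⟩ := graph_tr.1 h
    exact ⟨m, rfl, Or.inr ⟨b, rfl, hC n, by simpa only [Vis.compl_compl] using hm⟩⟩

theorem applyRew_rewTest (hC : ∀ k, C.live k) (n : ℕ) (P : Proc Ch V) :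
    applyRew (rewTest V C n) P = C.outcomes n P.toLTS := by
  rw [applyRew_eq_outcomes]
  exact Ctx.outcomes_map_mv (rewTest V C) hC (fun _ => trivial) (fun _ _ _ _ => rewTest_mv)
    (fun _ _ _ _ => rewTest_mv_cases hC) n P.toLTS

theorem rewTest_allLabels {p : ℝ → Prop} (hC : ∀ k, C.live k)
    (h : C.RewardInv (fun _ => True) p) (n : ℕ) :
    (rewTest V C n).1.AllLabels fun ℓ => p ℓ.rew := by
  refine graph_allLabels (fun n ℓ m hm => ?_) n
  obtain ⟨_ | b, r⟩ := ℓ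
  · exact (h n none r m trivial (Or.inl ⟨rfl, hm⟩)).2
  · exact (h n (some b.compl) r m trivial (Or.inr ⟨_, rfl, hC n, hm⟩)).2

/-- Every path of the test, visible transitions included, traces a path of moves of C, along which
the potential bounds the number of penalties. -/
theorem rewTest_finitePenalty (hC : ∀ k, C.live k) {μ : ℕ → ℕ} (h : C.Potential μ) (n : ℕ) :
    (rewTest V C n).FinitePenalty := by
  intro st ℓ h0 hs
  obtain ⟨q, hq0, hq⟩ := exists_seq_of_step (Z := ℕ × ℕ) (Q := fun x => st x.1 = rewTest V C x.2)
    (R := fun _ x y => y.1 = x.1 + 1 ∧ ∃ a, C.Mv x.2 a (ℓ x.1).rew y.2) (z := (0, n)) h0 (by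
      rintro - ⟨i, k⟩ hk
      have := hs i
      simp only at hk
      rw [hk] at this
      obtain ⟨m, a, hm, hG⟩ := rewTest_step hC this
      exact ⟨(i + 1, m), hG, rfl, a, hm⟩)
  have hn : ∀ n, (q n).1 = n := by
    intro n
    induction n with
    | zero => rw [hq0]
    | succ n ih => rw [(hq n).2.1, ih]
  refine finite_of_potential (μ := fun i => μ (q i).2) fun i => ?_
  obtain ⟨a, ha⟩ := (hq i).2.2
  rw [hn] at ha
  exact h _ _ _ _ ha

/-! ### Characterisations of the reward preorders -/

variable {P Q : Proc Ch V}

/-- This and the four characterisations below share one pattern: the chains needed for completeness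
are CCS tests of the permitted kind, and every permitted test is a context meeting the hypothesis of
the matching soundness result. -/
theorem reward_iff : Reward P Q ↔ NDFD P.toLTS Q.toLTS := by
  constructor
  · refine fun h => Ctx.ndfd_of_chain fun c ρ e => ?_
    have := h (rewTest V (Ctx.chain c ρ e) 1) trivial
    rwa [applyRew_rewTest (fun _ => trivial), applyRew_rewTest (fun _ => trivial)] at this
  · intro h T _
    rw [applyRew_eq_outcomes, applyRew_eq_outcomes]
    exact Ctx.smythLE_of_ndfd h _ T

theorem negReward_iff : NegReward P Q ↔ TraceInf P.toLTS Q.toLTS := by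
  constructor
  · refine fun h => Ctx.traceInf_of_chain fun c ρ hρ => ?_
    have := h (rewTest V (Ctx.chain c ρ fun _ _ => False) 1) (rewTest_allLabels (p := (· ≤ 0))
      (fun _ => trivial) (Ctx.chain_rewardInv hρ (Or.inr fun _ _ => id)) 1)
    rwa [applyRew_rewTest (fun _ => trivial), applyRew_rewTest (fun _ => trivial)] at this
  · intro h T hT
    rw [applyRew_eq_outcomes, applyRew_eq_outcomes]
    exact Ctx.smythLE_of_traceInf h (rewCtx_rewardInv fun _ _ => add_nonpos) hT

theorem fpReward_iff : FpReward P Q ↔ FDId P.toLTS Q.toLTS := by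
  constructor
  · refine fun h => Ctx.fdid_of_chain fun c k e => ?_
    have := h (rewTest V (Ctx.chain c (Ctx.negReward k) e) 1)
      (rewTest_finitePenalty (fun _ => trivial) (Ctx.chain_potential c k e) 1)
    rwa [applyRew_rewTest (fun _ => trivial), applyRew_rewTest (fun _ => trivial)] at this
  · intro h T hT
    rw [applyRew_eq_outcomes, applyRew_eq_outcomes]
    exact Ctx.smythLE_of_fdid h hT.rewCtx

theorem fpNegReward_iff : FpNegReward P Q ↔ Trace P.toLTS Q.toLTS := by
  constructor
  · refine fun h => Ctx.trace_of_chain fun c k => ?_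
    have := h (rewTest V (Ctx.chain c (Ctx.negReward k) fun _ _ => False) 1)
      ⟨rewTest_finitePenalty (fun _ => trivial) (Ctx.chain_potential c k _) 1,
        rewTest_allLabels (p := (· ≤ 0)) (fun _ => trivial)
          (Ctx.chain_rewardInv (Ctx.negReward_nonpos k) (Or.inr fun _ _ => id)) 1⟩
    rwa [applyRew_rewTest (fun _ => trivial), applyRew_rewTest (fun _ => trivial)] at this
  · intro h T hT
    rw [applyRew_eq_outcomes, applyRew_eq_outcomes]
    exact Ctx.smythLE_of_trace h (rewCtx_rewardInv fun _ _ => add_nonpos) hT.2 hT.1.rewCtx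

theorem posReward_iff : PosReward P Q ↔ FDIbot P.toLTS Q.toLTS := by
  constructor
  · refine fun h => Ctx.fdibot_of_chain fun c e ⟨o, ho, ho'⟩ => ?_
    have := h (rewTest V (Ctx.chain c (fun _ => 0) e) 1) (rewTest_allLabels (p := (0 ≤ ·))
      (fun _ => trivial) (Ctx.chain_rewardInv (fun _ => le_rfl) (Or.inl zero_le_one)) 1)
    rw [applyRew_rewTest (fun _ => trivial), applyRew_rewTest (fun _ => trivial)] at this
    obtain ⟨o', h1, h2⟩ := this o ho
    exact ⟨o', h1, h2.trans ho'⟩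
  · intro h T hT
    rw [applyRew_eq_outcomes, applyRew_eq_outcomes]
    exact Ctx.smythLE_of_fdibot h (rewCtx_rewardInv fun _ _ => add_nonneg) hT

end RewardTests

end RewardTesting

namespace RewardTesting

/-! ### Classical tests -/

section ClassicalTests

variable {Ch V : Type u}

namespace Test

/-- The test can report success. -/
def Succeeds (T : Test Ch V) : Prop := ∃ T', T.Step .omega T'

theorem run_step {T G : Test Ch V} {P : Proc Ch V} :
    (T.run P).Step (.act .tau) G ↔
      (∃ T', T.Step (.act .tau) T' ∧ G = Test.run T' P) ∨
      (∃ P', P.Step .tau P' ∧ G = T.run P') ∨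
      ∃ a T' P', T.Step (.act (.vis a.compl)) T' ∧ P.Step (.vis a) P' ∧ G = Test.run T' P' := by
  unfold Test.run
  rw [step_par_mapLabel (TestAct.labelHom Ch)]
  refine or_congr Iff.rfl (or_congr ⟨?_, ?_⟩ ⟨?_, ?_⟩)
  · rintro ⟨α, P', h, h', rfl⟩
    cases h'
    exact ⟨P', h, rfl⟩
  · rintro ⟨P', h, rfl⟩
    exact ⟨_, P', h, rfl, rfl⟩
  · rintro ⟨ℓ', α, T', P', ⟨_, _, _, ⟨a, rfl, rfl, rfl⟩, rfl, h2, -⟩, h3, h4, rfl⟩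
    cases h2
    exact ⟨a.compl, T', P', by rwa [Vis.compl_compl], h4, rfl⟩
  · rintro ⟨a, T', P', h1, h2, rfl⟩
    exact ⟨_, _, T', P', ⟨_, _, _, ⟨a.compl, rfl, rfl, rfl⟩, rfl, by rw [Vis.compl_compl], rfl⟩,
      h1, h2, rfl⟩

/-- The process never performs the success action, and synchronisation never produces it. -/
theorem succeeds_run {T : Test Ch V} {P : Proc Ch V} : (T.run P).Succeeds ↔ T.Succeeds := by
  unfold Succeeds Test.run
  simp only [step_par_mapLabel (TestAct.labelHom Ch)]
  constructor
  · rintro ⟨G, ⟨T', h, -⟩ | ⟨α, P', -, h, -⟩ | ⟨ℓ', α, T', P', ⟨_, _, _, -, -, -, h⟩, -⟩⟩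
    · exact ⟨T', h⟩
    · cases h
    · cases h
  · rintro ⟨T', h⟩
    exact ⟨_, Or.inl ⟨T', h, rfl⟩⟩

open Classical in
/-- Reaching success is rewarded by `1`. -/
noncomputable def gain (T T' : Test Ch V) : ℝ := if ¬ T.Succeeds ∧ T'.Succeeds then 1 else 0

theorem gain_nonneg (T T' : Test Ch V) : 0 ≤ gain T T' := by
  unfold gain
  split_ifs <;> norm_num

theorem gain_run (T T' : Test Ch V) (P P' : Proc Ch V) :
    gain (T.run P) (T'.run P') = gain T T' := by
  unfold gain
  rw [succeeds_run, succeeds_run]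

theorem gain_self (T : Test Ch V) : gain T T = 0 := by
  unfold gain
  rw [if_neg]
  tauto

theorem gain_eq_zero {T T' : Test Ch V} (h : gain T T' = 0) (hT : ¬ T.Succeeds) :
    ¬ T'.Succeeds := by
  intro hT'
  unfold gain at h
  rw [if_pos ⟨hT, hT'⟩] at h
  exact one_ne_zero h

/-- The internal steps of a test, rewarded if they reach success. -/
def Tau (T : Test Ch V) (r : ℝ) (T' : Test Ch V) : Prop :=
  T.Step (.act .tau) T' ∧ r = gain T T'

end Test

/-- Classical tests as contexts. -/
noncomputable def testCtx (Ch V : Type u) : Ctx (Vis Ch) (Test Ch V) ℝ where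
  live _ := True
  own T r T' := T.Step (.act .tau) T' ∧ r = Test.gain T T'
  sync T a r T' := T.Step (.act (.vis a.compl)) T' ∧ r = Test.gain T T'

theorem testCtx_rewardInv : (testCtx Ch V).RewardInv (fun _ => True) (0 ≤ ·) := by
  rintro T a r T' - (⟨-, -, rfl⟩ | ⟨b, -, -, -, rfl⟩)
  · exact ⟨trivial, Test.gain_nonneg _ _⟩
  · exact ⟨trivial, Test.gain_nonneg _ _⟩

theorem testCtx_step_tau {P : Proc Ch V} {x : Test Ch V × Proc Ch V} {r : ℝ}
    {y : Test Ch V × Proc Ch V} (hst : (testCtx Ch V).Step 0 P.toLTS x r y) :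
    Test.Tau (Test.run x.1 x.2) r (Test.run y.1 y.2) := by
  obtain ⟨T, p⟩ := x
  obtain ⟨T', p'⟩ := y
  unfold Test.Tau
  rw [Test.gain_run]
  replace hst : (testCtx Ch V).Step 0 P.toLTS (T, p) r (T', p') := hst
  cases hst with
  | own h => exact ⟨Test.run_step.2 (Or.inl ⟨_, h.1, rfl⟩), h.2⟩
  | tau _ h =>
    exact ⟨Test.run_step.2 (Or.inr (Or.inl ⟨_, h, rfl⟩)), (Test.gain_self _).symm⟩
  | sync _ h h' =>
    exact ⟨Test.run_step.2 (Or.inr (Or.inr ⟨_, _, _, h.1, h', rfl⟩)), h.2⟩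

theorem testCtx_step_of_tau {P : Proc Ch V} {x : Test Ch V × Proc Ch V} {r : ℝ} {G : Test Ch V}
    (h : Test.Tau (Test.run x.1 x.2) r G) :
    ∃ y : Test Ch V × Proc Ch V, Test.run y.1 y.2 = G ∧ (testCtx Ch V).Step 0 P.toLTS x r y := by
  obtain ⟨T, p⟩ := x
  obtain ⟨h, rfl⟩ := h
  rcases Test.run_step.1 h with ⟨T', h1, rfl⟩ | ⟨p', h1, rfl⟩ | ⟨a, T', p', h1, h2, rfl⟩
  · exact ⟨(T', p), rfl, Ctx.Step.own ⟨h1, Test.gain_run _ _ _ _⟩⟩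
  · rw [Test.gain_run, Test.gain_self]
    exact ⟨(T, p'), rfl, Ctx.Step.tau (P := P.toLTS) trivial h1⟩
  · exact ⟨(T', p'), rfl, Ctx.Step.sync (P := P.toLTS) trivial ⟨h1, Test.gain_run _ _ _ _⟩ h2⟩

theorem tau_outcomes (T : Test Ch V) (P : Proc Ch V) :
    Outcomes Test.Tau (T.run P) = (testCtx Ch V).outcomes T P.toLTS :=
  outcomes_map (X := Test Ch V × Proc Ch V) (st := (testCtx Ch V).Step 0 P.toLTS)
    (fun x => Test.run x.1 x.2) (fun _ _ _ => testCtx_step_tau)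
    (fun _ _ _ => testCtx_step_of_tau) (T, P)

/-- Prepending a step to a computation. -/
noncomputable def Computation.cons {T T' : Test Ch V} (h : T.Step (.act .tau) T')
    (π : Computation T') : Computation T where
  len := π.len + 1
  st := seqCons T π.st
  st_zero := rfl
  step := by
    rintro (_ | n) hn
    · simpa [seqCons, π.st_zero] using h
    · refine π.step n ?_
      rw [Nat.cast_add, Nat.cast_one] at hn
      exact lt_of_add_lt_add_right hn
  final := by
    rintro (_ | n) hn
    · rw [Nat.cast_zero] at hn
      exact absurd hn.symm (by simp)
    · refine π.final n ?_
      rw [Nat.cast_add, Nat.cast_one] at hn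
      exact (WithTop.add_right_inj ENat.one_ne_top).1 hn

theorem Computation.Successful.cons {T T' : Test Ch V} (h : T.Step (.act .tau) T')
    {π : Computation T'} (hπ : π.Successful) : (π.cons h).Successful := by
  obtain ⟨n, hn, hT⟩ := hπ
  refine ⟨n + 1, ?_, hT⟩
  rw [Nat.cast_add, Nat.cast_one]
  exact add_le_add_left hn 1

/-- Gains are nonnegative, so a total of at most 0 makes each of them 0, and from an unsuccessful
start success is never reached. The conditions come after the existential, so that the lemma also
shows that computations exist at all. -/
theorem exists_computation_of_outcome {T : Test Ch V} {o : EReal} (ho : o ∈ Outcomes Test.Tau T) :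
    ∃ π : Computation T, o ≤ 0 → ¬ T.Succeeds → ¬ π.Successful := by
  have key : ∀ {s : ℕ → Test Ch V} {r : ℕ → ℝ} {N : ℕ},
      (∀ i < N, Test.Tau (s i) (r i) (s (i + 1))) →
      ∑ i ∈ Finset.range N, r i ≤ 0 → ¬ (s 0).Succeeds → ∀ n ≤ N, ¬ (s n).Succeeds := by
    intro s r N hs hsum h0 n
    have hr : ∀ i ∈ Finset.range N, 0 ≤ r i := fun i hi => by
      rw [(hs i (Finset.mem_range.1 hi)).2]
      exact Test.gain_nonneg _ _
    induction n with
    | zero => exact fun _ => h0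
    | succ n ih =>
      intro hn
      have := (Finset.sum_eq_zero_iff_of_nonneg hr).1 (hsum.antisymm (Finset.sum_nonneg hr)) n
        (Finset.mem_range.2 hn)
      rw [(hs n hn).2] at this
      exact Test.gain_eq_zero this (ih (Nat.le_of_succ_le hn))
  rcases ho with ⟨N, t, y, hr, hy, rfl⟩ | ⟨s, r, rfl, hs, rfl⟩
  · obtain ⟨s, r, rfl, rfl, hs, rfl⟩ := hr.exists_seq
    refine ⟨⟨N, s, rfl, fun i hi => (hs i (by exact_mod_cast hi)).1, ?_⟩, ?_⟩
    · intro i hi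
      obtain rfl : i = N := by exact_mod_cast hi
      exact fun T' h => hy _ T' ⟨h, rfl⟩
    · rintro ho hT ⟨n, hn, hn'⟩
      exact key hs (by exact_mod_cast ho) hT n (Nat.cast_le.1 hn) hn'
  · refine ⟨⟨⊤, s, rfl, fun i _ => (hs i).1, fun i hi => absurd hi (by simp)⟩, ?_⟩
    rintro ho hT ⟨n, -, hn'⟩
    have := (sum_le_limReward (N := n) fun i _ => by
      rw [(hs i).2]
      exact Test.gain_nonneg _ _).trans ho
    exact key (fun i _ => hs i) (by exact_mod_cast this) hT n le_rfl hn'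

theorem Computation.exists (T : Test Ch V) : Nonempty (Computation T) :=
  let ⟨_, ho⟩ := outcomes_nonempty Test.Tau T
  let ⟨π, _⟩ := exists_computation_of_outcome ho
  ⟨π⟩

theorem exists_unsuccessful_iff {T : Test Ch V} : (∃ π : Computation T, ¬ π.Successful) ↔
    ¬ T.Succeeds ∧ ∃ o ∈ Outcomes Test.Tau T, o ≤ 0 := by
  constructor
  · rintro ⟨π, hπ⟩
    have hs : ∀ n : ℕ, (n : ℕ∞) ≤ π.len → ¬ (π.st n).Succeeds := fun n hn h => hπ ⟨n, hn, h⟩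
    have hst : ∀ n : ℕ, (n : ℕ∞) < π.len → Test.Tau (π.st n) 0 (π.st (n + 1)) := by
      refine fun n hn => ⟨π.step n hn, ?_⟩
      unfold Test.gain
      rw [if_neg fun h => hs (n + 1) (by exact_mod_cast Order.add_one_le_of_lt hn) h.2]
    refine ⟨by simpa [π.st_zero] using hs 0 (by simp), 0, ?_, le_rfl⟩
    by_cases h : π.len = ⊤
    · refine Or.inr ⟨π.st, fun _ => 0, π.st_zero, fun n => hst n (by simp [h]), ?_⟩
      rw [limReward_eq_sum (N := 0) fun _ _ => rfl]
      simp
    · obtain ⟨n, hn⟩ := ENat.ne_top_iff_exists.1 h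
      have hr : Run Test.Tau n (π.st 0) (∑ i ∈ Finset.range n, 0) (π.st n) :=
        Run.of_seq fun i hi => hst i (by rw [← hn]; exact_mod_cast hi)
      rw [π.st_zero] at hr
      exact Or.inl ⟨n, _, _, hr, fun r z hz => π.final n hn z hz.1, by simp⟩
  · rintro ⟨hT, o, ho, ho'⟩
    obtain ⟨π, hπ⟩ := exists_computation_of_outcome ho
    exact ⟨π, hπ ho' hT⟩

/-- A finite run into a successful state can be prolonged to a maximal one, so maximality plays no
role for possible success. -/
theorem exists_successful_iff {T : Test Ch V} : (∃ π : Computation T, π.Successful) ↔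
    ∃ n t T', Run Test.Tau n T t T' ∧ T'.Succeeds := by
  constructor
  · rintro ⟨π, n, hn, h⟩
    have hr := Run.of_seq (st := Test.Tau) (s := π.st)
      (r := fun i => Test.gain (π.st i) (π.st (i + 1))) (n := n) fun i hi =>
        ⟨π.step i (lt_of_lt_of_le (by exact_mod_cast hi) hn), rfl⟩
    rw [π.st_zero] at hr
    exact ⟨n, _, _, hr, h⟩
  · rintro ⟨n, t, T', hr, h⟩
    induction hr with
    | refl T =>
      obtain ⟨π⟩ := Computation.exists T
      exact ⟨π, 0, by simp, by rwa [π.st_zero]⟩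
    | head hst _ ih =>
      obtain ⟨π, hπ⟩ := ih h
      exact ⟨π.cons hst.1, hπ.cons hst.1⟩

theorem fails_iff {T : Test Ch V} {P : Proc Ch V} :
    (∃ π : Computation (T.run P), ¬ π.Successful) ↔
      ¬ T.Succeeds ∧ ∃ o ∈ (testCtx Ch V).outcomes T P.toLTS, o ≤ 0 := by
  rw [exists_unsuccessful_iff, Test.succeeds_run, tau_outcomes]

theorem maySucceed_iff {T : Test Ch V} {P : Proc Ch V} :
    (∃ π : Computation (T.run P), π.Successful) ↔
      ∃ σ t T', (testCtx Ch V).Path T σ t T' ∧ T'.Succeeds ∧ σ ∈ P.toLTS.ptraces := by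
  rw [exists_successful_iff]
  constructor
  · rintro ⟨n, t, G, hr, hG⟩
    obtain ⟨⟨T', p'⟩, rfl, hr'⟩ := hr.of_map (X := Test Ch V × Proc Ch V)
      (st := (testCtx Ch V).Step 0 P.toLTS) (f := fun x => Test.run x.1 x.2)
      (fun _ _ _ => testCtx_step_of_tau) (x := (T, P)) rfl
    obtain ⟨σ, h1, h2⟩ := Ctx.exists_path_of_run hr'
    exact ⟨σ, t, T', h1, Test.succeeds_run.1 hG, p', h2⟩
  · rintro ⟨σ, t, T', h1, h2, q, hq⟩
    obtain ⟨n, p', hr, -⟩ := h1.exists_run hq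
    exact ⟨n, t, _, Run.map (X := Test Ch V × Proc Ch V) (st := (testCtx Ch V).Step 0 P.toLTS)
      (f := fun x => Test.run x.1 x.2) (fun _ _ _ => testCtx_step_tau) hr,
      Test.succeeds_run.2 h2⟩

variable {P Q : Proc Ch V}

/-- Every combined system has a computation, so the success outcome of Q is matched by any outcome
of P; the Smyth order demands something only for failure. -/
theorem mustTesting_iff_fails : MustTesting P Q ↔ ∀ T : Test Ch V,
    (∃ π : Computation (T.run Q), ¬ π.Successful) →
      ∃ π : Computation (T.run P), ¬ π.Successful := by
  constructor
  · intro h T hT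
    obtain ⟨o, ⟨rfl, -⟩ | ⟨-, h1⟩, h2⟩ := h T trivial ⊥ (Or.inr ⟨rfl, hT⟩)
    · exact absurd h2 (by decide)
    · exact h1
  · rintro h T - o (⟨rfl, -⟩ | ⟨rfl, hT⟩)
    · obtain ⟨π⟩ := Computation.exists (T.run P)
      by_cases hπ : π.Successful
      · exact ⟨⊤, Or.inl ⟨rfl, π, hπ⟩, le_rfl⟩
      · exact ⟨⊥, Or.inr ⟨rfl, π, hπ⟩, bot_le⟩
    · exact ⟨⊥, Or.inr ⟨rfl, h T hT⟩, le_rfl⟩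

theorem dualMustTesting_iff_maySucceed : DualMustTesting P Q ↔ ∀ T : Test Ch V,
    (∃ π : Computation (T.run Q), π.Successful) → ∃ π : Computation (T.run P), π.Successful := by
  constructor
  · intro h T hT
    obtain ⟨o, ⟨-, h1⟩ | ⟨rfl, -⟩, h2⟩ := h T trivial ⊥ (Or.inl ⟨rfl, hT⟩)
    · exact h1
    · exact absurd h2 (by decide)
  · rintro h T - o (⟨rfl, hT⟩ | ⟨rfl, -⟩)
    · exact ⟨⊥, Or.inl ⟨rfl, h T hT⟩, le_rfl⟩
    · obtain ⟨π⟩ := Computation.exists (T.run P)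
      by_cases hπ : π.Successful
      · exact ⟨⊥, Or.inl ⟨rfl, π, hπ⟩, bot_le⟩
      · exact ⟨⊤, Or.inr ⟨rfl, π, hπ⟩, le_rfl⟩

theorem mayTesting_iff_maySucceed : MayTesting Q P ↔ ∀ T : Test Ch V,
    (∃ π : Computation (T.run Q), π.Successful) → ∃ π : Computation (T.run P), π.Successful := by
  constructor
  · intro h T hT
    obtain ⟨o, ⟨-, h1⟩ | ⟨rfl, -⟩, h2⟩ := h T trivial ⊤ (Or.inl ⟨rfl, hT⟩)
    · exact h1
    · exact absurd h2 (by decide)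
  · rintro h T - o (⟨rfl, hT⟩ | ⟨rfl, -⟩)
    · exact ⟨⊤, Or.inl ⟨rfl, h T hT⟩, le_rfl⟩
    · obtain ⟨π⟩ := Computation.exists (T.run P)
      by_cases hπ : π.Successful
      · exact ⟨⊤, Or.inl ⟨rfl, π, hπ⟩, bot_le⟩
      · exact ⟨⊥, Or.inr ⟨rfl, π, hπ⟩, le_rfl⟩

/-! ### Chains as classical tests -/

variable [Infinite V] {c : ℕ → Option (Vis Ch)} {e : ℕ → Option (Vis Ch) → Prop}

/-- The test that behaves as a chain and succeeds by escaping. -/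
noncomputable def chainClassical (V : Type u) [Infinite V] (c : ℕ → Option (Vis Ch))
    (e : ℕ → Option (Vis Ch) → Prop) (n : ℕ) : Test Ch V :=
  graph Ch V (fun k ℓ k' => match ℓ with
    | .omega => k = 0
    | .act .tau => ∃ r, (Ctx.chain c (fun _ => 0) e).own k r k'
    | .act (.vis b) => ∃ r, (Ctx.chain c (fun _ => 0) e).sync k b.compl r k') n

theorem chainClassical_succeeds {n : ℕ} : (chainClassical V c e n).Succeeds ↔ n = 0 := by
  constructor
  · rintro ⟨T', h⟩
    obtain ⟨m, hm, -⟩ := graph_tr.1 h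
    exact hm
  · rintro rfl
    exact ⟨chainClassical V c e 0, graph_tr.2 ⟨0, rfl, rfl⟩⟩

/-- State 0 is the only successful one and is entered only by escaping, so the gain agrees with the
escape bonus of the zero-reward chain. -/
theorem chainClassical_gain {a : Option (Vis Ch)} {r : ℝ} {n m : ℕ}
    (h : (Ctx.chain c (fun _ => 0) e).Mv n a r m) :
    r = Test.gain (chainClassical V c e n) (chainClassical V c e m) := by
  unfold Test.gain
  simp only [chainClassical_succeeds]
  obtain ⟨i, rfl, ⟨-, -, rfl, rfl⟩ | ⟨-, rfl, rfl⟩⟩ := Ctx.chain_mv h <;> simp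

theorem chainClassical_mv {a : Option (Vis Ch)} {r : ℝ} {n m : ℕ}
    (h : (Ctx.chain c (fun _ => 0) e).Mv n a r m) :
    (testCtx Ch V).Mv (chainClassical V c e n) a r (chainClassical V c e m) := by
  have hr := chainClassical_gain (V := V) h
  rcases h with ⟨rfl, h⟩ | ⟨b, rfl, -, h⟩
  · exact Or.inl ⟨rfl, graph_tr.2 ⟨m, ⟨r, h⟩, rfl⟩, hr⟩
  · exact Or.inr ⟨b, rfl, trivial, graph_tr.2 ⟨m, ⟨r, by rwa [Vis.compl_compl]⟩, rfl⟩, hr⟩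

theorem chainClassical_mv_cases {a : Option (Vis Ch)} {r : ℝ} {n : ℕ} {T : Test Ch V}
    (h : (testCtx Ch V).Mv (chainClassical V c e n) a r T) :
    ∃ m, chainClassical V c e m = T ∧ (Ctx.chain c (fun _ => 0) e).Mv n a r m := by
  rcases h with ⟨rfl, h, rfl⟩ | ⟨b, rfl, -, h, rfl⟩
  · obtain ⟨m, ⟨r, hm⟩, rfl⟩ := graph_tr.1 h
    have hm : (Ctx.chain c (fun _ => 0) e).Mv n none r m := Or.inl ⟨rfl, hm⟩
    exact ⟨m, rfl, chainClassical_gain (V := V) hm ▸ hm⟩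
  · obtain ⟨m, ⟨r, hm⟩, rfl⟩ := graph_tr.1 h
    rw [Vis.compl_compl] at hm
    have hm : (Ctx.chain c (fun _ => 0) e).Mv n (some b) r m := Or.inr ⟨b, rfl, trivial, hm⟩
    exact ⟨m, rfl, chainClassical_gain (V := V) hm ▸ hm⟩

theorem chainClassical_outcomes (n : ℕ) (P : Proc Ch V) :
    (testCtx Ch V).outcomes (chainClassical V c e n) P.toLTS =
      (Ctx.chain c (fun _ => 0) e).outcomes n P.toLTS :=
  Ctx.outcomes_map_mv (chainClassical V c e) (fun _ => trivial) (fun _ => trivial)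
    (fun _ _ _ _ => chainClassical_mv) (fun _ _ _ _ => chainClassical_mv_cases) n P.toLTS

theorem chainClassical_path {n m : ℕ} {σ : List (Vis Ch)} {t : ℝ}
    (h : (Ctx.chain c (fun _ => 0) e).Path n σ t m) :
    (testCtx Ch V).Path (chainClassical V c e n) σ t (chainClassical V c e m) := by
  induction h with
  | refl n => exact Ctx.Path.refl _
  | own h _ ih => exact (Ctx.Path.of_mv (chainClassical_mv (Or.inl ⟨rfl, h⟩))).trans ih
  | sync h h' _ ih =>
    exact (Ctx.Path.of_mv (chainClassical_mv (Or.inr ⟨_, rfl, h, h'⟩))).trans ih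

theorem chainClassical_path_cases {T T' : Test Ch V} {σ : List (Vis Ch)} {t : ℝ}
    (h : (testCtx Ch V).Path T σ t T') : ∀ {n}, T = chainClassical V c e n →
      ∃ m, T' = chainClassical V c e m ∧ (Ctx.chain c (fun _ => 0) e).Path n σ t m := by
  induction h with
  | refl T => exact fun {n} h => ⟨n, h, Ctx.Path.refl n⟩
  | own h _ ih =>
    rintro n rfl
    obtain ⟨m, rfl, hm⟩ := chainClassical_mv_cases (Or.inl ⟨rfl, h⟩)
    obtain ⟨k, rfl, hk⟩ := ih rfl
    exact ⟨k, rfl, (Ctx.Path.of_mv hm).trans hk⟩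
  | sync h h' _ ih =>
    rintro n rfl
    obtain ⟨m, rfl, hm⟩ := chainClassical_mv_cases (Or.inr ⟨_, rfl, h, h'⟩)
    obtain ⟨k, rfl, hk⟩ := ih rfl
    exact ⟨k, rfl, (Ctx.Path.of_mv hm).trans hk⟩

/-- The test for `σ` succeeds for the processes with partial trace `σ`. -/
theorem maySucceed_chainClassical {σ : List (Vis Ch)} :
    (∃ π : Computation ((chainClassical V (fun i => σ[i]?)
      (fun i a => i = σ.length ∧ a = none) 1).run P), π.Successful) ↔ σ ∈ P.toLTS.ptraces := by
  rw [maySucceed_iff]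
  constructor
  · rintro ⟨ρ, t, T', h1, h2, h3⟩
    obtain ⟨m, rfl, hm⟩ := chainClassical_path_cases h1 rfl
    obtain rfl := chainClassical_succeeds.1 h2
    rcases (Ctx.chain_path_cases hm).2 0 rfl (by simp) with ⟨i, h4, -⟩
        | ⟨-, i, a, ⟨rfl, rfl⟩, h4, -⟩
    · cases h4
    · simp only [traceUpTo_getElem?, List.take_zero, List.nil_append, List.take_length,
        Option.toList_none, List.append_nil] at h4
      rwa [← h4]
  · intro h
    have hp := (Ctx.chain_path (c := fun i => σ[i]?) (ρ := fun _ => 0)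
      (e := fun i a => i = σ.length ∧ a = none) (i := σ.length)
      fun j hj => Ctx.getElem?_ne_none_of_lt hj).trans
      (Ctx.Path.of_mv (Or.inl ⟨rfl, σ.length, rfl, ⟨rfl, rfl⟩, rfl, rfl⟩))
    rw [traceUpTo_getElem?, List.take_length, Option.toList_none, List.append_nil] at hp
    exact ⟨σ, _, _, chainClassical_path hp, chainClassical_succeeds.2 rfl, h⟩

theorem maySucceed_iff_trace : (∀ T : Test Ch V,
    (∃ π : Computation (T.run Q), π.Successful) → ∃ π : Computation (T.run P), π.Successful) ↔
      Trace P.toLTS Q.toLTS := by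
  constructor
  · exact fun h σ hσ => maySucceed_chainClassical.1 (h _ (maySucceed_chainClassical.2 hσ))
  · intro h T
    rw [maySucceed_iff, maySucceed_iff]
    rintro ⟨σ, t, T', h1, h2, h3⟩
    exact ⟨σ, t, T', h1, h2, h h3⟩

theorem dualMustTesting_iff : DualMustTesting P Q ↔ Trace P.toLTS Q.toLTS :=
  dualMustTesting_iff_maySucceed.trans maySucceed_iff_trace

theorem mayTesting_iff : MayTesting Q P ↔ Trace P.toLTS Q.toLTS :=
  mayTesting_iff_maySucceed.trans maySucceed_iff_trace

theorem mustTesting_iff : MustTesting P Q ↔ FDIbot P.toLTS Q.toLTS := by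
  rw [mustTesting_iff_fails]
  constructor
  · refine fun h => Ctx.fdibot_of_chain fun c e ho => ?_
    have := h (chainClassical V c e 1)
    rw [fails_iff, fails_iff, chainClassical_outcomes, chainClassical_outcomes] at this
    exact (this ⟨by simp [chainClassical_succeeds], ho⟩).2
  · intro h T
    rw [fails_iff, fails_iff]
    rintro ⟨hT, o, ho, ho'⟩
    obtain ⟨o', h1, h2⟩ := Ctx.smythLE_of_fdibot h testCtx_rewardInv trivial o ho
    exact ⟨hT, o', h1, h2.trans ho'⟩

end ClassicalTests

end RewardTesting

namespace RewardTesting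

/-! ### Transition systems on the natural numbers -/

section NatLTS

variable {A : Type u}

/-- The state `n` of a transition relation on the natural numbers. -/
def natLTS (t : ℕ → Act A → ℕ → Prop) (n : ℕ) : LTS.{u, v} A :=
  ⟨ULift ℕ, fun x α y => t x.down α y.down, ⟨n⟩⟩

variable {t : ℕ → Act A → ℕ → Prop} {n : ℕ}

theorem natLTS_weak {x y : ULift.{v} ℕ} {σ : List A} :
    Weak (natLTS.{u, v} t n).tr x σ y ↔ Weak t x.down σ y.down := by
  constructor
  · intro h
    induction h with
    | refl p => exact Weak.refl _
    | tau h _ ih => exact Weak.tau h ih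
    | vis h _ ih => exact Weak.vis h ih
  · intro h
    obtain ⟨x⟩ := x
    obtain ⟨y⟩ := y
    simp only at h
    induction h with
    | refl p => exact Weak.refl _
    | @tau p q _ _ h _ ih => exact Weak.tau (tr := (natLTS.{u, v} t n).tr) (q := ⟨q⟩) h ih
    | @vis p q _ _ _ h _ ih => exact Weak.vis (tr := (natLTS.{u, v} t n).tr) (q := ⟨q⟩) h ih

theorem mem_ptraces_natLTS {σ : List A} :
    σ ∈ (natLTS.{u, v} t n).ptraces ↔ ∃ m, Weak t n σ m :=
  ⟨fun ⟨y, h⟩ => ⟨y.down, natLTS_weak.1 h⟩, fun ⟨m, h⟩ => ⟨⟨m⟩, natLTS_weak.2 h⟩⟩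

theorem mem_divergences_natLTS {σ : List A} : σ ∈ (natLTS.{u, v} t n).divergences ↔
    ∃ m, Weak t n σ m ∧ ∃ s : ℕ → ℕ, s 0 = m ∧ ∀ i, t (s i) .tau (s (i + 1)) := by
  constructor
  · rintro ⟨y, h, s, rfl, hs⟩
    exact ⟨_, natLTS_weak.1 h, fun i => (s i).down, rfl, hs⟩
  · rintro ⟨m, h, s, rfl, hs⟩
    exact ⟨⟨s 0⟩, natLTS_weak.2 h, fun i => ⟨s i⟩, rfl, hs⟩

theorem mem_infTraces_natLTS {ν : ℕ → A} : ν ∈ (natLTS.{u, v} t n).infTraces ↔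
    ∃ s : ℕ → ℕ, s 0 = n ∧ ∀ i, Weak t (s i) [ν i] (s (i + 1)) := by
  constructor
  · rintro ⟨s, h0, hs⟩
    exact ⟨fun i => (s i).down, congrArg ULift.down h0, fun i => natLTS_weak.1 (hs i)⟩
  · rintro ⟨s, rfl, hs⟩
    exact ⟨fun i => ⟨s i⟩, rfl, fun i => natLTS_weak.2 (hs i)⟩

/-- An infinite trace would yield an infinite strict descent of ranks. -/
theorem infTraces_natLTS_eq_empty (rank : ℕ → ℕ∞) (hτ : ∀ x y, t x .tau y → rank y ≤ rank x)
    (hvis : ∀ x a y, t x (.vis a) y → rank y < rank x) : (natLTS.{u, v} t n).infTraces = ∅ := by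
  have key : ∀ {x σ y}, Weak t x σ y → rank y ≤ rank x ∧ (σ ≠ [] → rank y < rank x) := by
    intro x σ y h
    induction h with
    | refl p => exact ⟨le_rfl, fun h => absurd rfl h⟩
    | tau h _ ih =>
      exact ⟨ih.1.trans (hτ _ _ h), fun hσ => (ih.2 hσ).trans_le (hτ _ _ h)⟩
    | vis h _ ih =>
      have := ih.1.trans_lt (hvis _ _ _ h)
      exact ⟨this.le, fun _ => this⟩
  refine Set.eq_empty_iff_forall_notMem.2 fun ν hν => ?_
  obtain ⟨s, -, hs⟩ := mem_infTraces_natLTS.1 hν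
  exact not_strictAnti_of_wellFoundedLT (fun i => rank (s i))
    (strictAnti_nat_of_succ_lt fun i => (key (hs i)).2 (by simp))

end NatLTS

/-! ### Initial divergence and divergence everywhere -/

section Divergence

variable {A : Type u} {P Q : LTS.{u, v} A}

theorem FDIbot.of_diverges (h : [] ∈ P.divergences) : FDIbot P Q :=
  ⟨fun _ _ => ⟨[], h, List.nil_prefix⟩, fun _ _ => Or.inr ⟨[], h, rfl⟩,
    fun _ _ => Or.inr ⟨[], h, List.nil_prefix⟩⟩

theorem LTS.divergences_of_loops (h : ∀ p, P.tr p .tau p) : P.divergences = P.ptraces :=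
  Set.Subset.antisymm (fun _ => LTS.ptraces_of_divergences)
    fun _ ⟨q, hq⟩ => ⟨q, hq, fun _ => q, rfl, fun _ => h q⟩

/-- When every state diverges, each partial trace is a divergence and no state is stable. An
infinite trace of Q then has all its prefixes among the divergences of P, whether or not P can
perform it. -/
theorem FDId.of_loops (hP : ∀ p, P.tr p .tau p) (hQ : ∀ q, Q.tr q .tau q)
    (h : Q.ptraces ⊆ P.ptraces) : FDId P Q := by
  have hd : Q.divergences ⊆ P.divergences := by
    rwa [LTS.divergences_of_loops hP, LTS.divergences_of_loops hQ]
  refine ⟨hd, ?_, ?_⟩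
  · rintro ν (hν | hν)
    · refine Or.inr fun σ hσ => ⟨σ, ?_, List.prefix_rfl, hσ⟩
      rw [LTS.divergences_of_loops hP]
      apply h
      rw [hσ, ← traceUpTo_some ν]
      exact (follows_some_iff.2 hν).traceUpTo_mem _
    · exact Or.inr fun σ hσ => let ⟨ρ, h1, h2⟩ := hν σ hσ; ⟨ρ, hd h1, h2⟩
  · rintro ⟨σ, X⟩ (hσ | hσ)
    · refine Or.inr (hd ?_)
      rw [LTS.divergences_of_loops hQ]
      exact LTS.ptraces_of_failures hσ
    · exact Or.inr (hd hσ)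

end Divergence

/-! ### Examples -/

section Examples

variable {A : Type u}

/-- The processes `Ω` (state `0`), `0` (state `1`), `Ω + a.0` (state `2`) and `Ω + a.Ω`
(state `3`). -/
inductive LoopTr (a : A) : ℕ → Act A → ℕ → Prop
  | zero : LoopTr a 0 .tau 0
  | two : LoopTr a 2 .tau 2
  | halt : LoopTr a 2 (.vis a) 1
  | three : LoopTr a 3 .tau 3
  | diverge : LoopTr a 3 (.vis a) 0

/-- The state `0` performs infinitely many `a`, the state `1` any finite number of them. All states
may diverge. -/
inductive CountTr (a : A) : ℕ → Act A → ℕ → Prop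
  | loop (n : ℕ) : CountTr a n .tau n
  | again : CountTr a 0 (.vis a) 0
  | choose (n : ℕ) : CountTr a 1 (.vis a) (n + 2)
  | next (n : ℕ) : CountTr a (n + 3) (.vis a) (n + 2)

variable {a : A}

theorem loopTr_weak {x y : ℕ} {σ : List A} (h : Weak (LoopTr a) x σ y) :
    (x ≤ 1 → y = x ∧ σ = []) ∧ (x = 2 → σ = [] ∨ y = 1) ∧ (σ = [] ∨ σ = [a]) := by
  induction h with
  | refl p => simp
  | tau h _ ih => cases h <;> exact ih
  | vis h _ ih =>
    cases h with
    | halt => exact ⟨by omega, fun _ => Or.inr (ih.1 le_rfl).1, Or.inr (by rw [(ih.1 le_rfl).2])⟩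
    | diverge => exact ⟨by omega, by omega, Or.inr (by rw [(ih.1 zero_le_one).2])⟩

theorem infTraces_loopTr (n : ℕ) : (natLTS.{u, v} (LoopTr a) n).infTraces = ∅ := by
  refine infTraces_natLTS_eq_empty (fun n => if n ≤ 1 then 0 else 1) ?_ ?_
  · rintro x y h
    cases h <;> simp
  · rintro x b y h
    cases h <;> simp

theorem mem_ptraces_loopTr_of_two_le {n : ℕ} (hn : n = 2 ∨ n = 3) {σ : List A} :
    σ ∈ (natLTS.{u, v} (LoopTr a) n).ptraces ↔ σ = [] ∨ σ = [a] := by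
  rw [mem_ptraces_natLTS]
  constructor
  · rintro ⟨m, h⟩
    exact (loopTr_weak h).2.2
  · rintro (rfl | rfl)
    · exact ⟨n, Weak.refl n⟩
    · rcases hn with rfl | rfl
      · exact ⟨1, Weak.vis .halt (Weak.refl _)⟩
      · exact ⟨0, Weak.vis .diverge (Weak.refl _)⟩

theorem mem_ptraces_loopTr_of_le_one {n : ℕ} (hn : n ≤ 1) {σ : List A} :
    σ ∈ (natLTS.{u, v} (LoopTr a) n).ptraces ↔ σ = [] := by
  rw [mem_ptraces_natLTS]
  constructor
  · rintro ⟨m, h⟩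
    exact ((loopTr_weak h).1 hn).2
  · rintro rfl
    exact ⟨n, Weak.refl n⟩

theorem nil_mem_divergences_loopTr {n : ℕ} (h : LoopTr a n .tau n) :
    [] ∈ (natLTS.{u, v} (LoopTr a) n).divergences :=
  mem_divergences_natLTS.2 ⟨n, Weak.refl n, fun _ => n, rfl, fun _ => h⟩

theorem traceInf_two_three : TraceInf (natLTS.{u, v} (LoopTr a) 2) (natLTS.{u, v} (LoopTr a) 3) :=
  ⟨fun σ hσ => (mem_ptraces_loopTr_of_two_le (Or.inl rfl)).2
    ((mem_ptraces_loopTr_of_two_le (Or.inr rfl)).1 hσ), by simp [infTraces_loopTr]⟩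

theorem traceInf_three_two : TraceInf (natLTS.{u, v} (LoopTr a) 3) (natLTS.{u, v} (LoopTr a) 2) :=
  ⟨fun σ hσ => (mem_ptraces_loopTr_of_two_le (Or.inr rfl)).2
    ((mem_ptraces_loopTr_of_two_le (Or.inl rfl)).1 hσ), by simp [infTraces_loopTr]⟩

/-- After a, state 3 reaches the loop 0, while state 2 reaches 1, which has no transition. -/
theorem not_fdid_two_three :
    ¬ FDId (natLTS.{u, v} (LoopTr a) 2) (natLTS.{u, v} (LoopTr a) 3) := by
  intro h
  have : [a] ∈ (natLTS.{u, v} (LoopTr a) 3).divergences := mem_divergences_natLTS.2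
    ⟨0, Weak.vis .diverge (Weak.refl _), fun _ => 0, rfl, fun _ => .zero⟩
  obtain ⟨m, h1, s, rfl, hs⟩ := mem_divergences_natLTS.1 (h.1 this)
  have h2 := ((loopTr_weak h1).2.1 rfl).resolve_left (by simp)
  have h3 := hs 0
  rw [h2] at h3
  cases h3

theorem traceInf_of_le_one {n m : ℕ} (hn : n ≤ 1) (hm : m ≤ 1) :
    TraceInf (natLTS.{u, v} (LoopTr a) n) (natLTS.{u, v} (LoopTr a) m) :=
  ⟨fun σ hσ => (mem_ptraces_loopTr_of_le_one hn).2 ((mem_ptraces_loopTr_of_le_one hm).1 hσ),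
    by simp [infTraces_loopTr]⟩

theorem not_fdibot_one_zero :
    ¬ FDIbot (natLTS.{u, v} (LoopTr a) 1) (natLTS.{u, v} (LoopTr a) 0) := by
  intro h
  obtain ⟨ρ, h1, -⟩ := h.1 ⟨[], nil_mem_divergences_loopTr .zero, List.prefix_rfl⟩
  obtain ⟨m, h2, s, rfl, hs⟩ := mem_divergences_natLTS.1 h1
  have h3 := hs 0
  rw [((loopTr_weak h2).1 le_rfl).1] at h3
  cases h3

theorem not_trace_zero_two :
    ¬ Trace (natLTS.{u, v} (LoopTr a) 0) (natLTS.{u, v} (LoopTr a) 2) := fun h => by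
  have := (mem_ptraces_loopTr_of_le_one zero_le_one).1
    (h ((mem_ptraces_loopTr_of_two_le (σ := [a]) (Or.inl rfl)).2 (Or.inr rfl)))
  cases this

theorem mem_ptraces_countTr {n : ℕ} (hn : n = 0 ∨ n = 1) {σ : List A} :
    σ ∈ (natLTS.{u, v} (CountTr a) n).ptraces ↔ ∀ b ∈ σ, b = a := by
  rw [mem_ptraces_natLTS]
  constructor
  · rintro ⟨m, h⟩
    clear hn
    induction h with
    | refl p => simp
    | tau _ _ ih => exact ih
    | vis h _ ih =>
      intro b hb
      rcases List.mem_cons.1 hb with rfl | hb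
      · cases h <;> rfl
      · exact ih b hb
  · intro h
    rcases hn with rfl | rfl
    · refine ⟨0, ?_⟩
      induction σ with
      | nil => exact Weak.refl 0
      | cons b σ ih =>
        obtain rfl := h b (by simp)
        exact Weak.vis .again (ih fun c hc => h c (by simp [hc]))
    · have key : ∀ {σ : List A}, (∀ b ∈ σ, b = a) → Weak (CountTr a) (σ.length + 2) σ 2 := by
        intro σ h
        induction σ with
        | nil => exact Weak.refl 2
        | cons b σ ih =>
          obtain rfl := h b (by simp)
          exact Weak.vis (.next _) (ih fun c hc => h c (by simp [hc]))
      rcases σ with _ | ⟨b, σ⟩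
      · exact ⟨1, Weak.refl 1⟩
      · obtain rfl := h b (by simp)
        exact ⟨2, Weak.vis (.choose _) (key fun c hc => h c (by simp [hc]))⟩

theorem fdid_countTr {n m : ℕ} (hn : n = 0 ∨ n = 1) (hm : m = 0 ∨ m = 1) :
    FDId (natLTS.{u, v} (CountTr a) n) (natLTS.{u, v} (CountTr a) m) :=
  FDId.of_loops (fun _ => .loop _) (fun _ => .loop _)
    fun _ hσ => (mem_ptraces_countTr hn).2 ((mem_ptraces_countTr hm).1 hσ)

/-- The first visible action from state 1 fixes a counter, which every later one lowers without
passing below 2; hence only finitely many can follow. State 0 repeats the action forever. -/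
theorem not_traceInf_countTr :
    ¬ TraceInf (natLTS.{u, v} (CountTr a) 1) (natLTS.{u, v} (CountTr a) 0) := by
  intro h
  obtain ⟨s, h0, hs⟩ := mem_infTraces_natLTS.1 (h.2 (mem_infTraces_natLTS.2
    ⟨fun _ => 0, rfl, fun _ => Weak.vis (.again (a := a)) (Weak.refl 0)⟩))
  have key : ∀ {x σ y}, Weak (CountTr a) x σ y → (2 ≤ x → y + σ.length = x ∧ 2 ≤ y) ∧
      (x = 1 → σ ≠ [] → 2 ≤ y) := by
    intro x σ y h
    induction h with
    | refl p => simp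
    | tau h _ ih => cases h; exact ih
    | vis h _ ih =>
      rw [List.length_cons]
      cases h with
      | again => omega
      | choose n => exact ⟨by omega, fun _ _ => (ih.1 (by omega)).2⟩
      | next n => exact ⟨fun _ => ⟨by have := (ih.1 (by omega)).1; omega, (ih.1 (by omega)).2⟩,
          by omega⟩
  have h1 := (key (hs 0)).2 h0 (by simp)
  have h2 : ∀ i, s (i + 1) + i = s 1 ∧ 2 ≤ s (i + 1) := by
    intro i
    induction i with
    | zero => exact ⟨rfl, h1⟩
    | succ i ih =>
      have := (key (hs (i + 1))).1 ih.2
      rw [List.length_singleton] at this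
      omega
  have := h2 (s 1)
  omega

end Examples

/-! ### Examples as CCS processes -/

section GraphProcesses

variable {Ch V : Type u} [Infinite V] {t : ℕ → Act (Vis Ch) → ℕ → Prop} {n m : ℕ}

variable (V) in
theorem bisimilar_graph (n : ℕ) :
    Bisimilar (natLTS t n) (Proc.toLTS (graph Ch V t n)) := by
  refine Bisimilar.of_map (fun x => graph Ch V t x.down) rfl ?_ ?_
  · exact fun p α p' h => graph_tr.2 ⟨p'.down, h, rfl⟩
  · intro p α q h
    obtain ⟨m, hm, rfl⟩ := graph_tr.1 h
    exact ⟨⟨m⟩, hm, rfl⟩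

/-- A transitive relation containing `NDFD` is invariant under bisimilarity, so the examples can be
analysed on the natural numbers. -/
theorem graph_iff {R : LTS.{u, u + 1} (Vis Ch) → LTS.{u, u + 1} (Vis Ch) → Prop}
    (htrans : ∀ P Q S, R P Q → R Q S → R P S) (hR : ∀ P Q, NDFD P Q → R P Q) :
    R (Proc.toLTS (graph Ch V t n)) (Proc.toLTS (graph Ch V t m)) ↔
      R (natLTS t n) (natLTS t m) :=
  ⟨fun h => htrans _ _ _ (hR _ _ (bisimilar_graph V n).ndfd)
    (htrans _ _ _ h (hR _ _ (bisimilar_graph V m).symm.ndfd)),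
    fun h => htrans _ _ _ (hR _ _ (bisimilar_graph V n).symm.ndfd)
      (htrans _ _ _ h (hR _ _ (bisimilar_graph V m).ndfd))⟩

end GraphProcesses

end RewardTesting

namespace RewardTesting

/-! ### Separating examples in CCS -/

section Separation

variable {Ch V : Type u} [Infinite V]

instance [Infinite Ch] : Infinite (Vis Ch) :=
  Infinite.of_injective Vis.name fun _ _ h => by cases h; rfl

/-- The state `n` of `LoopTr` as a CCS process. -/
noncomputable def loopProc (V : Type u) [Infinite V] (c : Ch) (n : ℕ) : Proc Ch V :=
  graph Ch V (LoopTr (Vis.name c)) n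

/-- The state `n` of `CountTr` as a CCS process. -/
noncomputable def countProc (V : Type u) [Infinite V] (c : Ch) (n : ℕ) : Proc Ch V :=
  graph Ch V (CountTr (Vis.name c)) n

variable {c : Ch} {n m : ℕ}

theorem isPreord_traceInf {A : Type u} : IsPreord (TraceInf (A := A)) :=
  ⟨fun _ => ⟨subset_rfl, subset_rfl⟩, fun _ _ _ h h' => ⟨h'.1.trans h.1, h'.2.trans h.2⟩⟩

theorem negReward_loopProc : NegReward (loopProc V c n) (loopProc V c m) ↔
    TraceInf (natLTS.{u, u + 1} (LoopTr (Vis.name c)) n) (natLTS (LoopTr (Vis.name c)) m) :=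
  negReward_iff.trans (graph_iff isPreord_traceInf.trans fun _ _ h => h.traceInf)

theorem fpReward_loopProc : FpReward (loopProc V c n) (loopProc V c m) ↔
    FDId (natLTS.{u, u + 1} (LoopTr (Vis.name c)) n) (natLTS (LoopTr (Vis.name c)) m) :=
  fpReward_iff.trans (graph_iff isPreord_fdid.trans fun _ _ h => h.fdid)

theorem posReward_loopProc : PosReward (loopProc V c n) (loopProc V c m) ↔
    FDIbot (natLTS.{u, u + 1} (LoopTr (Vis.name c)) n) (natLTS (LoopTr (Vis.name c)) m) :=
  posReward_iff.trans (graph_iff isPreord_fdibot.trans fun _ _ h => h.fdid.fdibot)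

theorem fpNegReward_loopProc : FpNegReward (loopProc V c n) (loopProc V c m) ↔
    Trace (natLTS.{u, u + 1} (LoopTr (Vis.name c)) n) (natLTS (LoopTr (Vis.name c)) m) :=
  fpNegReward_iff.trans (graph_iff isPreord_trace.trans fun _ _ h => h.traceInf.trace)

theorem negReward_countProc : NegReward (countProc V c n) (countProc V c m) ↔
    TraceInf (natLTS.{u, u + 1} (CountTr (Vis.name c)) n) (natLTS (CountTr (Vis.name c)) m) :=
  negReward_iff.trans (graph_iff isPreord_traceInf.trans fun _ _ h => h.traceInf)

theorem fpReward_countProc : FpReward (countProc V c n) (countProc V c m) ↔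
    FDId (natLTS.{u, u + 1} (CountTr (Vis.name c)) n) (natLTS (CountTr (Vis.name c)) m) :=
  fpReward_iff.trans (graph_iff isPreord_fdid.trans fun _ _ h => h.fdid)

variable (V) in
theorem fpReward_equivalent_countProc (c : Ch) :
    Equivalent FpReward (countProc V c 1) (countProc V c 0) :=
  ⟨fpReward_countProc.2 (fdid_countTr (Or.inr rfl) (Or.inl rfl)),
    fpReward_countProc.2 (fdid_countTr (Or.inl rfl) (Or.inr rfl))⟩

variable (V) in
theorem not_negReward_countProc (c : Ch) : ¬ NegReward (countProc V c 1) (countProc V c 0) :=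
  fun h => not_traceInf_countTr (negReward_countProc.1 h)

variable (V) in
theorem posReward_equivalent_loopProc (c : Ch) (hn : n = 0 ∨ n = 2 ∨ n = 3)
    (hm : m = 0 ∨ m = 2 ∨ m = 3) : Equivalent PosReward (loopProc V c n) (loopProc V c m) := by
  have key : ∀ {n : ℕ}, n = 0 ∨ n = 2 ∨ n = 3 → LoopTr (Vis.name c) n .tau n := by
    rintro _ (rfl | rfl | rfl)
    exacts [.zero, .two, .three]
  exact ⟨posReward_loopProc.2 (.of_diverges (nil_mem_divergences_loopTr (key hn))),
    posReward_loopProc.2 (.of_diverges (nil_mem_divergences_loopTr (key hm)))⟩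

variable (V) in
theorem negReward_equivalent_two_three (c : Ch) :
    Equivalent NegReward (loopProc V c 2) (loopProc V c 3) :=
  ⟨negReward_loopProc.2 traceInf_two_three, negReward_loopProc.2 traceInf_three_two⟩

variable (V) in
theorem negReward_equivalent_one_zero (c : Ch) :
    Equivalent NegReward (loopProc V c 1) (loopProc V c 0) :=
  ⟨negReward_loopProc.2 (traceInf_of_le_one le_rfl zero_le_one),
    negReward_loopProc.2 (traceInf_of_le_one zero_le_one le_rfl)⟩

variable (V) in
theorem not_fpReward_two_three (c : Ch) : ¬ FpReward (loopProc V c 2) (loopProc V c 3) :=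
  fun h => not_fdid_two_three (fpReward_loopProc.1 h)

variable (V) in
theorem not_posReward_one_zero (c : Ch) : ¬ PosReward (loopProc V c 1) (loopProc V c 0) :=
  fun h => not_fdibot_one_zero (posReward_loopProc.1 h)

variable (V) in
theorem not_fpNegReward_zero_two (c : Ch) : ¬ FpNegReward (loopProc V c 0) (loopProc V c 2) :=
  fun h => not_trace_zero_two (fpNegReward_loopProc.1 h)

end Separation

/-! ### Inclusions and equalities between the testing preorders -/

section Order

variable (Ch V : Type u) [Infinite V]

theorem reward_le_negReward : (Reward : Proc Ch V → Proc Ch V → Prop) ≤ NegReward :=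
  fun _ _ h => negReward_iff.2 (reward_iff.1 h).traceInf

theorem reward_le_fpReward : (Reward : Proc Ch V → Proc Ch V → Prop) ≤ FpReward :=
  fun _ _ h => fpReward_iff.2 (reward_iff.1 h).fdid

theorem negReward_le_fpNegReward : (NegReward : Proc Ch V → Proc Ch V → Prop) ≤ FpNegReward :=
  fun _ _ h => fpNegReward_iff.2 (negReward_iff.1 h).trace

theorem fpReward_le_fpNegReward : (FpReward : Proc Ch V → Proc Ch V → Prop) ≤ FpNegReward :=
  fun _ _ h => fpNegReward_iff.2 (fpReward_iff.1 h).trace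

theorem fpReward_le_posReward : (FpReward : Proc Ch V → Proc Ch V → Prop) ≤ PosReward :=
  fun _ _ h => posReward_iff.2 (fpReward_iff.1 h).fdibot

theorem mustTesting_eq_posReward : (MustTesting : Proc Ch V → Proc Ch V → Prop) = PosReward := by
  funext P Q
  exact propext (mustTesting_iff.trans posReward_iff.symm)

theorem fpNegReward_eq : (FpNegReward : Proc Ch V → Proc Ch V → Prop) = onCCS Trace := by
  funext P Q
  exact propext fpNegReward_iff

theorem fpReward_eq : (FpReward : Proc Ch V → Proc Ch V → Prop) = onCCS FDId := by
  funext P Q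
  exact propext fpReward_iff

theorem reward_eq : (Reward : Proc Ch V → Proc Ch V → Prop) = onCCS NDFD := by
  funext P Q
  exact propext reward_iff

theorem posReward_eq : (PosReward : Proc Ch V → Proc Ch V → Prop) = onCCS FDIbot := by
  funext P Q
  exact propext posReward_iff

theorem dualMustTesting_eq : (DualMustTesting : Proc Ch V → Proc Ch V → Prop) = FpNegReward := by
  funext P Q
  exact propext (dualMustTesting_iff.trans fpNegReward_iff.symm)

end Order

end RewardTesting

theorem mainTheorem8 (Ch V : Type u) [Infinite V] :
    -- the testing preorders and their explicit characterisations, node by node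
    ((Reward : Proc Ch V → Proc Ch V → Prop) = onCCS NDFD) ∧
    ((NegReward : Proc Ch V → Proc Ch V → Prop) = onCCS TraceInf) ∧
    ((FpReward : Proc Ch V → Proc Ch V → Prop) = onCCS FDId) ∧
    ((MustTesting : Proc Ch V → Proc Ch V → Prop) = PosReward ∧
      (PosReward : Proc Ch V → Proc Ch V → Prop) = onCCS FDIbot) ∧
    ((fun P Q : Proc Ch V => MayTesting Q P) = DualMustTesting ∧
      (DualMustTesting : Proc Ch V → Proc Ch V → Prop) = FpNegReward ∧
      (FpNegReward : Proc Ch V → Proc Ch V → Prop) = onCCS Trace) ∧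
    -- the coarsest precongruences preserving linear-time, conditional liveness, liveness and
    -- safety properties exist and coincide with the corresponding testing preorders
    (Infinite Ch →
      (∃ R, IsCoarsestPrecongruence R PreservesLinearTime ∧
        (Reward : Proc Ch V → Proc Ch V → Prop) = onCCS R) ∧
      (∃ R, IsCoarsestPrecongruence R PreservesCondLiveness ∧
        (FpReward : Proc Ch V → Proc Ch V → Prop) = onCCS R) ∧
      (∃ R, IsCoarsestPrecongruence R PreservesLiveness ∧
        (MustTesting : Proc Ch V → Proc Ch V → Prop) = onCCS R)) ∧
    (∃ R, IsCoarsestPrecongruence R PreservesSafety ∧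
      (FpNegReward : Proc Ch V → Proc Ch V → Prop) = onCCS R) ∧
    -- the arrows, in the coarser direction
    ((Reward : Proc Ch V → Proc Ch V → Prop) ≤ NegReward ∧
      (Reward : Proc Ch V → Proc Ch V → Prop) ≤ FpReward ∧
      (NegReward : Proc Ch V → Proc Ch V → Prop) ≤ FpNegReward ∧
      (FpReward : Proc Ch V → Proc Ch V → Prop) ≤ FpNegReward ∧
      (FpReward : Proc Ch V → Proc Ch V → Prop) ≤ PosReward) ∧
    (Nonempty Ch →
      -- all arrows are strict
      ((Reward : Proc Ch V → Proc Ch V → Prop) < NegReward ∧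
        (Reward : Proc Ch V → Proc Ch V → Prop) < FpReward ∧
        (NegReward : Proc Ch V → Proc Ch V → Prop) < FpNegReward ∧
        (FpReward : Proc Ch V → Proc Ch V → Prop) < FpNegReward ∧
        (FpReward : Proc Ch V → Proc Ch V → Prop) < PosReward) ∧
      -- the nodes not connected by arrows are incomparable
      (¬ (NegReward : Proc Ch V → Proc Ch V → Prop) ≤ FpReward ∧
        ¬ (FpReward : Proc Ch V → Proc Ch V → Prop) ≤ NegReward ∧
        ¬ (NegReward : Proc Ch V → Proc Ch V → Prop) ≤ PosReward ∧
        ¬ (PosReward : Proc Ch V → Proc Ch V → Prop) ≤ NegReward ∧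
        ¬ (PosReward : Proc Ch V → Proc Ch V → Prop) ≤ FpNegReward ∧
        ¬ (FpNegReward : Proc Ch V → Proc Ch V → Prop) ≤ PosReward) ∧
      -- the separating examples, which separate also the associated equivalences
      (∃ P Q : Proc Ch V, Equivalent FpReward P Q ∧ ¬ NegReward P Q) ∧
      (∃ P Q : Proc Ch V, Equivalent MustTesting P Q ∧ Equivalent NegReward P Q ∧
        ¬ FpReward P Q) ∧
      (∃ P Q : Proc Ch V, Equivalent FpNegReward P Q ∧ ¬ PosReward P Q) ∧
      (∃ P Q : Proc Ch V, Equivalent PosReward P Q ∧ ¬ FpNegReward P Q)) := by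
  -- The examples directly refute three inclusions, `hnegPos`, `hfpNeg` and `hposFpNeg`. The other
  -- refutations follow by composing with the inclusions already known.
  have hnegPos : ∀ c : Ch, ¬ (NegReward : Proc Ch V → Proc Ch V → Prop) ≤ PosReward := fun c h =>
    not_posReward_one_zero V c (h _ _ (negReward_equivalent_one_zero V c).1)
  have hnegFp : ∀ c : Ch, ¬ (NegReward : Proc Ch V → Proc Ch V → Prop) ≤ FpReward := fun c h =>
    hnegPos c (h.trans (fpReward_le_posReward Ch V))
  have hfpNeg : ∀ c : Ch, ¬ (FpReward : Proc Ch V → Proc Ch V → Prop) ≤ NegReward := fun c h =>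
    not_negReward_countProc V c (h _ _ (fpReward_equivalent_countProc V c).1)
  have hposFpNeg : ∀ c : Ch, ¬ (PosReward : Proc Ch V → Proc Ch V → Prop) ≤ FpNegReward :=
    fun c h => not_fpNegReward_zero_two V c
      (h _ _ (posReward_equivalent_loopProc V c (Or.inl rfl) (Or.inr (Or.inl rfl))).1)
  have hfpNegPos : ∀ c : Ch, ¬ (FpNegReward : Proc Ch V → Proc Ch V → Prop) ≤ PosReward :=
    fun c h => hnegPos c ((negReward_le_fpNegReward Ch V).trans h)
  refine ⟨reward_eq Ch V, funext₂ fun _ _ => propext negReward_iff, fpReward_eq Ch V,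
    ⟨mustTesting_eq_posReward Ch V, posReward_eq Ch V⟩,
    ⟨funext₂ fun _ _ => propext (mayTesting_iff.trans dualMustTesting_iff.symm),
      dualMustTesting_eq Ch V, fpNegReward_eq Ch V⟩,
    fun _ => ⟨⟨NDFD, isCoarsest_ndfd, reward_eq Ch V⟩, ⟨FDId, isCoarsest_fdid, fpReward_eq Ch V⟩,
      ⟨FDIbot, isCoarsest_fdibot, (mustTesting_eq_posReward Ch V).trans (posReward_eq Ch V)⟩⟩,
    ⟨Trace, isCoarsest_trace, fpNegReward_eq Ch V⟩,
    ⟨reward_le_negReward Ch V, reward_le_fpReward Ch V, negReward_le_fpNegReward Ch V,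
      fpReward_le_fpNegReward Ch V, fpReward_le_posReward Ch V⟩, ?_⟩
  rintro ⟨c⟩
  -- Strictness: the reverse of each inclusion, composed with another of the five, would give an
  -- inclusion that has been refuted.
  refine ⟨⟨⟨reward_le_negReward Ch V, fun h => hnegFp c (h.trans (reward_le_fpReward Ch V))⟩,
      ⟨reward_le_fpReward Ch V, fun h => hfpNeg c (h.trans (reward_le_negReward Ch V))⟩,
      ⟨negReward_le_fpNegReward Ch V, fun h => hfpNeg c ((fpReward_le_fpNegReward Ch V).trans h)⟩,
      ⟨fpReward_le_fpNegReward Ch V, fun h => hnegFp c ((negReward_le_fpNegReward Ch V).trans h)⟩,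
      ⟨fpReward_le_posReward Ch V, fun h => hposFpNeg c (h.trans (fpReward_le_fpNegReward Ch V))⟩⟩,
    ⟨hnegFp c, hfpNeg c, hnegPos c, fun h => hposFpNeg c (h.trans (negReward_le_fpNegReward Ch V)),
      hposFpNeg c, hfpNegPos c⟩,
    ⟨_, _, fpReward_equivalent_countProc V c, not_negReward_countProc V c⟩,
    ⟨_, _, ?_, negReward_equivalent_two_three V c, not_fpReward_two_three V c⟩,
    ⟨_, _, ⟨negReward_le_fpNegReward Ch V _ _ (negReward_equivalent_one_zero V c).1,
      negReward_le_fpNegReward Ch V _ _ (negReward_equivalent_one_zero V c).2⟩,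
      not_posReward_one_zero V c⟩,
    ⟨_, _, posReward_equivalent_loopProc V c (Or.inl rfl) (Or.inr (Or.inl rfl)),
      not_fpNegReward_zero_two V c⟩⟩
  rw [mustTesting_eq_posReward]
  exact posReward_equivalent_loopProc V c (Or.inr (Or.inl rfl)) (Or.inr (Or.inr rfl))
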